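/- Let $\boldsymbol{\alpha}=(\alpha_2,\alpha_3,\ldots)$ be a finitely supported sequence of nonnegative integers, and put $\langle\boldsymbol{\alpha}\rangle=\sum_{j\ge2}(j-1)\alpha_j$. A \emph{minimal factorization of type} $\boldsymbol{\alpha}$ is a way of writing the $n$-cycle $(1\,2\ldots n)$, $n=\langle\boldsymbol{\alpha}\rangle+1$, as a product $\sigma_m\cdots\sigma_1$ (composed from right to left) of cycles of length at least $2$ in $S_n$, of which exactly $\alpha_j$ are $j$-cycles for each $j\ge2$; for $n=1$ the only one is the empty product. Two minimal factorizations are equivalent if one is obtained from the other by repeatedly exchanging neighbouring commuting factors. The heads (tails) of an equivalence class are the cycles that occur as the leftmost factor $\sigma_m$ (the rightmost factor $\sigma_1$) of some member of the class. Let $\widetilde H_{\boldsymbol{h},\boldsymbol{t}}(\boldsymbol{\alpha})$ be the number of equivalence classes of minimal factorizations of type $\boldsymbol{\alpha}$ that have, for each $j\ge2$, exactly $h_j$ different $j$-cycles as heads and exactly $t_j$ different $j$-cycles as tails. Define the formal power series with integer coefficients \[ g(\boldsymbol{x},\boldsymbol{v},\boldsymbol{u})=\sum_{\boldsymbol{\alpha}}\sum_{\boldsymbol{h}}\sum_{\boldsymbol{t}}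 \widetilde H_{\boldsymbol{h},\boldsymbol{t}}(\boldsymbol{\alpha})\prod_{j\ge2}x_j^{\alpha_j}u_j^{h_j}v_j^{t_j}. \] Then there is exactly one formal power series $f=f(\boldsymbol{x},\boldsymbol{v},\boldsymbol{u})$ with integer coefficients that satisfies \[ f=1+\sum_{n\ge2}x_n\,(f^n-1+v_n)\,\hat f^{\,n-1},\qquad \hat f(\boldsymbol{x},\boldsymbol{v},\boldsymbol{u})=f(\boldsymbol{x},\boldsymbol{u},\boldsymbol{v}), \] and with this $f$ \[ g=f-\sum_{n\ge2}x_n(1-u_n)f^n+\sum_{n\ge2}x_n(1-u_n)(1-v_n) =f\hat f-\sum_{n\ge2}x_n(f\hat f)^n+\sum_{n\ge2}x_n(1-u_n)(1-v_n). \] -/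

import Mathlib

open scoped MvPowerSeries.WithPiTopology

noncomputable section

namespace CycleFactorization

open Equiv

/-- The possible lengths of the factors: the integers `j ≥ 2`. -/
abbrev Len : Type := {j : ℕ // 2 ≤ j}

/-- `⟨α⟩ = ∑ (j - 1) α_j`, where `α_j` is the number of `j`-cycles. -/
def rank (α : Len →₀ ℕ) : ℕ := α.sum fun j a => (j.1 - 1) * a

/-- The list `[σ_m, …, σ_1]` of permutations is a factorization of type `α` of the `n`-cycle
`(1 2 … n)`: every factor is a cycle of length at least two, exactly `α_j` of the factors are
`j`-cycles, and `σ_m ⋯ σ_1 = (1 2 … n)` (products are composed from right to left; the `n` points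
are `0, …, n - 1`). For `n = 1` the `n`-cycle is the identity. -/
structure IsFactorization (n : ℕ) (α : Len →₀ ℕ) (L : List (Perm (Fin n))) : Prop where
  isCycle : ∀ σ ∈ L, σ.IsCycle
  type_eq : ∀ j : Len, (L.filter fun σ => σ.support.card = j.1).length = α j
  prod_eq : L.prod = finRotate n

/-- The minimal factorizations of type `α`: those with `⟨α⟩ = n - 1`, that is, the factorizations
of type `α` of the `n`-cycle with `n = ⟨α⟩ + 1`. -/
def MinFactorization (α : Len →₀ ℕ) : Type :=
  {L : List (Perm (Fin (rank α + 1))) // IsFactorization (rank α + 1) α L}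

/-- Two lists differ by exchanging two neighbouring commuting factors. -/
def Swap {n : ℕ} (L L' : List (Perm (Fin n))) : Prop :=
  ∃ (A B : List (Perm (Fin n))) (σ τ : Perm (Fin n)),
    Commute σ τ ∧ L = A ++ σ :: τ :: B ∧ L' = A ++ τ :: σ :: B

/-- Equivalence of minimal factorizations: they differ only in the order of commuting factors.
(An exchange of neighbouring commuting factors turns a factorization into a factorization of the
same type, so that it does not matter that the intermediate lists are not restricted.) -/
instance equivalence (α : Len →₀ ℕ) : Setoid (MinFactorization α) :=
  (Relation.EqvGen.setoid Swap).comap Subtype.val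

/-- Inequivalent minimal factorizations of type `α`, that is, equivalence classes. -/
def FactClass (α : Len →₀ ℕ) : Type := Quotient (equivalence α)

/-- The heads of a class: the cycles that can appear in the position `σ_m`. -/
def heads {α : Len →₀ ℕ} (c : FactClass α) : Set (Perm (Fin (rank α + 1))) :=
  {σ | ∃ L : MinFactorization α, Quotient.mk (equivalence α) L = c ∧ L.1.head? = some σ}

/-- The tails of a class: the cycles that can appear in the position `σ_1`. -/
def tails {α : Len →₀ ℕ} (c : FactClass α) : Set (Perm (Fin (rank α + 1))) :=
  {σ | ∃ L : MinFactorization α, Quotient.mk (equivalence α) L = c ∧ L.1.getLast? = some σ}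

/-- The number of different `j`-cycle heads. -/
def headCount {α : Len →₀ ℕ} (c : FactClass α) (j : Len) : ℕ :=
  {σ | σ ∈ heads c ∧ σ.support.card = j.1}.ncard

/-- The number of different `j`-cycle tails. -/
def tailCount {α : Len →₀ ℕ} (c : FactClass α) (j : Len) : ℕ :=
  {σ | σ ∈ tails c ∧ σ.support.card = j.1}.ncard

/-- The number of inequivalent minimal factorizations of type `α` with `h_j` heads and `t_j` tails
that are `j`-cycles, for every `j`. -/
def numFact (α h t : Len →₀ ℕ) : ℕ :=
  {c : FactClass α | (∀ j, headCount c j = h j) ∧ (∀ j, tailCount c j = t j)}.ncard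

/-- The variables `x_j`, `v_j`, `u_j`, for `j ≥ 2`. -/
inductive Var : Type
  | x (j : Len)
  | v (j : Len)
  | u (j : Len)

/-- Formal power series with integer coefficients in all the variables `x_j`, `v_j`, `u_j`. -/
abbrev Series : Type := MvPowerSeries Var ℤ

/-- The variable `x_j` as a power series. -/
def x (j : Len) : Series := MvPowerSeries.X (Var.x j)

/-- The variable `v_j` as a power series. -/
def v (j : Len) : Series := MvPowerSeries.X (Var.v j)

/-- The variable `u_j` as a power series. -/
def u (j : Len) : Series := MvPowerSeries.X (Var.u j)

/-- The generating function `g(x, v, u)`: the coefficient of `∏ x_j ^ α_j * u_j ^ h_j * v_j ^ t_j`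
is the number of inequivalent minimal factorizations of type `α` with head vector `h` and tail
vector `t`. -/
def g : Series := fun e =>
  (numFact
    (e.comapDomain Var.x (fun _ _ _ _ hab => Var.x.inj hab))
    (e.comapDomain Var.u (fun _ _ _ _ hab => Var.u.inj hab))
    (e.comapDomain Var.v (fun _ _ _ _ hab => Var.v.inj hab)) : ℤ)

/-- The exchange of `u_j` and `v_j` for all `j`. -/
def swapVar : Var ≃ Var where
  toFun
    | .x j => .x j
    | .v j => .u j
    | .u j => .v j
  invFun
    | .x j => .x j
    | .v j => .u j
    | .u j => .v j
  left_inv := by rintro (j | j | j) <;> rfl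
  right_inv := by rintro (j | j | j) <;> rfl

/-- `hat f (x, v, u) = f (x, u, v)`. -/
def hat (f : Series) : Series := MvPowerSeries.renameEquiv ℤ swapVar f

/-- Every series `∑ x_n * G_n` converges coefficientwise, whatever the power series `G_n` are; the
infinite sums below are therefore genuine ones. -/
theorem summable_x_mul (G : Len → Series) : Summable fun n => x n * G n := by
  classical
  rw [MvPowerSeries.WithPiTopology.summable_iff_summable_coeff]
  intro d
  have hfin : (Var.x ⁻¹' (d.support : Set Var)).Finite :=
    d.support.finite_toSet.preimage (fun _ _ _ _ hab => Var.x.inj hab)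
  refine summable_of_hasFiniteSupport (hfin.subset ?_)
  intro n hn
  by_contra hnot
  apply hn
  have h0 : ¬ Finsupp.single (Var.x n) 1 ≤ d := by
    intro hle
    have := hle (Var.x n)
    simp only [Finsupp.single_eq_same] at this
    exact hnot (by simp; omega)
  simp only [x, MvPowerSeries.X]
  rw [MvPowerSeries.coeff_monomial_mul, if_neg h0]

/-- The recursion `f = 1 + ∑_{n ≥ 2} x_n (f ^ n - 1 + v_n) f̂ ^ (n - 1)`. -/
def SolvesRecursion (f : Series) : Prop :=
  f = 1 + ∑' n : Len, x n * ((f ^ n.1 - 1 + v n) * hat f ^ (n.1 - 1))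

end CycleFactorization

end

/-! Equivalence classes of minimal factorizations correspond to plane trees, and the equations are
those of tree generating functions.

Let `L` be a minimal factorization of the cycle through a list `l`, and let P = (w₀ w₁ …) be the
leftmost factor that moves the first point w₀ of `l`. Minimality is a genus-zero condition: the
supports of the factors connect all points and have no rank to spare (`exists_labelling`,
`length_le_totalRank`). Remove P and cut each wᵢ into one copy for the factors left of P and one for
those right of P. Every component then contains exactly one copy (`exists_labels`). Tracing
components along `l` shows that `l` is the concatenation of blocks αᵢ wᵢ βᵢ with α₀ empty, and that
the factors of a component multiply to the cycle through αᵢ wᵢ or through wᵢ βᵢ. Commutations move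
the former to the left of P and the latter to its right (`MinFact.exists_decomp`). Conversely, such
pieces always assemble to a minimal factorization (`prod_formPerm_blocks`, `Decomp.minFact`). The
class of `L` determines P, the blocks and the classes of the pieces (`Decomp.formPerm_eq`,
`Decomp.blocks_eq`, `Decomp.pieces_equivalent`), so recursion gives a bijection with `Tree`
(`numFact_eq_ncard`).

A piece over wᵢ βᵢ is again rooted at its first point. A piece over αᵢ wᵢ becomes so after reversing
the order and inverting the factors, which exchanges heads and tails; this is the origin of f̂. The
factor P is a tail exactly when all right pieces are empty, and a head exactly when all left pieces
are. A head of a right piece is a head of `L` exactly when it commutes with P, that is, fixes wᵢ.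
Hence the recursion closes for the weight that counts only the heads fixing the root, and its series
is f. Counting P as a head too gives g = 1 + ∑ xₙ (fⁿ − 1 + vₙ)(f̂ⁿ⁻¹ − 1 + uₙ), see
`SolvesRecursion.g_eq_xsum`.

Subtracting the recursion for f yields the first formula. Multiplying the recursion by f̂ gives f f̂
− ∑ xₙ (f f̂)ⁿ = f̂ − ∑ xₙ (1 − vₙ) f̂ⁿ; the left side is invariant under the exchange of u and v,
so the right side may be replaced by its image, and this is the second formula
(`SolvesRecursion.mul_hat_sub`). The solution f is unique because the factor xₙ raises the order of
the difference of two solutions. -/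

noncomputable section

namespace CycleFactorization

open Equiv

/-! ### Lists of permutations up to exchange of neighbouring commuting entries -/

/-- Lists that differ by exchanges of neighbouring commuting entries. -/
abbrev Equivalent {n : ℕ} (L L' : List (Perm (Fin n))) : Prop := Relation.EqvGen Swap L L'

namespace Equivalent

variable {n : ℕ} {L L' L₁ L₂ L₃ : List (Perm (Fin n))}

theorem rfl' : Equivalent L L := Relation.EqvGen.refl _

theorem of_eq (h : L = L') : Equivalent L L' := h ▸ rfl'

/-- A relation that is preserved by exchanges is preserved by equivalence. -/
theorem lift {r : List (Perm (Fin n)) → List (Perm (Fin n)) → Prop} (hr : Equivalence r)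
    (h : ∀ A B σ τ, Commute σ τ → r (A ++ σ :: τ :: B) (A ++ τ :: σ :: B))
    (hL : Equivalent L L') : r L L' := by
  induction hL with
  | rel _ _ hs =>
    obtain ⟨A, B, σ, τ, hc, rfl, rfl⟩ := hs
    exact h A B σ τ hc
  | refl _ => exact hr.refl _
  | symm _ _ _ ih => exact hr.symm ih
  | trans _ _ _ _ _ ih₁ ih₂ => exact hr.trans ih₁ ih₂

theorem map_of_swap (F : List (Perm (Fin n)) → List (Perm (Fin n)))
    (h : ∀ A B σ τ, Commute σ τ → Equivalent (F (A ++ σ :: τ :: B)) (F (A ++ τ :: σ :: B)))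
    (hL : Equivalent L L') : Equivalent (F L) (F L') :=
  hL.lift (r := fun X Y => Equivalent (F X) (F Y))
    ⟨fun _ => rfl', fun h => h.symm, fun h h' => h.trans _ _ _ h'⟩ h

theorem swap' (A B : List (Perm (Fin n))) {σ τ : Perm (Fin n)} (h : Commute σ τ) :
    Equivalent (A ++ σ :: τ :: B) (A ++ τ :: σ :: B) :=
  Relation.EqvGen.rel _ _ ⟨A, B, σ, τ, h, rfl, rfl⟩

theorem perm (h : Equivalent L L') : L.Perm L' :=
  h.lift (r := List.Perm) ⟨List.Perm.refl, List.Perm.symm, List.Perm.trans⟩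
    fun A B σ τ _ => List.Perm.append_left A (List.Perm.swap τ σ B)

theorem prod_eq (h : Equivalent L L') : L.prod = L'.prod :=
  h.lift (r := fun X Y => X.prod = Y.prod) ⟨fun _ => rfl, Eq.symm, Eq.trans⟩ <| by
    intro A B σ τ hc
    simp only [List.prod_append, List.prod_cons, ← mul_assoc]
    rw [mul_assoc A.prod, hc.eq, mul_assoc]
    simp [mul_assoc]

/-- Two neighbours that both survive stay neighbours. Through this, the leftmost factor at the root
and the pieces of a decomposition depend only on the class. -/
theorem filter (p : Perm (Fin n) → Bool) (h : Equivalent L L') :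
    Equivalent (L.filter p) (L'.filter p) :=
  h.map_of_swap (fun X => X.filter p) <| by
    intro A B σ τ hc
    simp only [List.filter_append, List.filter_cons]
    split_ifs
    · exact swap' _ _ hc
    all_goals exact rfl'

theorem append_left (X : List (Perm (Fin n))) (h : Equivalent L L') :
    Equivalent (X ++ L) (X ++ L') :=
  h.map_of_swap (fun Y => X ++ Y) <| by
    intro A B σ τ hc
    simp only [← List.append_assoc]
    exact swap' _ _ hc

theorem append_right (X : List (Perm (Fin n))) (h : Equivalent L L') :
    Equivalent (L ++ X) (L' ++ X) :=
  h.map_of_swap (fun Y => Y ++ X) <| by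
    intro A B σ τ hc
    simp only [List.append_assoc, List.cons_append]
    exact swap' _ _ hc

theorem append (h : Equivalent L L') (h' : Equivalent L₁ L₂) :
    Equivalent (L ++ L₁) (L' ++ L₂) :=
  (h.append_right L₁).trans _ _ _ (h'.append_left L')

theorem cons (σ : Perm (Fin n)) (h : Equivalent L L') : Equivalent (σ :: L) (σ :: L') :=
  h.append_left [σ]

theorem flatten_ofFn {k : ℕ} {A B : Fin k → List (Perm (Fin n))}
    (h : ∀ i, Equivalent (A i) (B i)) :
    Equivalent (List.ofFn A).flatten (List.ofFn B).flatten := by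
  induction k with
  | zero => simpa using rfl'
  | succ k ih =>
    simp only [List.ofFn_succ, List.flatten_cons]
    exact (h 0).append (ih fun i => h i.succ)

theorem reverse (h : Equivalent L L') : Equivalent L.reverse L'.reverse :=
  h.map_of_swap List.reverse <| by
    intro A B σ τ hc
    simp only [List.reverse_append, List.reverse_cons, List.append_assoc, List.cons_append,
      List.nil_append]
    exact swap' _ _ hc.symm

theorem map_inv (h : Equivalent L L') : Equivalent (L.map (·⁻¹)) (L'.map (·⁻¹)) :=
  h.map_of_swap (List.map (·⁻¹)) <| by
    intro A B σ τ hc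
    simp only [List.map_append, List.map_cons]
    exact swap' _ _ hc.inv_inv

theorem move {A : List (Perm (Fin n))} {σ : Perm (Fin n)} (h : ∀ τ ∈ A, Commute τ σ)
    (B : List (Perm (Fin n))) : Equivalent (A ++ σ :: B) (σ :: (A ++ B)) := by
  induction A with
  | nil => exact rfl'
  | cons τ A ih =>
    refine ((ih fun ρ hρ => h ρ (List.mem_cons_of_mem _ hρ)).cons τ).trans _ _ _ ?_
    exact swap' [] _ (h τ List.mem_cons_self)

/-- Stable sorting by a key, provided that pairs in the wrong order commute. -/
theorem sort_by_key (key : Perm (Fin n) → ℕ) (K : ℕ) :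
    ∀ L : List (Perm (Fin n)), (∀ σ ∈ L, key σ < K) →
      L.Pairwise (fun σ τ => key τ < key σ → Commute σ τ) →
      Equivalent L ((List.range K).flatMap fun i => L.filter fun σ => key σ = i) := by
  intro L
  induction L with
  | nil => intro _ _; exact of_eq (by simp)
  | cons σ L ih =>
    intro hK hp
    rw [List.pairwise_cons] at hp
    have hσ := hK σ List.mem_cons_self
    refine ((ih (fun τ hτ => hK τ (List.mem_cons_of_mem _ hτ)) hp.2).cons σ).trans _ _ _ ?_
    -- The range is split into the keys below, at and above `key σ`; only the middle bucket gains
    -- `σ`.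
    obtain ⟨r, rfl⟩ := Nat.exists_eq_add_of_lt hσ
    rw [show key σ + r + 1 = key σ + (1 + r) by ring, List.range_add, List.range_add]
    simp only [List.flatMap_append, List.range_one, List.map_append]
    have h₁ : ((List.range (key σ)).flatMap fun i => (σ :: L).filter fun τ => key τ = i) =
        (List.range (key σ)).flatMap fun i => L.filter fun τ => key τ = i := by
      refine List.flatMap_congr fun i hi => ?_
      rw [List.filter_cons_of_neg]
      simpa using (List.mem_range.1 hi).ne'
    have h₂ : ((List.map (fun x => key σ + x) (List.map (fun x => 1 + x) (List.range r))).flatMap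
        fun i => (σ :: L).filter fun τ => key τ = i) =
        (List.map (fun x => key σ + x) (List.map (fun x => 1 + x) (List.range r))).flatMap
          fun i => L.filter fun τ => key τ = i := by
      refine List.flatMap_congr fun i hi => ?_
      rw [List.filter_cons_of_neg]
      simp only [List.map_map, List.mem_map, List.mem_range, Function.comp] at hi
      obtain ⟨a, _, rfl⟩ := hi
      simp
    rw [h₁, h₂]
    simp only [List.map_cons, List.map_nil, add_zero, List.flatMap_cons, List.flatMap_nil,
      List.append_nil]
    rw [List.filter_cons_of_pos (by simp)]
    -- The entries that `σ` has to pass have smaller keys, so they commute with it by hypothesis.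
    refine Relation.EqvGen.symm _ _ (move (fun τ hτ => ?_) _)
    simp only [List.mem_flatMap, List.mem_range, List.mem_filter, decide_eq_true_eq] at hτ
    obtain ⟨i, hi, hτL, hτi⟩ := hτ
    exact (hp.1 τ hτL (hτi ▸ hi)).symm

end Equivalent

/-! ### Heads and tails read off from one representative -/

/-- `σ` occurs in the list with only entries that commute with it to the left of it. -/
def CanHead {n : ℕ} : List (Perm (Fin n)) → Perm (Fin n) → Prop
  | [], _ => False
  | τ :: L, σ => τ = σ ∨ (Commute τ σ ∧ CanHead L σ)

/-- `σ` occurs in the list with only entries that commute with it to the right of it. -/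
def CanTail {n : ℕ} (L : List (Perm (Fin n))) (σ : Perm (Fin n)) : Prop := CanHead L.reverse σ

section CanHead

variable {n : ℕ} {L L' X Y : List (Perm (Fin n))} {σ : Perm (Fin n)}

theorem CanHead.mem (h : CanHead L σ) : σ ∈ L := by
  induction L with
  | nil => exact h.elim
  | cons τ L ih =>
    rcases h with rfl | ⟨_, h⟩
    · exact List.mem_cons_self
    · exact List.mem_cons_of_mem _ (ih h)

theorem CanTail.mem (h : CanTail L σ) : σ ∈ L := List.mem_reverse.1 (CanHead.mem h)

theorem canHead_append :
    CanHead (X ++ Y) σ ↔ CanHead X σ ∨ ((∀ τ ∈ X, Commute τ σ) ∧ CanHead Y σ) := by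
  induction X with
  | nil => simp [CanHead]
  | cons τ X ih =>
    simp only [List.cons_append, CanHead, ih, List.forall_mem_cons]
    tauto

theorem canTail_append :
    CanTail (X ++ Y) σ ↔ CanTail Y σ ∨ ((∀ τ ∈ Y, Commute τ σ) ∧ CanTail X σ) := by
  simp only [CanTail, List.reverse_append, canHead_append, List.mem_reverse]

theorem canTail_cons {τ : Perm (Fin n)} :
    CanTail (τ :: Y) σ ↔ CanTail Y σ ∨ ((∀ τ ∈ Y, Commute τ σ) ∧ τ = σ) := by
  rw [← List.singleton_append, canTail_append]
  simp [CanTail, CanHead]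

/-- If one of two exchanged entries is `σ` itself, their commutation is exactly what `σ` needs to
pass the other. So the heads of a class are visible in any member. -/
theorem Equivalent.canHead_iff (h : Equivalent L L') : CanHead L σ ↔ CanHead L' σ :=
  h.lift (r := fun X Y => CanHead X σ ↔ CanHead Y σ) ⟨fun _ => Iff.rfl, Iff.symm, Iff.trans⟩ <| by
    intro A B τ ρ hc
    simp only [canHead_append, CanHead]
    have h₁ : τ = σ → Commute ρ σ := fun h => h ▸ hc.symm
    have h₂ : ρ = σ → Commute τ σ := fun h => h ▸ hc
    tauto

theorem Equivalent.canTail_iff (h : Equivalent L L') : CanTail L σ ↔ CanTail L' σ :=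
  h.reverse.canHead_iff

theorem CanHead.exists_equivalent (h : CanHead L σ) : ∃ L', Equivalent L (σ :: L') := by
  induction L with
  | nil => exact h.elim
  | cons τ L ih =>
    rcases h with rfl | ⟨hc, h⟩
    · exact ⟨L, Equivalent.rfl'⟩
    · obtain ⟨L', hL'⟩ := ih h
      exact ⟨τ :: L', (hL'.cons τ).trans _ _ _ (Equivalent.swap' [] _ hc)⟩

theorem CanTail.exists_equivalent (h : CanTail L σ) : ∃ L', Equivalent L (L' ++ [σ]) := by
  obtain ⟨L', hL'⟩ := CanHead.exists_equivalent h
  exact ⟨L'.reverse, by simpa using hL'.reverse⟩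

theorem canHead_flatten_ofFn {k : ℕ} {A : Fin k → List (Perm (Fin n))}
    (h : ∀ i j, i ≠ j → ∀ σ ∈ A i, ∀ τ ∈ A j, Commute σ τ) :
    CanHead (List.ofFn A).flatten σ ↔ ∃ i, CanHead (A i) σ := by
  induction k with
  | zero => simp [CanHead]
  | succ k ih =>
    simp only [List.ofFn_succ, List.flatten_cons, canHead_append]
    rw [ih fun i j hij => h _ _ fun e => hij (Fin.succ_injective _ e), Fin.exists_fin_succ]
    refine or_congr_right (and_iff_right_of_imp ?_)
    rintro ⟨i, hi⟩ τ hτ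
    exact h 0 i.succ (Fin.succ_ne_zero i).symm τ hτ σ hi.mem

theorem canTail_flatten_ofFn {k : ℕ} {A : Fin k → List (Perm (Fin n))}
    (h : ∀ i j, i ≠ j → ∀ σ ∈ A i, ∀ τ ∈ A j, Commute σ τ) :
    CanTail (List.ofFn A).flatten σ ↔ ∃ i, CanTail (A i) σ := by
  induction k with
  | zero => simp [CanTail, CanHead]
  | succ k ih =>
    simp only [List.ofFn_succ, List.flatten_cons, canTail_append]
    rw [ih fun i j hij => h _ _ fun e => hij (Fin.succ_injective _ e), Fin.exists_fin_succ,
      or_comm]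
    refine or_congr_left (and_iff_right_of_imp ?_)
    intro h0 τ hτ
    simp only [List.mem_flatten, List.mem_ofFn] at hτ
    obtain ⟨_, ⟨i, rfl⟩, hτ⟩ := hτ
    exact h i.succ 0 (Fin.succ_ne_zero i) τ hτ σ h0.mem

/-- The list of the inverses in the reverse order. -/
def revInv (L : List (Perm (Fin n))) : List (Perm (Fin n)) := (L.map (·⁻¹)).reverse

theorem revInv_revInv (L : List (Perm (Fin n))) : revInv (revInv L) = L := by
  simp [revInv, List.map_reverse]

theorem mem_revInv : σ ∈ revInv L ↔ σ⁻¹ ∈ L := by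
  simp only [revInv, List.mem_reverse, List.mem_map]
  exact ⟨by rintro ⟨τ, h, rfl⟩; simpa, fun h => ⟨_, h, inv_inv σ⟩⟩

theorem prod_revInv (L : List (Perm (Fin n))) : (revInv L).prod = L.prod⁻¹ := by
  rw [List.prod_inv_reverse]; rfl

theorem length_revInv (L : List (Perm (Fin n))) : (revInv L).length = L.length := by
  simp [revInv]

theorem Equivalent.revInv (h : Equivalent L L') :
    Equivalent (CycleFactorization.revInv L) (CycleFactorization.revInv L') :=
  h.map_inv.reverse

theorem canHead_map_inv : CanHead (L.map (·⁻¹)) σ ↔ CanHead L σ⁻¹ := by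
  induction L with
  | nil => simp [CanHead]
  | cons τ L ih =>
    simp only [List.map_cons, CanHead, ih, inv_eq_iff_eq_inv]
    rw [show Commute τ⁻¹ σ ↔ Commute τ σ⁻¹ by rw [Commute.inv_left_iff, Commute.inv_right_iff]]

/-- Together with `canHead_revInv` this is the combinatorial source of `hat`: reversing and
inverting exchanges heads and tails. -/
theorem canTail_revInv : CanTail (revInv L) σ ↔ CanHead L σ⁻¹ := by
  rw [CanTail, revInv, List.reverse_reverse, canHead_map_inv]

theorem canHead_revInv : CanHead (revInv L) σ ↔ CanTail L σ⁻¹ := by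
  rw [CanTail, revInv, ← List.map_reverse, canHead_map_inv]

end CanHead

/-! ### The cycle through the entries of a list -/

theorem list_prod_apply_of_fixed {V : Type*} {L : List (Perm V)} {x : V} (h : ∀ σ ∈ L, σ x = x) :
    L.prod x = x := by
  induction L with
  | nil => simp
  | cons σ L ih =>
    rw [List.prod_cons, Perm.mul_apply, ih fun τ hτ => h τ (List.mem_cons_of_mem _ hτ),
      h σ List.mem_cons_self]

section FormPerm

variable {V : Type*} [DecidableEq V]

/-- The cycle is a product of transpositions of neighbours in the list, so it can be cut at any
entry. The later products of block cycles rest on this. -/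
theorem formPerm_append_cons (X Y : List V) (w : V) :
    (X ++ w :: Y).formPerm = (X ++ [w]).formPerm * (w :: Y).formPerm := by
  induction X with
  | nil => simp
  | cons x X ih =>
    cases X with
    | nil => simp
    | cons x' X =>
      simp only [List.cons_append, List.formPerm_cons_cons] at ih ⊢
      rw [ih, mul_assoc]

theorem formPerm_append_comm {X Y : List V} (h : (X ++ Y).Nodup) :
    (X ++ Y).formPerm = (Y ++ X).formPerm :=
  List.formPerm_eq_of_isRotated h List.isRotated_append

/-- Rotate the list to `γ ++ w :: β`, cut at `w`, and rotate the first factor back. -/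
theorem formPerm_cons_append {w : V} {β γ : List V} (h : (w :: (β ++ γ)).Nodup) :
    (w :: (β ++ γ)).formPerm = (w :: γ).formPerm * (w :: β).formPerm := by
  have h₁ : (w :: (β ++ γ)).formPerm = (γ ++ w :: β).formPerm := by
    rw [← List.cons_append]
    exact formPerm_append_comm h
  have h₂ : (w :: γ).formPerm = (γ ++ [w]).formPerm := by
    rw [← List.singleton_append]
    refine formPerm_append_comm ?_
    exact h.sublist (by simp)
  rw [h₁, h₂, formPerm_append_cons]

theorem formPerm_apply_of_append {X Y : List V} {y z : V} (h : (X ++ y :: z :: Y).Nodup) :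
    (X ++ y :: z :: Y).formPerm y = z := by
  rw [formPerm_append_cons, Perm.mul_apply,
    List.formPerm_apply_head _ _ _ (h.sublist (List.sublist_append_right _ _))]
  apply List.formPerm_apply_of_notMem
  have := List.disjoint_of_nodup_append h
  simp only [List.nodup_append, List.nodup_cons, List.mem_cons, not_or] at h
  simp only [List.mem_append, List.mem_singleton, not_or]
  exact ⟨fun hz => this hz (by simp), fun e => h.2.1.1.1 e.symm⟩

/-- The successor condition fixes `π` on every entry but the last, and bijectivity forces the image
of the last one. -/
theorem eq_formPerm {C : List V} {π : Perm V} (hC : C.Nodup) (hout : ∀ x ∉ C, π x = x)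
    (h : ∀ X y z Y, C = X ++ y :: z :: Y → π y = z) : π = C.formPerm := by
  rcases List.eq_nil_or_concat C with rfl | ⟨X, z, rfl⟩
  · ext x; simpa using hout x
  rw [List.concat_eq_append] at *
  have key : ∀ x, x ≠ z → π x = (X ++ [z]).formPerm x := by
    intro x hx
    by_cases hxX : x ∈ X
    · obtain ⟨s, t, rfl⟩ := List.append_of_mem hxX
      obtain ⟨y, Y, hY⟩ : ∃ y Y, t ++ [z] = y :: Y := by cases t <;> simp
      have e : s ++ x :: t ++ [z] = s ++ x :: y :: Y := by simp [hY]
      rw [h _ _ _ _ e, e, formPerm_apply_of_append (e ▸ hC)]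
    · have : x ∉ X ++ [z] := by simp [hxX, hx]
      rw [hout x this, List.formPerm_apply_of_notMem this]
  ext x
  by_cases hx : x = z
  · subst hx
    obtain ⟨y, hy⟩ := (X ++ [x]).formPerm.surjective (π x)
    by_cases hyx : y = x
    · rw [← hy, hyx]
    · rw [← key y hyx] at hy
      exact (hyx (π.injective hy)).elim
  · exact key x hx

/-- The cycle acts transitively on its entries, so an invariant labelling is constant on them. -/
theorem label_eq_of_formPerm_invariant {W : Type*} {κ : V → W} {C : List V} (hC : C.Nodup)
    (h : ∀ x ∈ C, κ (C.formPerm x) = κ x) {x y : V} (hx : x ∈ C) (hy : y ∈ C) : κ x = κ y := by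
  have hc : C.IsChain (fun a b => κ a = κ b) := by
    rw [List.isChain_iff_forall_rel_of_append_cons_cons]
    intro a b l₁ l₂ e
    subst e
    rw [← h a (by simp), formPerm_apply_of_append hC]
  have hp : C.Pairwise (fun a b => κ a = κ b) := by
    have : IsTrans V (fun a b => κ a = κ b) := ⟨fun _ _ _ => Eq.trans⟩
    exact List.isChain_iff_pairwise.1 hc
  by_cases hxy : x = y
  · rw [hxy]
  · have : Std.Symm (fun a b => κ a = κ b) := ⟨fun _ _ => Eq.symm⟩
    exact hp.forall hx hy hxy

/-- The labels are the components of the hypergraph with edges `E`. Adding an edge `e` merges at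
most `e.card` classes into one, hence loses at most `e.card - 1` of them. -/
theorem exists_labelling {W : Type*} [DecidableEq W] (S : Finset W) (E : List (Finset W))
    (hE : ∀ e ∈ E, e.Nonempty) :
    ∃ κ : W → W, (∀ e ∈ E, ∀ x ∈ e, ∀ y ∈ e, κ x = κ y) ∧
      S.card ≤ (S.image κ).card + (E.map fun e => e.card - 1).sum := by
  induction E with
  | nil => exact ⟨id, by simp, by simp⟩
  | cons e E ih =>
    obtain ⟨κ, h₁, h₂⟩ := ih fun e he => hE e (List.mem_cons_of_mem _ he)
    obtain ⟨s, hs⟩ := hE e List.mem_cons_self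
    refine ⟨fun x => if κ x ∈ e.image κ then κ s else κ x, ?_, ?_⟩
    · intro e' he' x hx y hy
      rcases List.mem_cons.1 he' with rfl | he'
      · simp only [Finset.mem_image_of_mem κ hx, Finset.mem_image_of_mem κ hy, if_true]
      · simp only [h₁ e' he' x hx y hy]
    · have hsub : S.image κ ⊆ (S.image fun x => if κ x ∈ e.image κ then κ s else κ x) ∪
          (e.image κ).erase (κ s) := by
        intro a ha
        obtain ⟨x, hx, rfl⟩ := Finset.mem_image.1 ha
        by_cases hxe : κ x ∈ e.image κ
        · by_cases hxs : κ x = κ s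
          · refine Finset.mem_union_left _ (Finset.mem_image.2 ⟨x, hx, ?_⟩)
            simp only [hxs, ite_self]
          · exact Finset.mem_union_right _ (Finset.mem_erase.2 ⟨hxs, hxe⟩)
        · refine Finset.mem_union_left _ (Finset.mem_image.2 ⟨x, hx, ?_⟩)
          simp only [hxe, if_false]
      have hc := (Finset.card_le_card hsub).trans (Finset.card_union_le _ _)
      rw [Finset.card_erase_of_mem (Finset.mem_image_of_mem κ hs)] at hc
      have := Finset.card_image_le (s := e) (f := κ)
      simp only [List.map_cons, List.sum_cons]
      omega

end FormPerm

/-! ### Minimal factorizations and the rank bound -/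

section MinFact

variable {n : ℕ} {l : List (Fin n)} {L L' : List (Perm (Fin n))}

/-- The sum of the numbers `j - 1` over the `j`-cycles in the list. -/
def totalRank (L : List (Perm (Fin n))) : ℕ := (L.map fun σ => σ.support.card - 1).sum

theorem totalRank_append (L L' : List (Perm (Fin n))) :
    totalRank (L ++ L') = totalRank L + totalRank L' := by simp [totalRank]

theorem totalRank_cons (σ : Perm (Fin n)) (L : List (Perm (Fin n))) :
    totalRank (σ :: L) = (σ.support.card - 1) + totalRank L := by simp [totalRank]

theorem totalRank_flatten_ofFn {k : ℕ} (A : Fin k → List (Perm (Fin n))) :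
    totalRank (List.ofFn A).flatten = ∑ i, totalRank (A i) := by
  induction k with
  | zero => simp [totalRank]
  | succ k ih =>
    rw [List.ofFn_succ, List.flatten_cons, totalRank_append, ih, Fin.sum_univ_succ]

theorem Equivalent.totalRank_eq (h : Equivalent L L') : totalRank L = totalRank L' :=
  (h.perm.map _).sum_eq

/-- `L` is a minimal factorization into cycles of the cycle through the entries of `l`. -/
structure MinFact (l : List (Fin n)) (L : List (Perm (Fin n))) : Prop where
  nodup : l.Nodup
  isCycle : ∀ σ ∈ L, σ.IsCycle
  mem_of_mem_support : ∀ σ ∈ L, ∀ x ∈ σ.support, x ∈ l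
  prod_eq : L.prod = l.formPerm
  rank_eq : totalRank L + 1 = l.length

theorem list_prod_invariant {W : Type*} {κ : Fin n → W}
    (h : ∀ σ ∈ L, ∀ x, κ (σ x) = κ x) (x : Fin n) : κ (L.prod x) = κ x := by
  induction L with
  | nil => simp
  | cons σ L ih =>
    rw [List.prod_cons, Perm.mul_apply, h σ List.mem_cons_self,
      ih fun τ hτ => h τ (List.mem_cons_of_mem _ hτ)]

theorem invariant_of_support {W : Type*} {κ : Fin n → W} {σ : Perm (Fin n)}
    (h : ∀ x ∈ σ.support, ∀ y ∈ σ.support, κ x = κ y) (x : Fin n) : κ (σ x) = κ x := by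
  by_cases hx : x ∈ σ.support
  · exact h _ (Perm.apply_mem_support.2 hx) _ hx
  · rw [Perm.notMem_support.1 hx]

/-- Labels constant on supports are invariant under the product, which is transitive on `l`; so one
class remains in `exists_labelling`. `L'` is kept apart from `L` so that it may be `L` without
repetitions. -/
theorem length_le_totalRank_of_subset (hl : l.Nodup) (hL' : ∀ σ ∈ L', σ.IsCycle)
    (hsub : ∀ σ ∈ L, σ ∈ L') (hprod : L.prod = l.formPerm) : l.length ≤ totalRank L' + 1 := by
  obtain ⟨κ, h₁, h₂⟩ := exists_labelling l.toFinset (L'.map Perm.support) <| by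
    simp only [List.mem_map, forall_exists_index, and_imp, forall_apply_eq_imp_iff₂]
    exact fun σ hσ => Finset.card_pos.1 (by have := (hL' σ hσ).two_le_card_support; omega)
  rw [List.toFinset_card_of_nodup hl, List.map_map] at h₂
  have h₃ : (l.toFinset.image κ).card ≤ 1 := by
    rw [Finset.card_le_one]
    simp only [Finset.mem_image, List.mem_toFinset]
    rintro _ ⟨x, hx, rfl⟩ _ ⟨y, hy, rfl⟩
    refine label_eq_of_formPerm_invariant hl (fun x _ => ?_) hx hy
    rw [← hprod]
    exact list_prod_invariant (fun σ hσ => invariant_of_support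
      (h₁ _ (List.mem_map_of_mem (hsub σ hσ)))) x
  have : (L'.map ((fun e : Finset (Fin n) => e.card - 1) ∘ Perm.support)).sum = totalRank L' := rfl
  omega

theorem length_le_totalRank (hl : l.Nodup) (hL : ∀ σ ∈ L, σ.IsCycle)
    (hprod : L.prod = l.formPerm) : l.length ≤ totalRank L + 1 :=
  length_le_totalRank_of_subset hl hL (fun _ h => h) hprod

/-- The factors of a minimal factorization are different. -/
theorem MinFact.nodup_factors (h : MinFact l L) : L.Nodup := by
  -- `R` collects the repeated occurrences. The list without them already has the full rank, so `R`
  -- has rank zero and is empty.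
  obtain ⟨R, hR⟩ := (List.dedup_sublist L).exists_perm_append
  have h₁ := length_le_totalRank_of_subset (L' := L.dedup) h.nodup
    (fun σ hσ => h.isCycle σ (List.mem_dedup.1 hσ)) (fun σ hσ => List.mem_dedup.2 hσ) h.prod_eq
  have h₂ : totalRank L = totalRank L.dedup + totalRank R := by
    rw [← totalRank_append]
    exact (hR.map _).sum_eq
  have h₃ := h.rank_eq
  have h₄ : R = [] := by
    have h0 : totalRank R = 0 := by omega
    rw [totalRank, List.sum_eq_zero_iff] at h0
    refine List.eq_nil_iff_forall_not_mem.2 fun σ hσ => ?_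
    have := h0 _ (List.mem_map_of_mem hσ)
    have := (h.isCycle σ (hR.mem_iff.2 (by simp [hσ]))).two_le_card_support
    omega
  rw [h₄, List.append_nil] at hR
  exact hR.nodup_iff.2 (List.nodup_dedup L)

theorem MinFact.of_equivalent (h : MinFact l L) (hL : Equivalent L L') : MinFact l L' where
  nodup := h.nodup
  isCycle σ hσ := h.isCycle σ (hL.perm.mem_iff.2 hσ)
  mem_of_mem_support σ hσ := h.mem_of_mem_support σ (hL.perm.mem_iff.2 hσ)
  prod_eq := by rw [← hL.prod_eq, h.prod_eq]
  rank_eq := by rw [← hL.totalRank_eq, h.rank_eq]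

theorem totalRank_revInv (L : List (Perm (Fin n))) : totalRank (revInv L) = totalRank L := by
  simp [totalRank, revInv, List.sum_reverse, Function.comp_def]

theorem MinFact.revInv (h : MinFact l L) : MinFact l.reverse (CycleFactorization.revInv L) where
  nodup := List.nodup_reverse.2 h.nodup
  isCycle σ hσ := by simpa using (h.isCycle _ (mem_revInv.1 hσ)).inv
  mem_of_mem_support σ hσ x hx := List.mem_reverse.2 <|
    h.mem_of_mem_support _ (mem_revInv.1 hσ) x (by simpa using hx)
  prod_eq := by rw [prod_revInv, h.prod_eq, List.formPerm_reverse]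
  rank_eq := by rw [totalRank_revInv, h.rank_eq, List.length_reverse]

theorem minFact_singleton (a : Fin n) : MinFact [a] [] where
  nodup := List.nodup_singleton a
  isCycle := by simp
  mem_of_mem_support := by simp
  prod_eq := by simp
  rank_eq := by simp [totalRank]

theorem MinFact.eq_nil_iff (h : MinFact l L) : L = [] ↔ l.length = 1 := by
  constructor
  · rintro rfl; simpa [totalRank] using h.rank_eq.symm
  · intro hl
    have h0 : totalRank L = 0 := by have := h.rank_eq; omega
    rw [totalRank, List.sum_eq_zero_iff] at h0
    refine List.eq_nil_iff_forall_not_mem.2 fun σ hσ => ?_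
    have := h0 _ (List.mem_map_of_mem hσ)
    have := (h.isCycle σ hσ).two_le_card_support
    omega

theorem MinFact.ne_nil (h : MinFact l L) : l ≠ [] := by
  rintro rfl; simpa using h.rank_eq

/-- In a nonempty minimal factorization every point is moved by some factor. -/
theorem MinFact.exists_mem_support (h : MinFact l L) (hL : L ≠ []) {x : Fin n} (hx : x ∈ l) :
    ∃ σ ∈ L, x ∈ σ.support := by
  by_contra hcon
  push Not at hcon
  have h₁ : L.prod x = x :=
    list_prod_apply_of_fixed fun σ hσ => Perm.notMem_support.1 (hcon σ hσ)
  rw [h.prod_eq, List.formPerm_apply_mem_eq_self_iff _ h.nodup x hx] at h₁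
  have := List.length_pos_iff.2 h.ne_nil
  exact hL (h.eq_nil_iff.2 (by omega))

end MinFact

/-! ### Commuting and noncommuting cycles -/

section Commute

variable {n : ℕ} {σ τ : Perm (Fin n)}

theorem commute_of_support_disjoint (h : ∀ x ∈ σ.support, x ∉ τ.support) : Commute σ τ :=
  (Perm.disjoint_iff_disjoint_support.2 (Finset.disjoint_left.2 h)).commute

/-- If σ and τ commuted, then, since `τ w` is fixed by σ and `σ w` by τ, it would follow that `τ w =
σ w`. This point lies in both supports, so it is `w`, which is absurd. -/
theorem not_commute_of_unique_common {w : Fin n} (hσ : w ∈ σ.support) (hτ : w ∈ τ.support)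
    (h : ∀ x ∈ σ.support, x ∈ τ.support → x = w) : ¬ Commute σ τ := by
  intro hc
  have h₁ : σ (τ w) = τ w := by
    by_contra hne
    exact Perm.mem_support.1 hτ (h _ (Perm.mem_support.2 hne) (Perm.apply_mem_support.2 hτ))
  have h₂ : τ (σ w) = σ w := by
    by_contra hne
    exact Perm.mem_support.1 hσ (h _ (Perm.apply_mem_support.2 hσ) (Perm.mem_support.2 hne))
  have h₃ : σ (τ w) = τ (σ w) := DFunLike.congr_fun hc.eq w
  rw [h₁, h₂] at h₃
  have h₄ : σ w ∈ τ.support := h₃ ▸ Perm.apply_mem_support.2 hτ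
  exact Perm.mem_support.1 hσ (h _ (Perm.apply_mem_support.2 hσ) h₄)

end Commute

/-! ### Decomposition along the last factor that moves the first point -/

/-- A factorization `L` of the cycle through `l = … αᵢ wᵢ βᵢ …` that consists of the cycle
`(w₀ w₁ …)`, of factorizations `A i` of the cycles through `αᵢ wᵢ` to the left of it, and of
factorizations `B i` of the cycles through `wᵢ βᵢ` to the right of it. -/
structure Decomp {n m : ℕ} (α β : Fin (m + 2) → List (Fin n)) (w : Fin (m + 2) → Fin n)
    (A B : Fin (m + 2) → List (Perm (Fin n))) (l : List (Fin n)) (L : List (Perm (Fin n))) :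
    Prop where
  nodup : l.Nodup
  list_eq : l = (List.ofFn fun i => α i ++ w i :: β i).flatten
  fact_eq : L = (List.ofFn A).flatten ++ (List.ofFn w).formPerm :: (List.ofFn B).flatten
  left : ∀ i, MinFact (α i ++ [w i]) (A i)
  right : ∀ i, MinFact (w i :: β i) (B i)
  first : α 0 = []

/-- Labels for the blocks `αᵢ wᵢ` (label `(i, false)`) and `wᵢ βᵢ` (label `(i, true)`): the
factors in `A` respect `ρA`, those in `B` respect `ρB`. -/
structure Labelled {n m : ℕ} (l : List (Fin n)) (A B : List (Perm (Fin n))) (P : Perm (Fin n))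
    (w : Fin (m + 2) → Fin n) (ρA ρB : Fin n → Fin (m + 2) × Bool) : Prop where
  fact : MinFact l (A ++ P :: B)
  inj : Function.Injective w
  support_iff : ∀ x, x ∈ P.support ↔ ∃ i, w i = x
  next : ∀ i, ∃ j, P (w i) = w j ∧ (j = 0 ∨ j.val = i.val + 1)
  head : ∃ l', l = w 0 :: l'
  fix : A.prod (w 0) = w 0
  eq_off : ∀ x, (∀ i, w i ≠ x) → ρA x = ρB x
  left_w : ∀ i, ρA (w i) = (i, false)
  right_w : ∀ i, ρB (w i) = (i, true)
  left : ∀ σ ∈ A, ∀ x ∈ σ.support, ∀ y ∈ σ.support, ρA x = ρA y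
  right : ∀ σ ∈ B, ∀ x ∈ σ.support, ∀ y ∈ σ.support, ρB x = ρB y

/-- A component count on the points with each `w i` doubled. The rank of P is missing from the
edges, so at least `2 * (m + 2)` components remain; each of them contains a copy of some `w i`, so
the `2 * (m + 2)` copies represent them bijectively. -/
theorem exists_labels {n m : ℕ} {l : List (Fin n)} {A B : List (Perm (Fin n))}
    {P : Perm (Fin n)} {w : Fin (m + 2) → Fin n} (fact : MinFact l (A ++ P :: B))
    (inj : Function.Injective w) (support_iff : ∀ x, x ∈ P.support ↔ ∃ i, w i = x) :
    ∃ ρA ρB : Fin n → Fin (m + 2) × Bool,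
      (∀ x, (∀ i, w i ≠ x) → ρA x = ρB x) ∧ (∀ i, ρA (w i) = (i, false)) ∧
      (∀ i, ρB (w i) = (i, true)) ∧
      (∀ σ ∈ A, ∀ x ∈ σ.support, ∀ y ∈ σ.support, ρA x = ρA y) ∧
      (∀ σ ∈ B, ∀ x ∈ σ.support, ∀ y ∈ σ.support, ρB x = ρB y) := by
  classical
  -- Factors right of P see the second copy `Sum.inr` of the points `w i`; all other points have
  -- only the copy `Sum.inl`.
  let eB : Fin n → Fin n ⊕ Fin n := fun x => if ∃ i, w i = x then Sum.inr x else Sum.inl x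
  have heB : Function.Injective eB := by
    intro x y h
    simp only [eB] at h
    split_ifs at h <;> simp_all
  let S : Finset (Fin n ⊕ Fin n) :=
    l.toFinset.image Sum.inl ∪ (Finset.univ.image w).image Sum.inr
  obtain ⟨κ, h₁, h₂⟩ := exists_labelling S
    ((A.map fun σ => σ.support.image Sum.inl) ++ B.map fun σ => σ.support.image eB) <| by
      intro e he
      simp only [List.mem_append, List.mem_map] at he
      rcases he with ⟨σ, hσ, rfl⟩ | ⟨σ, hσ, rfl⟩
      · have := (fact.isCycle σ (by simp [hσ])).two_le_card_support
        exact (Finset.card_pos.1 (by omega)).image _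
      · have := (fact.isCycle σ (by simp [hσ])).two_le_card_support
        exact (Finset.card_pos.1 (by omega)).image _
  have hA : ∀ σ ∈ A, ∀ x ∈ σ.support, ∀ y ∈ σ.support,
      κ (Sum.inl x) = κ (Sum.inl y) := fun σ hσ x hx y hy =>
    h₁ _ (List.mem_append_left _ (List.mem_map_of_mem hσ)) _ (Finset.mem_image_of_mem _ hx) _
      (Finset.mem_image_of_mem _ hy)
  have hB : ∀ σ ∈ B, ∀ x ∈ σ.support, ∀ y ∈ σ.support, κ (eB x) = κ (eB y) :=
    fun σ hσ x hx y hy =>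
    h₁ _ (List.mem_append_right _ (List.mem_map_of_mem hσ)) _ (Finset.mem_image_of_mem _ hx) _
      (Finset.mem_image_of_mem _ hy)
  have hsum : (((A.map fun σ : Perm (Fin n) =>
        (σ.support.image Sum.inl : Finset (Fin n ⊕ Fin n))) ++
      B.map fun σ : Perm (Fin n) => σ.support.image eB).map
        fun e : Finset (Fin n ⊕ Fin n) => e.card - 1).sum =
      totalRank A + totalRank B := by
    simp only [List.map_append, List.map_map, List.sum_append, totalRank, Function.comp_def,
      Finset.card_image_of_injective _ heB, Finset.card_image_of_injective _ Sum.inl_injective]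
  have hP : P.support.card = m + 2 := by
    have : P.support = Finset.univ.image w := by
      ext x; simp [support_iff]
    rw [this, Finset.card_image_of_injective _ inj, Finset.card_univ, Fintype.card_fin]
  have hS : S.card = l.length + (m + 2) := by
    rw [Finset.card_union_of_disjoint, Finset.card_image_of_injective _ Sum.inl_injective,
      Finset.card_image_of_injective _ Sum.inr_injective, Finset.card_image_of_injective _ inj,
      Finset.card_univ, Fintype.card_fin, List.toFinset_card_of_nodup fact.nodup]
    rw [Finset.disjoint_left]
    simp
  have hrank := fact.rank_eq
  rw [totalRank_append, totalRank_cons, hP] at hrank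
  let t : Fin (m + 2) × Bool → Fin n ⊕ Fin n :=
    fun p => if p.2 then Sum.inr (w p.1) else Sum.inl (w p.1)
  -- A class without copies of the `w i` would be preserved by every factor, including P, which
  -- moves only the `w i`. Then the whole cycle would preserve it, although it misses `w 0`.
  have hall : ∀ x ∈ l, κ (Sum.inl x) ∈ Set.range (κ ∘ t) := by
    intro x₀ hx₀
    by_contra hcon
    let q : Fin n → Prop := fun y => κ (Sum.inl y) = κ (Sum.inl x₀)
    have hqw : ∀ i, ¬ q (w i) := fun i hi => hcon ⟨(i, false), hi⟩
    have hqB : ∀ y, q y = (κ (eB y) = κ (Sum.inl x₀)) := by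
      intro y
      by_cases hy : ∃ i, w i = y
      · obtain ⟨i, rfl⟩ := hy
        have : eB (w i) = Sum.inr (w i) := by simp [eB]
        rw [this]
        exact propext ⟨fun h => (hqw i h).elim, fun h => (hcon ⟨(i, true), h⟩).elim⟩
      · simp only [eB, hy, if_false, q]
    have hinv : ∀ σ ∈ A ++ P :: B, ∀ y, q (σ y) = q y := by
      intro σ hσ y
      simp only [List.mem_append, List.mem_cons] at hσ
      rcases hσ with hσ | rfl | hσ
      · have := invariant_of_support (κ := fun x => κ (Sum.inl x)) (hA σ hσ) y
        simp only [q, this]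
      · by_cases hy : y ∈ σ.support
        · obtain ⟨i, rfl⟩ := (support_iff y).1 hy
          obtain ⟨j, hj⟩ := (support_iff _).1 (Perm.apply_mem_support.2 hy)
          rw [← hj]
          exact propext (iff_of_false (hqw j) (hqw i))
        · rw [Perm.notMem_support.1 hy]
      · have := invariant_of_support (κ := fun x => κ (eB x)) (hB σ hσ) y
        simp only [hqB, this]
    have hw0 : w 0 ∈ l := fact.mem_of_mem_support P (by simp) _ ((support_iff _).2 ⟨0, rfl⟩)
    have := label_eq_of_formPerm_invariant (κ := q) fact.nodup (fun y _ => by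
      rw [← fact.prod_eq]; exact list_prod_invariant hinv y) hx₀ hw0
    exact hqw 0 (this ▸ rfl)
  have himage : S.image κ ⊆ Finset.univ.image (κ ∘ t) := by
    intro y hy
    simp only [S, Finset.mem_image, Finset.mem_union, List.mem_toFinset, Finset.mem_univ,
      true_and] at hy ⊢
    obtain ⟨_, ⟨x, hx, rfl⟩ | ⟨_, ⟨i, rfl⟩, rfl⟩, rfl⟩ := hy
    · exact hall x hx
    · exact ⟨(i, true), rfl⟩
  have hcard := Finset.card_le_card himage
  -- There are at least as many classes as copies, and each is the class of a copy. Inverting `κ ∘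
  -- t` turns classes into labels `(i, b)`.
  have hinj : Function.Injective (κ ∘ t) := by
    have hle : (Finset.univ.image (κ ∘ t)).card = (Finset.univ : Finset (Fin (m + 2) × Bool)).card := by
      refine le_antisymm Finset.card_image_le ?_
      rw [Finset.card_univ, Fintype.card_prod, Fintype.card_fin, Fintype.card_bool]
      omega
    simpa using Finset.card_image_iff.1 hle
  have hleft := Function.leftInverse_invFun hinj
  refine ⟨fun x => Function.invFun (κ ∘ t) (κ (Sum.inl x)),
    fun x => Function.invFun (κ ∘ t) (κ (eB x)), ?_, ?_, ?_, ?_, ?_⟩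
  · intro x hx
    have : eB x = Sum.inl x := by simp [eB, hx]
    simp only [this]
  · exact fun i => hleft (i, false)
  · intro i
    have : eB (w i) = Sum.inr (w i) := by simp [eB]
    simp only [this]
    exact hleft (i, true)
  · exact fun σ hσ x hx y hy => by simp only [hA σ hσ x hx y hy]
  · exact fun σ hσ x hx y hy => by simp only [hB σ hσ x hx y hy]

/-! ### Sorted lists and products of selected factors -/

section ListLemmas

variable {V : Type*}

/-- Putting an entry of least key in front only extends the first nonempty bucket or opens an
earlier one. Applied to `Labelled.key`, this cuts `l` into its blocks. -/
theorem eq_flatMap_filter_of_sorted (key : V → ℕ) (K : ℕ) :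
    ∀ l : List V, (∀ x ∈ l, key x < K) → l.Pairwise (fun x y => key x ≤ key y) →
      l = (List.range K).flatMap fun i => l.filter fun x => key x = i := by
  intro l
  induction l with
  | nil => intro _ _; simp
  | cons x l ih =>
    intro hK hp
    rw [List.pairwise_cons] at hp
    obtain ⟨r, rfl⟩ := Nat.exists_eq_add_of_lt (hK x List.mem_cons_self)
    have ih' := ih (fun y hy => hK y (List.mem_cons_of_mem _ hy)) hp.2
    have hsplit : ∀ f : ℕ → List V, ((List.range (key x + r + 1)).flatMap f) =
        (List.range (key x)).flatMap f ++ (f (key x) ++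
          (List.map (fun y => key x + y) (List.map (fun y => 1 + y) (List.range r))).flatMap f) := by
      intro f
      rw [show key x + r + 1 = key x + (1 + r) by ring, List.range_add, List.range_add]
      simp [List.flatMap_append]
    rw [hsplit] at ih' ⊢
    have h₀ : ∀ j < key x, l.filter (fun y => key y = j) = [] := by
      intro j hj
      rw [List.filter_eq_nil_iff]
      intro y hy
      have := hp.1 y hy
      simp; omega
    have h₁ : ((List.range (key x)).flatMap fun i => l.filter fun y => key y = i) = [] := by
      rw [List.flatMap_eq_nil_iff]
      exact fun j hj => h₀ j (List.mem_range.1 hj)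
    have h₂ : ((List.range (key x)).flatMap fun i => (x :: l).filter fun y => key y = i) = [] := by
      rw [List.flatMap_eq_nil_iff]
      intro j hj
      have := List.mem_range.1 hj
      rw [List.filter_cons_of_neg (by simp; omega), h₀ j this]
    have h₃ : ((List.map (fun y => key x + y) (List.map (fun y => 1 + y) (List.range r))).flatMap
        fun i => (x :: l).filter fun y => key y = i) =
        (List.map (fun y => key x + y) (List.map (fun y => 1 + y) (List.range r))).flatMap
          fun i => l.filter fun y => key y = i := by
      refine List.flatMap_congr fun i hi => ?_
      rw [List.filter_cons_of_neg]
      simp only [List.map_map, List.mem_map, List.mem_range, Function.comp] at hi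
      obtain ⟨a, _, rfl⟩ := hi
      simp
    rw [h₂, h₃, List.filter_cons_of_pos (by simp)]
    rw [h₁] at ih'
    simp only [List.nil_append, List.cons_append] at ih' ⊢
    rw [← ih']

theorem flatMap_range_three_mul (f : ℕ → List V) (k : ℕ) :
    (List.range (3 * k)).flatMap f = (List.ofFn fun i : Fin k =>
      f (3 * i.val) ++ (f (3 * i.val + 1) ++ f (3 * i.val + 2))).flatten := by
  induction k with
  | zero => simp
  | succ k ih =>
    rw [show 3 * (k + 1) = 3 * k + 1 + 1 + 1 by ring, List.range_succ, List.range_succ,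
      List.range_succ]
    simp only [List.flatMap_append, ih, List.ofFn_succ', List.concat_eq_append,
      List.flatten_append]
    simp [List.append_assoc]

theorem flatMap_range_eq_ofFn (f : ℕ → List V) (k : ℕ) :
    (List.range k).flatMap f = (List.ofFn fun i : Fin k => f i.val).flatten := by
  induction k with
  | zero => simp
  | succ k ih =>
    rw [List.range_succ]
    simp only [List.flatMap_append, ih, List.ofFn_succ', List.concat_eq_append,
      List.flatten_append]
    simp

theorem exists_append_of_flatten_ofFn {k : ℕ} (f : Fin k → List V) (i : Fin k) :
    ∃ X Y, (List.ofFn f).flatten = X ++ (f i ++ Y) := by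
  obtain ⟨s, t, h⟩ := List.append_of_mem (List.mem_ofFn.2 ⟨i, rfl⟩ : f i ∈ List.ofFn f)
  exact ⟨s.flatten, t.flatten, by simp [h]⟩

/-- The path of `x` under the factors never leaves the label `c`, and the dropped factors fix every
point with that label. -/
theorem filter_prod_apply {W : Type*} {M : List (Perm V)} {ρ : V → W} {p : Perm V → Bool} {c : W}
    (hinv : ∀ σ ∈ M, ∀ x, ρ (σ x) = ρ x)
    (hp : ∀ σ ∈ M, p σ = false → ∀ x, ρ x = c → σ x = x) {x : V} (hx : ρ x = c) :
    (M.filter p).prod x = M.prod x ∧ ρ (M.prod x) = c := by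
  induction M with
  | nil => simpa
  | cons σ M ih =>
    obtain ⟨ih₁, ih₂⟩ := ih (fun τ hτ => hinv τ (List.mem_cons_of_mem _ hτ))
      (fun τ hτ => hp τ (List.mem_cons_of_mem _ hτ))
    rw [List.prod_cons, Perm.mul_apply, hinv σ List.mem_cons_self, List.filter_cons]
    refine ⟨?_, ih₂⟩
    split_ifs with h
    · rw [List.prod_cons, Perm.mul_apply, ih₁]
    · rw [ih₁, hp σ List.mem_cons_self (by simpa using h) _ ih₂]

end ListLemmas

/-! ### The labels along `l` and the block cycles -/

namespace Labelled

variable {n m : ℕ} {l : List (Fin n)} {A B : List (Perm (Fin n))} {P : Perm (Fin n)}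
  {w : Fin (m + 2) → Fin n} {ρA ρB : Fin n → Fin (m + 2) × Bool}

/-- The points of the block `αᵢ`. -/
def alpha (l : List (Fin n)) (ρB : Fin n → Fin (m + 2) × Bool) (i : Fin (m + 2)) : List (Fin n) :=
  l.filter fun x => ρB x = (i, false)

open Classical in
/-- The points of the block `βᵢ`. -/
def beta (l : List (Fin n)) (w : Fin (m + 2) → Fin n) (ρB : Fin n → Fin (m + 2) × Bool)
    (i : Fin (m + 2)) : List (Fin n) :=
  l.filter fun x => ρB x = (i, true) ∧ ∀ j, w j ≠ x

open Classical in
/-- The factors whose support is contained in `s`. -/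
def within (L : List (Perm (Fin n))) (s : List (Fin n)) : List (Perm (Fin n)) :=
  L.filter fun σ => ∀ x ∈ σ.support, x ∈ s

open Classical in
/-- The position of a point in the order of the blocks. -/
def key (w : Fin (m + 2) → Fin n) (ρB : Fin n → Fin (m + 2) × Bool) (x : Fin n) : ℕ :=
  3 * (ρB x).1.val + if (ρB x).2 then if ∃ j, w j = x then 1 else 2 else 0

theorem prod_within_apply_of_notMem (M : List (Perm (Fin n))) {C : List (Fin n)} {x : Fin n}
    (hx : x ∉ C) : (within M C).prod x = x := by
  induction M with
  | nil => simp [within]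
  | cons σ M ih =>
    rw [within, List.filter_cons]
    split_ifs with hσ
    · rw [List.prod_cons, Perm.mul_apply]
      rw [within] at ih
      rw [ih]
      by_contra hne
      exact hx ((by simpa using hσ : ∀ x, σ x ≠ x → x ∈ C) x hne)
    · exact ih

theorem mem_alpha {i : Fin (m + 2)} {x : Fin n} : x ∈ alpha l ρB i ↔ x ∈ l ∧ ρB x = (i, false) := by
  simp [alpha]

theorem mem_beta {i : Fin (m + 2)} {x : Fin n} :
    x ∈ beta l w ρB i ↔ x ∈ l ∧ ρB x = (i, true) ∧ ∀ j, w j ≠ x := by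
  simp [beta]

theorem key_off {x : Fin n} (hx : ∀ j, w j ≠ x) :
    key w ρB x = 3 * (ρB x).1.val + if (ρB x).2 then 2 else 0 := by
  simp [key, hx]

theorem filter_key_zero (i : Fin (m + 2)) :
    (l.filter fun x => key w ρB x = 3 * i.val) = alpha l ρB i := by
  refine List.filter_congr fun x _ => ?_
  simp only [decide_eq_decide]
  rw [key]
  constructor
  · intro hx
    split_ifs at hx with h₁
    · omega
    · omega
    · exact Prod.ext (Fin.ext (by simp at hx ⊢; omega)) (by simpa using h₁)
  · intro hx
    simp [hx]

theorem filter_key_two (i : Fin (m + 2)) :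
    (l.filter fun x => key w ρB x = 3 * i.val + 2) = beta l w ρB i := by
  refine List.filter_congr fun x _ => ?_
  simp only [decide_eq_decide]
  rw [key]
  constructor
  · intro hx
    split_ifs at hx with h₁ h₂
    · omega
    · exact ⟨Prod.ext (Fin.ext (by simp at hx ⊢; omega)) (by simpa using h₁),
        by simpa using h₂⟩
    · omega
  · rintro ⟨hx, hw⟩
    simp [hx, hw]

theorem inv_left (h : Labelled l A B P w ρA ρB)
    : ∀ σ ∈ A, ∀ x, ρA (σ x) = ρA x := fun σ hσ => invariant_of_support (h.left σ hσ)

theorem inv_right (h : Labelled l A B P w ρA ρB) : ∀ σ ∈ B, ∀ x, ρB (σ x) = ρB x :=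
  fun σ hσ => invariant_of_support (h.right σ hσ)

theorem w_mem (h : Labelled l A B P w ρA ρB) (i : Fin (m + 2)) : w i ∈ l :=
  h.fact.mem_of_mem_support P (by simp) _ ((h.support_iff _).2 ⟨i, rfl⟩)

/-- The two labellings differ only at the points of P, where `ρA` assigns `(i, false)` to `w i`. So
`alpha`, defined by `ρB`, omits exactly `w i` from this label class of `ρA`. -/
theorem mem_left (h : Labelled l A B P w ρA ρB) {i : Fin (m + 2)} {x : Fin n} :
    x ∈ alpha l ρB i ++ [w i] ↔ x ∈ l ∧ ρA x = (i, false) := by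
  rw [List.mem_append, mem_alpha, List.mem_singleton]
  by_cases hx : ∃ j, w j = x
  · obtain ⟨j, rfl⟩ := hx
    simp [h.left_w, h.right_w, h.w_mem, h.inj.eq_iff]
  · push Not at hx
    rw [h.eq_off x hx]
    have := (hx i).symm
    tauto

theorem mem_right (h : Labelled l A B P w ρA ρB) {i : Fin (m + 2)} {x : Fin n} :
    x ∈ w i :: beta l w ρB i ↔ x ∈ l ∧ ρB x = (i, true) := by
  rw [List.mem_cons, mem_beta]
  by_cases hx : ∃ j, w j = x
  · obtain ⟨j, rfl⟩ := hx
    simp [h.right_w, h.w_mem, h.inj.eq_iff]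
  · push Not at hx
    have := (hx i).symm
    tauto

theorem not_w_of_false (h : Labelled l A B P w ρA ρB)
    {i : Fin (m + 2)} {x : Fin n} (hx : ρB x = (i, false)) :
    ∀ j, w j ≠ x := by
  rintro j rfl
  simp [h.right_w] at hx

theorem apply_eq (h : Labelled l A B P w ρA ρB)
    (X Y : List (Fin n)) (y z : Fin n) (hl : l = X ++ y :: z :: Y) :
    A.prod (P (B.prod y)) = z := by
  have h₁ : (A ++ P :: B).prod y = z := by
    rw [h.fact.prod_eq, hl]
    exact formPerm_apply_of_append (hl ▸ h.fact.nodup)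
  simpa [List.prod_append] using h₁

/-- The possible steps from a point of `l` to the next one. -/
theorem step (h : Labelled l A B P w ρA ρB)
    (X Y : List (Fin n)) (y z : Fin n) (hl : l = X ++ y :: z :: Y) :
    ((∀ j, w j ≠ B.prod y) ∧ P (B.prod y) = B.prod y ∧ ρA z = ρB y) ∨
      ∃ i j, j.val = i.val + 1 ∧ ρB y = (i, true) ∧ ρA z = (j, false) := by
  have hz := h.apply_eq X Y y z hl
  have hB : ρB (B.prod y) = ρB y := list_prod_invariant h.inv_right y
  have hA : ρA z = ρA (P (B.prod y)) := by rw [← hz]; exact list_prod_invariant h.inv_left _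
  by_cases hw : ∃ i, w i = B.prod y
  · right
    obtain ⟨i, hi⟩ := hw
    obtain ⟨j, hj, hij⟩ := h.next i
    rw [← hi, h.right_w] at hB
    rw [← hi, hj, h.left_w] at hA
    rcases hij with rfl | hij
    -- P wraps round to `w 0`, which the factors in `A` fix, so `z = w 0`. But `w 0` is the first
    -- entry of `l` and `z` has a predecessor in a list without repetitions.
    · exfalso
      rw [← hi, hj, h.fix] at hz
      obtain ⟨l', hl'⟩ := h.head
      have hnd := h.fact.nodup
      cases X with
      | nil =>
        simp only [List.nil_append] at hl
        rw [hl] at hl' hnd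
        simp only [List.cons.injEq] at hl'
        rw [hl'.1, ← hz] at hnd
        simp at hnd
      | cons x X =>
        rw [hl] at hl' hnd
        simp only [List.cons_append, List.cons.injEq] at hl'
        rw [hl'.1, ← hz] at hnd
        simp at hnd
    · exact ⟨i, j, hij, hB.symm, hA⟩
  · left
    push Not at hw
    have hP : P (B.prod y) = B.prod y := by
      by_contra hne
      obtain ⟨i, hi⟩ := (h.support_iff _).1 (Perm.mem_support.2 hne)
      exact hw i hi
    refine ⟨hw, hP, ?_⟩
    rw [hA, hP, h.eq_off _ hw, hB]

theorem key_w (h : Labelled l A B P w ρA ρB)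
    (i : Fin (m + 2)) : key w ρB (w i) = 3 * i.val + 1 := by
  simp [key, h.right_w]

/-- Each block has the keys `3 * i`, `3 * i + 1`, `3 * i + 2` for αᵢ, wᵢ, βᵢ. A step either carries
the label over or passes from `(i, true)` to `(i + 1, false)`; the only extra care is at the `w i`,
which carry both labels. -/
theorem key_step (h : Labelled l A B P w ρA ρB)
    (X Y : List (Fin n)) (y z : Fin n) (hl : l = X ++ y :: z :: Y) :
    key w ρB y ≤ key w ρB z := by
  have hle : key w ρB y ≤ 3 * (ρB y).1.val + if (ρB y).2 then 2 else 0 := by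
    rw [key]
    split_ifs <;> omega
  refine hle.trans ?_
  rcases h.step X Y y z hl with ⟨_, _, h₃⟩ | ⟨i, j, hij, h₁, h₂⟩
  · by_cases hz : ∃ j, w j = z
    · obtain ⟨j, rfl⟩ := hz
      rw [h.left_w] at h₃
      rw [h.key_w, ← h₃]
      simp
    · push Not at hz
      rw [key_off hz, ← h.eq_off z hz, h₃]
  · by_cases hz : ∃ j, w j = z
    · obtain ⟨j', rfl⟩ := hz
      rw [h.left_w] at h₂
      simp only [Prod.mk.injEq, and_true] at h₂
      subst h₂
      rw [h.key_w, h₁]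
      simp only [if_true]
      omega
    · push Not at hz
      rw [key_off hz, ← h.eq_off z hz, h₂, h₁]
      simp
      omega

theorem pairwise_key (h : Labelled l A B P w ρA ρB)
    : l.Pairwise fun x y => key w ρB x ≤ key w ρB y := by
  have : IsTrans (Fin n) fun x y => key w ρB x ≤ key w ρB y := ⟨fun _ _ _ => le_trans⟩
  rw [← List.isChain_iff_pairwise, List.isChain_iff_forall_rel_of_append_cons_cons]
  exact fun _ _ _ _ hl => h.key_step _ _ _ _ hl

theorem filter_key_one (h : Labelled l A B P w ρA ρB) (i : Fin (m + 2)) :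
    (l.filter fun x => key w ρB x = 3 * i.val + 1) = [w i] := by
  rw [← List.perm_singleton]
  refine (List.perm_ext_iff_of_nodup (h.fact.nodup.filter _) (List.nodup_singleton _)).2 fun x => ?_
  simp only [List.mem_filter, decide_eq_true_eq, List.mem_singleton]
  constructor
  · rintro ⟨_, hx⟩
    by_cases hw : ∃ j, w j = x
    · obtain ⟨j, rfl⟩ := hw
      rw [h.key_w] at hx
      rw [Fin.ext (by omega : j.val = i.val)]
    · push Not at hw
      rw [key_off hw] at hx
      split_ifs at hx <;> omega
  · rintro rfl
    exact ⟨h.w_mem i, h.key_w i⟩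

theorem list_eq (h : Labelled l A B P w ρA ρB)
    : l = (List.ofFn fun i => alpha l ρB i ++ w i :: beta l w ρB i).flatten := by
  have h₁ := eq_flatMap_filter_of_sorted (key w ρB) (3 * (m + 2)) l (fun x _ => by
    have := (ρB x).1.isLt
    rw [key]; split_ifs <;> omega) h.pairwise_key
  rw [flatMap_range_three_mul] at h₁
  simp only [filter_key_zero, h.filter_key_one, filter_key_two] at h₁
  exact h₁

/-- The first entry `w 0` of `l` has key 1, whereas a point of the zeroth α-block would have key 0
and come earlier. -/
theorem alpha_zero (h : Labelled l A B P w ρA ρB) : alpha l ρB 0 = [] := by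
  rw [List.eq_nil_iff_forall_not_mem]
  intro x hx
  rw [← filter_key_zero (w := w)] at hx
  simp only [List.mem_filter, Fin.val_zero, mul_zero, decide_eq_true_eq] at hx
  obtain ⟨l', hl'⟩ := h.head
  have hp := h.pairwise_key
  have h0 := h.key_w 0
  rw [hl'] at hp
  obtain ⟨hxl, hx⟩ := hx
  rw [hl', List.mem_cons] at hxl
  rcases hxl with rfl | hxl
  · simp at h0; omega
  · have := (List.pairwise_cons.1 hp).1 x hxl
    simp at h0; omega

theorem card_ge (h : Labelled l A B P w ρA ρB)
    {σ : Perm (Fin n)} (hσ : σ ∈ A ++ P :: B) : 2 ≤ σ.support.card :=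
  (h.fact.isCycle σ hσ).two_le_card_support

theorem exists_ne (h : Labelled l A B P w ρA ρB)
    {σ : Perm (Fin n)} (hσ : σ ∈ A ++ P :: B) (a : Fin n) :
    ∃ x ∈ σ.support, x ≠ a := Finset.exists_mem_ne (h.card_ge hσ) a

theorem exists_support (h : Labelled l A B P w ρA ρB)
    {σ : Perm (Fin n)} (hσ : σ ∈ A ++ P :: B) : ∃ x, x ∈ σ.support :=
  Finset.card_pos.1 (by have := h.card_ge hσ; omega)

/-- All points of a support share one label, which names the block. If a factor has the label that
its side of P does not give to the `w i`, it avoids them all, and there the two labellings agree. -/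
theorem classify (h : Labelled l A B P w ρA ρB) {σ : Perm (Fin n)} (hσ : σ ∈ A ∨ σ ∈ B) :
    (∃ i, ∀ x ∈ σ.support, x ∈ alpha l ρB i ++ [w i]) ∨
      ∃ i, ∀ x ∈ σ.support, x ∈ w i :: beta l w ρB i := by
  have hmem : σ ∈ A ++ P :: B := by rcases hσ with hσ | hσ <;> simp [hσ]
  obtain ⟨x, hx⟩ := h.exists_support hmem
  have hl := h.fact.mem_of_mem_support σ hmem
  rcases hσ with hσ | hσ
  · obtain ⟨i, b, hb⟩ : ∃ i b, ρA x = (i, b) := ⟨_, _, rfl⟩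
    have hc : ∀ y ∈ σ.support, ρA y = (i, b) := fun y hy => (h.left σ hσ y hy x hx).trans hb
    cases b
    · exact Or.inl ⟨i, fun y hy => h.mem_left.2 ⟨hl y hy, hc y hy⟩⟩
    · refine Or.inr ⟨i, fun y hy => h.mem_right.2 ⟨hl y hy, ?_⟩⟩
      rw [← h.eq_off, hc y hy]
      rintro j rfl
      simpa [h.left_w] using hc _ hy
  · obtain ⟨i, b, hb⟩ : ∃ i b, ρB x = (i, b) := ⟨_, _, rfl⟩
    have hc : ∀ y ∈ σ.support, ρB y = (i, b) := fun y hy => (h.right σ hσ y hy x hx).trans hb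
    cases b
    · refine Or.inl ⟨i, fun y hy => h.mem_left.2 ⟨hl y hy, ?_⟩⟩
      rw [h.eq_off, hc y hy]
      exact h.not_w_of_false (hc y hy)
    · exact Or.inr ⟨i, fun y hy => h.mem_right.2 ⟨hl y hy, hc y hy⟩⟩

theorem left_unique (h : Labelled l A B P w ρA ρB)
    {i j : Fin (m + 2)} {x : Fin n} (hi : x ∈ alpha l ρB i ++ [w i])
    (hj : x ∈ alpha l ρB j ++ [w j]) : i = j := by
  have := (h.mem_left.1 hi).2.symm.trans (h.mem_left.1 hj).2
  simpa using this

theorem right_unique (h : Labelled l A B P w ρA ρB)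
    {i j : Fin (m + 2)} {x : Fin n} (hi : x ∈ w i :: beta l w ρB i)
    (hj : x ∈ w j :: beta l w ρB j) : i = j := by
  have := (h.mem_right.1 hi).2.symm.trans (h.mem_right.1 hj).2
  simpa using this

theorem left_right (h : Labelled l A B P w ρA ρB)
    {i j : Fin (m + 2)} {x : Fin n} (hi : x ∈ alpha l ρB i ++ [w i])
    (hj : x ∈ w j :: beta l w ρB j) : x = w i ∧ i = j := by
  have h₁ := (h.mem_left.1 hi).2
  have h₂ := (h.mem_right.1 hj).2
  by_cases hx : ∃ q, w q = x
  · obtain ⟨q, rfl⟩ := hx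
    rw [h.left_w] at h₁
    rw [h.right_w] at h₂
    simp_all
  · push Not at hx
    rw [h.eq_off x hx, h₂] at h₁
    simp at h₁

theorem not_left_and_right (h : Labelled l A B P w ρA ρB)
    {σ : Perm (Fin n)} (hσ : σ ∈ A ++ P :: B) {i j : Fin (m + 2)}
    (hi : ∀ x ∈ σ.support, x ∈ alpha l ρB i ++ [w i])
    (hj : ∀ x ∈ σ.support, x ∈ w j :: beta l w ρB j) : False := by
  obtain ⟨x, hx, hne⟩ := h.exists_ne hσ (w i)
  exact hne (h.left_right (hi x hx) (hj x hx)).1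

theorem P_not_left (h : Labelled l A B P w ρA ρB)
    (i : Fin (m + 2)) : ¬ ∀ x ∈ P.support, x ∈ alpha l ρB i ++ [w i] := by
  intro hP
  have := fun j => (h.mem_left.1 (hP (w j) ((h.support_iff _).2 ⟨j, rfl⟩))).2
  simp only [h.left_w, Prod.mk.injEq, and_true] at this
  exact absurd ((this 0).trans (this 1).symm) (by simp)

theorem P_not_right (h : Labelled l A B P w ρA ρB)
    (i : Fin (m + 2)) : ¬ ∀ x ∈ P.support, x ∈ w i :: beta l w ρB i := by
  intro hP
  have := fun j => (h.mem_right.1 (hP (w j) ((h.support_iff _).2 ⟨j, rfl⟩))).2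
  simp only [h.right_w, Prod.mk.injEq, and_true] at this
  exact absurd ((this 0).trans (this 1).symm) (by simp)

/-- A factor to the right of `P` that lies in a block `αᵢ wᵢ` avoids all the points `wⱼ`. -/
theorem avoid_of_right (h : Labelled l A B P w ρA ρB)
    {τ : Perm (Fin n)} (hτ : τ ∈ B) {i : Fin (m + 2)}
    (hi : ∀ x ∈ τ.support, x ∈ alpha l ρB i ++ [w i]) (j : Fin (m + 2)) : w j ∉ τ.support := by
  intro hj
  obtain ⟨x, hx, hne⟩ := h.exists_ne (σ := τ) (by simp [hτ]) (w i)
  have h₁ : ρB x = (i, false) := by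
    have := hi x hx
    rw [List.mem_append, List.mem_singleton, mem_alpha] at this
    exact (this.resolve_right hne).2
  have := h.right τ hτ _ hj _ hx
  rw [h.right_w, h₁] at this
  simp at this

/-- A factor to the left of `P` that lies in a block `wᵢ βᵢ` avoids all the points `wⱼ`. -/
theorem avoid_of_left (h : Labelled l A B P w ρA ρB)
    {σ : Perm (Fin n)} (hσ : σ ∈ A) {i : Fin (m + 2)}
    (hi : ∀ x ∈ σ.support, x ∈ w i :: beta l w ρB i) (j : Fin (m + 2)) : w j ∉ σ.support := by
  intro hj
  obtain ⟨x, hx, hne⟩ := h.exists_ne (σ := σ) (by simp [hσ]) (w i)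
  have hx' := hi x hx
  rw [List.mem_cons, mem_beta] at hx'
  obtain ⟨_, h₁, h₂⟩ := hx'.resolve_left hne
  have := h.left σ hσ _ hj _ hx
  rw [h.left_w, h.eq_off x h₂, h₁] at this
  simp at this

/-- Between neighbours of the block the full product does not use P, and the factors outside the
block fix the intermediate points. So the selected product has the right successors, and
`eq_formPerm` applies. -/
theorem prod_within_left (h : Labelled l A B P w ρA ρB) (i : Fin (m + 2)) :
    (within (A ++ P :: B) (alpha l ρB i ++ [w i])).prod = (alpha l ρB i ++ [w i]).formPerm := by
  classical
  set C := alpha l ρB i ++ [w i] with hC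
  obtain ⟨X₀, Y₀, hXY⟩ := exists_append_of_flatten_ofFn
    (fun i => alpha l ρB i ++ w i :: beta l w ρB i) i
  have hl : l = X₀ ++ C ++ (beta l w ρB i ++ Y₀) := by
    conv_lhs => rw [h.list_eq, hXY]
    simp [hC]
  have hnd : C.Nodup := by
    have := h.fact.nodup
    rw [hl] at this
    exact this.sublist ((List.sublist_append_right _ _).trans (List.sublist_append_left _ _))
  refine eq_formPerm hnd ?_ ?_
  · exact fun x hx => prod_within_apply_of_notMem _ hx
  · intro X y z Y hCe
    have hl' : l = (X₀ ++ X) ++ y :: z :: (Y ++ (beta l w ρB i ++ Y₀)) := by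
      conv_lhs => rw [hl, hCe]
      simp [List.append_assoc]
    have hz : ρA z = (i, false) := (h.mem_left.1 (by rw [← hC, hCe]; simp)).2
    have hy : ρB y = (i, false) := by
      have : y ∈ alpha l ρB i := by
        have hyC : y ∈ C := by rw [hCe]; simp
        rw [hC, List.mem_append, List.mem_singleton] at hyC
        -- `w i` is the last entry of `C`, while `y` has the successor `z` in `C`.
        refine hyC.resolve_right ?_
        rintro rfl
        obtain ⟨Z, hZ⟩ : ∃ Z, X ++ [w i] ++ (z :: Y) = Z ++ [w i] := ⟨alpha l ρB i, by simp [← hC, hCe]⟩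
        have hnd' : (X ++ [w i] ++ (z :: Y)).Nodup := by simpa [hCe] using hnd
        have hlast : (z :: Y).getLast (by simp) = w i := by
          have := List.getLast_congr (by simp) (by simp) hZ
          rw [List.getLast_append_of_ne_nil (by simp) (by simp)] at this
          simpa using this
        have hdis := List.disjoint_of_nodup_append hnd'
        exact hdis (by simp : w i ∈ X ++ [w i]) (hlast ▸ List.getLast_mem _)
      exact (mem_alpha.1 this).2
    rcases h.step _ _ y z hl' with ⟨h₁, h₂, h₃⟩ | ⟨_, _, _, h₁, _⟩
    · have happ := h.apply_eq _ _ y z hl'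
      rw [h₂] at happ
      rw [within, List.filter_append, List.filter_cons, if_neg (by simpa [hC] using h.P_not_left i),
        List.prod_append, Perm.mul_apply]
      have hB := filter_prod_apply (M := B) (p := fun σ => decide (∀ x ∈ σ.support, x ∈ C))
        h.inv_right (c := (i, false)) (by
          intro σ hσ hp x hx
          by_contra hne
          rw [decide_eq_false_iff_not] at hp
          refine hp fun x' hx' => ?_
          have hc := (h.right σ hσ _ hx' _ (Perm.mem_support.2 hne)).trans hx
          refine List.mem_append_left _ (mem_alpha.2 ⟨?_, hc⟩)
          exact h.fact.mem_of_mem_support σ (by simp [hσ]) _ hx') hy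
      have hA := filter_prod_apply (M := A) (p := fun σ => decide (∀ x ∈ σ.support, x ∈ C))
        h.inv_left (c := (i, false)) (x := B.prod y) (by
          intro σ hσ hp x hx
          by_contra hne
          rw [decide_eq_false_iff_not] at hp
          refine hp fun x' hx' => ?_
          have hc := (h.left σ hσ _ hx' _ (Perm.mem_support.2 hne)).trans hx
          refine h.mem_left.2 ⟨?_, hc⟩
          exact h.fact.mem_of_mem_support σ (by simp [hσ]) _ hx') (by
            rw [h.eq_off _ h₁]; exact hB.2)
      rw [hB.1, hA.1, happ]
    · rw [hy] at h₁
      simp at h₁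

theorem prod_within_right (h : Labelled l A B P w ρA ρB) (i : Fin (m + 2)) :
    (within (A ++ P :: B) (w i :: beta l w ρB i)).prod = (w i :: beta l w ρB i).formPerm := by
  classical
  set C := w i :: beta l w ρB i with hC
  obtain ⟨X₀, Y₀, hXY⟩ := exists_append_of_flatten_ofFn
    (fun i => alpha l ρB i ++ w i :: beta l w ρB i) i
  have hl : l = (X₀ ++ alpha l ρB i) ++ C ++ Y₀ := by
    conv_lhs => rw [h.list_eq, hXY]
    simp [hC]
  have hnd : C.Nodup := by
    have := h.fact.nodup
    rw [hl] at this
    exact this.sublist ((List.sublist_append_right _ _).trans (List.sublist_append_left _ _))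
  refine eq_formPerm hnd ?_ ?_
  · exact fun x hx => prod_within_apply_of_notMem _ hx
  · intro X y z Y hCe
    have hl' : l = (X₀ ++ alpha l ρB i ++ X) ++ y :: z :: (Y ++ Y₀) := by
      conv_lhs => rw [hl, hCe]
      simp [List.append_assoc]
    have hy : ρB y = (i, true) := (h.mem_right.1 (by rw [← hC, hCe]; simp)).2
    have hz : ρB z = (i, true) := (h.mem_right.1 (by rw [← hC, hCe]; simp)).2
    rcases h.step _ _ y z hl' with ⟨h₁, h₂, h₃⟩ | ⟨i', j, hij, h₁, h₂⟩
    · have happ := h.apply_eq _ _ y z hl'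
      rw [h₂] at happ
      rw [within, List.filter_append, List.filter_cons, if_neg (by simpa [hC] using h.P_not_right i),
        List.prod_append, Perm.mul_apply]
      have hB := filter_prod_apply (M := B) (p := fun σ => decide (∀ x ∈ σ.support, x ∈ C))
        h.inv_right (c := (i, true)) (by
          intro σ hσ hp x hx
          by_contra hne
          rw [decide_eq_false_iff_not] at hp
          refine hp fun x' hx' => ?_
          have hc := (h.right σ hσ _ hx' _ (Perm.mem_support.2 hne)).trans hx
          refine h.mem_right.2 ⟨?_, hc⟩
          exact h.fact.mem_of_mem_support σ (by simp [hσ]) _ hx') hy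
      have hA := filter_prod_apply (M := A) (p := fun σ => decide (∀ x ∈ σ.support, x ∈ C))
        h.inv_left (c := (i, true)) (x := B.prod y) (by
          intro σ hσ hp x hx
          by_contra hne
          rw [decide_eq_false_iff_not] at hp
          refine hp fun x' hx' => ?_
          have hc := (h.left σ hσ _ hx' _ (Perm.mem_support.2 hne)).trans hx
          refine h.mem_right.2 ⟨h.fact.mem_of_mem_support σ (by simp [hσ]) _ hx', ?_⟩
          rw [← h.eq_off, hc]
          rintro j rfl
          simp [h.left_w] at hc) (by
            rw [h.eq_off _ h₁]; exact hB.2)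
      rw [hB.1, hA.1, happ]
    -- A passage through P would give `z` a left label of the next block. Off P this contradicts
    -- `hz`; at a point of P it would give that point two indices.
    · exfalso
      rw [hy, Prod.mk.injEq] at h₁
      by_cases hw : ∃ q, w q = z
      · obtain ⟨q, rfl⟩ := hw
        rw [h.left_w] at h₂
        rw [h.right_w] at hz
        simp only [Prod.mk.injEq, and_true] at h₂ hz
        subst h₂ hz
        rw [h₁.1] at hij
        omega
      · push Not at hw
        rw [h.eq_off z hw, hz] at h₂
        simp at h₂

end Labelled

/-! ### Sorting the factors by blocks -/

namespace Labelled

variable {n m : ℕ} {l : List (Fin n)} {A B : List (Perm (Fin n))} {P : Perm (Fin n)}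
  {w : Fin (m + 2) → Fin n} {ρA ρB : Fin n → Fin (m + 2) × Bool}

theorem mem_within {L : List (Perm (Fin n))} {s : List (Fin n)} {σ : Perm (Fin n)} :
    σ ∈ within L s ↔ σ ∈ L ∧ ∀ x ∈ σ.support, x ∈ s := by
  classical
  rw [within, List.mem_filter, decide_eq_true_eq]

open Classical in
/-- The position of a factor in the order of the blocks. -/
def factorKey (l : List (Fin n)) (w : Fin (m + 2) → Fin n) (ρB : Fin n → Fin (m + 2) × Bool)
    (σ : Perm (Fin n)) : ℕ :=
  if h : ∃ i, ∀ x ∈ σ.support, x ∈ alpha l ρB i ++ [w i] then h.choose.val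
  else if h : ∃ i, ∀ x ∈ σ.support, x ∈ w i :: beta l w ρB i then m + 2 + (1 + h.choose.val)
  else m + 2

theorem factorKey_left (h : Labelled l A B P w ρA ρB)
    {σ : Perm (Fin n)} (hσ : σ ∈ A ++ P :: B) {i : Fin (m + 2)}
    (hi : ∀ x ∈ σ.support, x ∈ alpha l ρB i ++ [w i]) : factorKey l w ρB σ = i.val := by
  have hex : ∃ i, ∀ x ∈ σ.support, x ∈ alpha l ρB i ++ [w i] := ⟨i, hi⟩
  obtain ⟨x, hx⟩ := h.exists_support hσ
  rw [factorKey, dif_pos hex, h.left_unique (hex.choose_spec x hx) (hi x hx)]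

theorem factorKey_right (h : Labelled l A B P w ρA ρB)
    {σ : Perm (Fin n)} (hσ : σ ∈ A ++ P :: B) {i : Fin (m + 2)}
    (hi : ∀ x ∈ σ.support, x ∈ w i :: beta l w ρB i) :
    factorKey l w ρB σ = m + 2 + (1 + i.val) := by
  have hnot : ¬ ∃ i, ∀ x ∈ σ.support, x ∈ alpha l ρB i ++ [w i] :=
    fun ⟨_, hj⟩ => h.not_left_and_right hσ hj hi
  have hex : ∃ i, ∀ x ∈ σ.support, x ∈ w i :: beta l w ρB i := ⟨i, hi⟩
  obtain ⟨x, hx⟩ := h.exists_support hσ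
  rw [factorKey, dif_neg hnot, dif_pos hex, h.right_unique (hex.choose_spec x hx) (hi x hx)]

theorem factorKey_P (h : Labelled l A B P w ρA ρB) : factorKey l w ρB P = m + 2 := by
  rw [factorKey, dif_neg fun ⟨i, hi⟩ => h.P_not_left i hi,
    dif_neg fun ⟨i, hi⟩ => h.P_not_right i hi]

/-- Factors in the wrong order commute. -/
theorem commute_of_key_lt (h : Labelled l A B P w ρA ρB)
    {σ τ : Perm (Fin n)} (hσ : σ ∈ A ++ P :: B) (hτ : τ ∈ A ++ P :: B)
    (hpos : σ ∈ A ∨ τ ∈ B) (hσP : σ ∈ A ∨ σ = P ∨ σ ∈ B) (hτP : τ ∈ A ∨ τ = P ∨ τ ∈ B)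
    (hlt : factorKey l w ρB τ < factorKey l w ρB σ) : Commute σ τ := by
  refine commute_of_support_disjoint fun x hxσ hxτ => ?_
  rcases em (τ = P) with rfl | hτ'
  · obtain ⟨q, rfl⟩ := (h.support_iff x).1 hxτ
    rcases em (σ = τ) with rfl | hσ'
    · exact lt_irrefl _ hlt
    rcases h.classify (hσP.imp_right fun H => H.resolve_left hσ') with ⟨i, hi⟩ | ⟨i, hi⟩
    · rw [h.factorKey_left hσ hi, h.factorKey_P] at hlt
      have := i.isLt
      omega
    · rcases hpos with hA | hB
      · exact h.avoid_of_left hA hi q hxσ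
      · rcases h.classify (Or.inr hB) with ⟨j, hj⟩ | ⟨j, hj⟩
        · exact h.P_not_left j hj
        · exact h.P_not_right j hj
  · rcases h.classify (hτP.imp_right fun H => H.resolve_left hτ') with ⟨j, hj⟩ | ⟨j, hj⟩
    · rcases em (σ = P) with rfl | hσ'
      · obtain ⟨q, rfl⟩ := (h.support_iff x).1 hxσ
        rcases hpos with hA | hB
        · rcases h.classify (Or.inl hA) with ⟨j, hj⟩ | ⟨j, hj⟩
          · exact h.P_not_left j hj
          · exact h.P_not_right j hj
        · exact h.avoid_of_right hB hj q hxτ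
      · rcases h.classify (hσP.imp_right fun H => H.resolve_left hσ') with ⟨i, hi⟩ | ⟨i, hi⟩
        · rw [h.factorKey_left hσ hi, h.factorKey_left hτ hj,
            h.left_unique (hi x hxσ) (hj x hxτ)] at hlt
          exact lt_irrefl _ hlt
        · obtain ⟨rfl, -⟩ := h.left_right (hj x hxτ) (hi x hxσ)
          rcases hpos with hA | hB
          · exact h.avoid_of_left hA hi _ hxσ
          · exact h.avoid_of_right hB hj _ hxτ
    · rw [h.factorKey_right hτ hj] at hlt
      rcases em (σ = P) with rfl | hσ'
      · rw [h.factorKey_P] at hlt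
        omega
      · rcases h.classify (hσP.imp_right fun H => H.resolve_left hσ') with ⟨i, hi⟩ | ⟨i, hi⟩
        · rw [h.factorKey_left hσ hi] at hlt
          have := i.isLt
          omega
        · rw [h.factorKey_right hσ hi, h.right_unique (hi x hxσ) (hj x hxτ)] at hlt
          exact lt_irrefl _ hlt

theorem pairwise_commute (h : Labelled l A B P w ρA ρB) : (A ++ P :: B).Pairwise fun σ τ =>
    factorKey l w ρB τ < factorKey l w ρB σ → Commute σ τ := by
  rw [List.pairwise_append, List.pairwise_cons]
  refine ⟨?_, ⟨?_, ?_⟩, ?_⟩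
  · refine List.pairwise_of_forall_mem_list fun σ hσ τ hτ hlt => ?_
    exact h.commute_of_key_lt (by simp [hσ]) (by simp [hτ]) (Or.inl hσ) (Or.inl hσ) (Or.inl hτ) hlt
  · intro τ hτ hlt
    exact h.commute_of_key_lt (by simp) (by simp [hτ]) (Or.inr hτ) (Or.inr (Or.inl rfl))
      (Or.inr (Or.inr hτ)) hlt
  · refine List.pairwise_of_forall_mem_list fun σ hσ τ hτ hlt => ?_
    exact h.commute_of_key_lt (by simp [hσ]) (by simp [hτ]) (Or.inr hτ) (Or.inr (Or.inr hσ))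
      (Or.inr (Or.inr hτ)) hlt
  · intro σ hσ τ hτ hlt
    refine h.commute_of_key_lt (by simp [hσ]) (List.mem_append_right _ hτ) (Or.inl hσ) (Or.inl hσ)
      (Or.inr (List.mem_cons.1 hτ)) hlt

theorem filter_factorKey_left (h : Labelled l A B P w ρA ρB) (i : Fin (m + 2)) :
    ((A ++ P :: B).filter fun σ => factorKey l w ρB σ = i.val) =
      within (A ++ P :: B) (alpha l ρB i ++ [w i]) := by
  classical
  refine List.filter_congr fun σ hσ => ?_
  rw [decide_eq_decide]
  refine ⟨fun hk => ?_, fun hi => h.factorKey_left hσ hi⟩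
  by_cases h₁ : σ = P
  · rw [h₁, h.factorKey_P] at hk
    have := i.isLt
    omega
  · have h₂ : σ ∈ A ∨ σ ∈ B := by simpa [h₁] using hσ
    rcases h.classify h₂ with ⟨j, hj⟩ | ⟨j, hj⟩
    · rw [h.factorKey_left hσ hj] at hk
      rwa [← Fin.ext hk]
    · rw [h.factorKey_right hσ hj] at hk
      have := i.isLt
      omega

theorem filter_factorKey_right (h : Labelled l A B P w ρA ρB) (i : Fin (m + 2)) :
    ((A ++ P :: B).filter fun σ => factorKey l w ρB σ = m + 2 + (1 + i.val)) =
      within (A ++ P :: B) (w i :: beta l w ρB i) := by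
  classical
  refine List.filter_congr fun σ hσ => ?_
  rw [decide_eq_decide]
  refine ⟨fun hk => ?_, fun hi => h.factorKey_right hσ hi⟩
  by_cases h₁ : σ = P
  · rw [h₁, h.factorKey_P] at hk
    omega
  · have h₂ : σ ∈ A ∨ σ ∈ B := by simpa [h₁] using hσ
    rcases h.classify h₂ with ⟨j, hj⟩ | ⟨j, hj⟩
    · rw [h.factorKey_left hσ hj] at hk
      have := j.isLt
      omega
    · rw [h.factorKey_right hσ hj] at hk
      rwa [← Fin.ext (by omega : j.val = i.val)]

theorem filter_factorKey_P (h : Labelled l A B P w ρA ρB) :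
    ((A ++ P :: B).filter fun σ => factorKey l w ρB σ = m + 2) = [P] := by
  have key : ∀ σ, (σ ∈ A ∨ σ ∈ B) → factorKey l w ρB σ ≠ m + 2 := by
    intro σ hσ
    have hmem : σ ∈ A ++ P :: B := by rcases hσ with hσ | hσ <;> simp [hσ]
    rcases h.classify hσ with ⟨j, hj⟩ | ⟨j, hj⟩
    · rw [h.factorKey_left hmem hj]; exact j.isLt.ne
    · rw [h.factorKey_right hmem hj]; omega
  rw [List.filter_append, List.filter_cons_of_pos (by simp [h.factorKey_P]),
    List.filter_eq_nil_iff.2 fun σ hσ => by simpa using key σ (Or.inl hσ),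
    List.filter_eq_nil_iff.2 fun σ hσ => by simpa using key σ (Or.inr hσ), List.nil_append]

/-- Sorting by `factorKey` puts the left blocks first, then P, then the right blocks;
`pairwise_commute` says that only commuting factors are exchanged. -/
theorem equivalent (h : Labelled l A B P w ρA ρB) : Equivalent (A ++ P :: B)
    ((List.ofFn fun i => within (A ++ P :: B) (alpha l ρB i ++ [w i])).flatten ++
      P :: (List.ofFn fun i => within (A ++ P :: B) (w i :: beta l w ρB i)).flatten) := by
  have h₁ := Equivalent.sort_by_key (factorKey l w ρB) (m + 2 + (1 + (m + 2))) (A ++ P :: B) (by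
    intro σ hσ
    by_cases hP : σ = P
    · rw [hP, h.factorKey_P]; omega
    · have h₂ : σ ∈ A ∨ σ ∈ B := by simpa [hP] using hσ
      rcases h.classify h₂ with ⟨j, hj⟩ | ⟨j, hj⟩
      · rw [h.factorKey_left hσ hj]; have := j.isLt; omega
      · rw [h.factorKey_right hσ hj]; have := j.isLt; omega) h.pairwise_commute
  refine h₁.trans _ _ _ (Equivalent.of_eq ?_)
  rw [@List.range_add (m + 2) (1 + (m + 2)), @List.range_add 1 (m + 2), List.map_append, List.flatMap_append, List.flatMap_append,
    flatMap_range_eq_ofFn, List.flatMap_map, List.flatMap_map, List.flatMap_map,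
    flatMap_range_eq_ofFn _ (m + 2)]
  simp only [h.filter_factorKey_left, h.filter_factorKey_right, List.range_one, add_zero,
    List.flatMap_singleton, h.filter_factorKey_P, List.singleton_append]

theorem nodup_blocks (h : Labelled l A B P w ρA ρB) (i : Fin (m + 2)) :
    (alpha l ρB i ++ [w i]).Nodup ∧ (w i :: beta l w ρB i).Nodup := by
  obtain ⟨X₀, Y₀, hXY⟩ := exists_append_of_flatten_ofFn
    (fun i => alpha l ρB i ++ w i :: beta l w ρB i) i
  have hnd := h.fact.nodup
  rw [h.list_eq, hXY] at hnd
  have := hnd.sublist ((List.sublist_append_left _ _).trans (List.sublist_append_right _ _))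
  exact ⟨this.sublist (by simp), this.sublist (by simp)⟩

/-- `length_le_totalRank` bounds the rank of each piece from below. The sum of the bounds is all the
rank that P leaves over, so every bound is attained. -/
theorem totalRank_within (h : Labelled l A B P w ρA ρB) (i : Fin (m + 2)) :
    totalRank (within (A ++ P :: B) (alpha l ρB i ++ [w i])) = (alpha l ρB i).length ∧
    totalRank (within (A ++ P :: B) (w i :: beta l w ρB i)) = (beta l w ρB i).length := by
  have hle₁ : ∀ i, (alpha l ρB i).length ≤
      totalRank (within (A ++ P :: B) (alpha l ρB i ++ [w i])) := fun i => by
    simpa using length_le_totalRank (h.nodup_blocks i).1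
      (fun σ hσ => h.fact.isCycle σ (mem_within.1 hσ).1) (h.prod_within_left i)
  have hle₂ : ∀ i, (beta l w ρB i).length ≤
      totalRank (within (A ++ P :: B) (w i :: beta l w ρB i)) := fun i => by
    simpa using length_le_totalRank (h.nodup_blocks i).2
      (fun σ hσ => h.fact.isCycle σ (mem_within.1 hσ).1) (h.prod_within_right i)
  have hP : P.support.card = m + 2 := by
    have : P.support = Finset.univ.image w := by
      ext x; simp [h.support_iff]
    rw [this, Finset.card_image_of_injective _ h.inj, Finset.card_univ, Fintype.card_fin]
  have hrank := h.fact.rank_eq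
  rw [h.equivalent.totalRank_eq, totalRank_append, totalRank_cons, totalRank_flatten_ofFn,
    totalRank_flatten_ofFn, hP] at hrank
  have hlen := congrArg List.length h.list_eq
  simp only [List.length_flatten, List.map_ofFn, List.sum_ofFn, Function.comp_def,
    List.length_append, List.length_cons, Finset.sum_add_distrib, Finset.sum_const,
    Finset.card_univ, Fintype.card_fin, smul_eq_mul, mul_one] at hlen
  have hs₁ := Finset.sum_le_sum fun i (_ : i ∈ Finset.univ) => hle₁ i
  have hs₂ := Finset.sum_le_sum fun i (_ : i ∈ Finset.univ) => hle₂ i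
  have he₁ := (Finset.sum_eq_sum_iff_of_le fun i (_ : i ∈ Finset.univ) => hle₁ i).1 (by omega)
  have he₂ := (Finset.sum_eq_sum_iff_of_le fun i (_ : i ∈ Finset.univ) => hle₂ i).1 (by omega)
  exact ⟨(he₁ i (Finset.mem_univ i)).symm, (he₂ i (Finset.mem_univ i)).symm⟩

theorem decomp (h : Labelled l A B P w ρA ρB) (hw : (List.ofFn w).formPerm = P) :
    Decomp (alpha l ρB) (beta l w ρB) w
      (fun i => within (A ++ P :: B) (alpha l ρB i ++ [w i]))
      (fun i => within (A ++ P :: B) (w i :: beta l w ρB i)) l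
      ((List.ofFn fun i => within (A ++ P :: B) (alpha l ρB i ++ [w i])).flatten ++
        P :: (List.ofFn fun i => within (A ++ P :: B) (w i :: beta l w ρB i)).flatten) where
  nodup := h.fact.nodup
  list_eq := h.list_eq
  fact_eq := by rw [hw]
  left i :=
    { nodup := (h.nodup_blocks i).1
      isCycle := fun σ hσ => h.fact.isCycle σ (mem_within.1 hσ).1
      mem_of_mem_support := fun σ hσ => (mem_within.1 hσ).2
      prod_eq := h.prod_within_left i
      rank_eq := by rw [(h.totalRank_within i).1]; simp }
  right i :=
    { nodup := (h.nodup_blocks i).2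
      isCycle := fun σ hσ => h.fact.isCycle σ (mem_within.1 hσ).1
      mem_of_mem_support := fun σ hσ => (mem_within.1 hσ).2
      prod_eq := h.prod_within_right i
      rank_eq := by rw [(h.totalRank_within i).2]; simp }
  first := h.alpha_zero

end Labelled

/-- The points of a cycle, in the order in which the cycle visits them. -/
theorem exists_cycle_points {n : ℕ} {P : Perm (Fin n)} (hP : P.IsCycle) {a : Fin n}
    (ha : a ∈ P.support) : ∃ (m : ℕ) (w : Fin (m + 2) → Fin n), w 0 = a ∧
      Function.Injective w ∧ (∀ x, x ∈ P.support ↔ ∃ i, w i = x) ∧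
      (∀ i, ∃ j, P (w i) = w j ∧ (j = 0 ∨ j.val = i.val + 1)) ∧ (List.ofFn w).formPerm = P := by
  obtain ⟨m, hm⟩ := Nat.exists_eq_add_of_le' hP.two_le_card_support
  have hc : P.cycleOf a = P := hP.cycleOf_eq (Perm.mem_support.1 ha)
  have hlist : (List.ofFn fun i : Fin (m + 2) => (P ^ i.val) a) = P.toList a := by
    apply List.ext_getElem
    · simp [hc, hm]
    · intro i h₁ h₂
      rw [Perm.getElem_toList, List.getElem_ofFn]
  refine ⟨m, fun i => (P ^ i.val) a, by simp, ?_, ?_, ?_, ?_⟩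
  · rw [← List.nodup_ofFn, hlist]
    exact Perm.nodup_toList P a
  · intro x
    have : x ∈ P.toList a ↔ x ∈ P.support := by
      rw [Perm.mem_toList_iff]
      refine ⟨fun hx => ?_, fun hx => ⟨hP.sameCycle (Perm.mem_support.1 ha)
        (Perm.mem_support.1 hx), ha⟩⟩
      exact hx.1.mem_support_iff.1 ha
    rw [← this, ← hlist, List.mem_ofFn]
  · intro i
    by_cases hi : i.val + 1 < m + 2
    · exact ⟨⟨i.val + 1, hi⟩, by simp [pow_succ'], Or.inr rfl⟩
    · refine ⟨0, ?_, Or.inl rfl⟩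
      have : i.val + 1 = orderOf P := by rw [hP.orderOf, hm]; omega
      rw [← Perm.mul_apply, ← pow_succ', this, pow_orderOf_eq_one]
      simp
  · rw [hlist, Perm.formPerm_toList, hc]

theorem exists_append_cons_of_first {V : Type*} {p : V → Prop} {L : List V}
    (h : ∃ x ∈ L, p x) : ∃ A x B, L = A ++ x :: B ∧ p x ∧ ∀ y ∈ A, ¬ p y := by
  induction L with
  | nil => simp at h
  | cons y L ih =>
    by_cases hy : p y
    · exact ⟨[], y, L, rfl, hy, by simp⟩
    · obtain ⟨A, x, B, rfl, hx, hA⟩ := ih (by simpa [hy] using h)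
      exact ⟨y :: A, x, B, rfl, hx, by simpa [hy] using hA⟩

/-- Every nonempty minimal factorization is equivalent to one that decomposes. -/
theorem MinFact.exists_decomp {n : ℕ} {l : List (Fin n)} {L : List (Perm (Fin n))}
    (h : MinFact l L) (hL : L ≠ []) :
    ∃ (m : ℕ) (α β : Fin (m + 2) → List (Fin n)) (w : Fin (m + 2) → Fin n)
      (A B : Fin (m + 2) → List (Perm (Fin n))) (L' : List (Perm (Fin n))),
      Equivalent L L' ∧ Decomp α β w A B l L' := by
  obtain ⟨a, l', rfl⟩ := List.exists_cons_of_ne_nil h.ne_nil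
  -- P is the leftmost factor moving the first point, so the product of `A` fixes that point. This
  -- excludes a wrap-around of P and makes the zeroth left block trivial.
  obtain ⟨A, P, B, rfl, haP, hA⟩ := exists_append_cons_of_first
    (h.exists_mem_support hL (x := a) List.mem_cons_self)
  obtain ⟨m, w, rfl, h₁, h₂, h₃, h₄⟩ := exists_cycle_points (h.isCycle P (by simp)) haP
  obtain ⟨ρA, ρB, k₁, k₂, k₃, k₄, k₅⟩ := exists_labels h h₁ h₂
  have hlab : Labelled (w 0 :: l') A B P w ρA ρB :=
    { fact := h
      inj := h₁
      support_iff := h₂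
      next := h₃
      head := ⟨l', rfl⟩
      fix := list_prod_apply_of_fixed fun σ hσ => Perm.notMem_support.1 (hA σ hσ)
      eq_off := k₁
      left_w := k₂
      right_w := k₃
      left := k₄
      right := k₅ }
  exact ⟨m, _, _, w, _, _, _, hlab.equivalent, hlab.decomp h₄⟩

/-! ### Properties of decompositions -/

/-! ### The product of the block cycles -/

section FormPermProducts

variable {V : Type*} [DecidableEq V]

theorem formPerm_concat_apply_last (α : List V) (w : V) (γ : List V) :
    ∃ γ', α ++ w :: γ = (α ++ [w]).formPerm w :: γ' := by
  cases α with
  | nil => exact ⟨γ, by simp⟩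
  | cons x α => exact ⟨α ++ w :: γ, by
      rw [List.cons_append, List.cons_append, List.formPerm_cons_concat_apply_last]⟩

/-- Peel off the first block α w β. The product A' of the other left cycles fixes w and sends w₁ to
the first entry of the remaining list l', so moving the transposition (w w₁) across A' turns it into
(w A'w₁). Multiplied by the cycle through l', this is the cycle through w :: l', into which α and β
are then inserted. -/
theorem prod_formPerm_blocks : ∀ D : List (List V × V × List V), D ≠ [] →
    (D.flatMap fun d => d.1 ++ d.2.1 :: d.2.2).Nodup →
    (D.map fun d => (d.1 ++ [d.2.1]).formPerm).prod * (D.map fun d => d.2.1).formPerm *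
      (D.map fun d => (d.2.1 :: d.2.2).formPerm).prod =
      (D.flatMap fun d => d.1 ++ d.2.1 :: d.2.2).formPerm
  | [], h, _ => (h rfl).elim
  | [d], _, _ => by simp [← formPerm_append_cons]
  | d :: d₁ :: D, _, hnd => by
    rw [List.flatMap_cons] at hnd
    have hdis := List.disjoint_of_nodup_append hnd
    have ih := prod_formPerm_blocks (d₁ :: D) (by simp)
      (hnd.sublist (List.sublist_append_right _ _))
    obtain ⟨α, w, β⟩ := d
    obtain ⟨α₁, w₁, β₁⟩ := d₁
    set l' := ((α₁, w₁, β₁) :: D).flatMap fun d : List V × V × List V => d.1 ++ d.2.1 :: d.2.2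
      with hl'
    set A' := (((α₁, w₁, β₁) :: D).map fun d : List V × V × List V =>
      (d.1 ++ [d.2.1]).formPerm).prod with hA'
    set B' := (((α₁, w₁, β₁) :: D).map fun d : List V × V × List V =>
      (d.2.1 :: d.2.2).formPerm).prod with hB'
    have hA'fix : ∀ x, x ∉ l' → A' x = x := by
      intro x hx
      refine list_prod_apply_of_fixed fun σ hσ => ?_
      obtain ⟨d, hd, rfl⟩ := List.mem_map.1 hσ
      refine List.formPerm_apply_of_notMem fun hxd => hx (List.mem_flatMap.2 ⟨d, hd, ?_⟩)
      simp only [List.mem_append, List.mem_cons] at hxd ⊢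
      tauto
    have hB'fix : ∀ x, x ∉ l' → B' x = x := by
      intro x hx
      refine list_prod_apply_of_fixed fun σ hσ => ?_
      obtain ⟨d, hd, rfl⟩ := List.mem_map.1 hσ
      refine List.formPerm_apply_of_notMem fun hxd => hx (List.mem_flatMap.2 ⟨d, hd, ?_⟩)
      simp only [List.mem_append, List.mem_cons] at hxd ⊢
      tauto
    have hw : A' w = w := hA'fix w fun hw => hdis (by simp) hw
    have hcomm : (w :: β).formPerm * B' = B' * (w :: β).formPerm := by
      refine (Perm.Disjoint.commute fun x => ?_).eq
      by_cases hx : x ∈ l'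
      · refine Or.inl (List.formPerm_apply_of_notMem fun hxd => hdis ?_ hx)
        simp only [List.mem_append]
        exact Or.inr hxd
      · exact Or.inr (hB'fix x hx)
    -- The cycle through `α₁ ++ [w₁]` sends its last entry to its first, and the cycles of the later
    -- blocks fix `w₁`.
    obtain ⟨γ, hγ⟩ : ∃ γ, l' = A' w₁ :: γ := by
      obtain ⟨γ, hγ⟩ := formPerm_concat_apply_last α₁ w₁
        (β₁ ++ D.flatMap fun d : List V × V × List V => d.1 ++ d.2.1 :: d.2.2)
      refine ⟨γ, ?_⟩
      have h₁ : A' w₁ = (α₁ ++ [w₁]).formPerm w₁ := by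
        rw [hA', List.map_cons, List.prod_cons, Perm.mul_apply]
        congr 1
        refine list_prod_apply_of_fixed fun σ hσ => ?_
        obtain ⟨d, hd, rfl⟩ := List.mem_map.1 hσ
        refine List.formPerm_apply_of_notMem fun hxd => ?_
        have hnd' := hnd.sublist (List.sublist_append_right _ _)
        rw [hl', List.flatMap_cons] at hnd'
        refine List.disjoint_of_nodup_append hnd' (by simp : w₁ ∈ _)
          (List.mem_flatMap.2 ⟨d, hd, ?_⟩)
        simp only [List.mem_append, List.mem_cons] at hxd ⊢
        tauto
      rw [h₁, ← hγ, hl', List.flatMap_cons]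
      simp
    have hmap : ((α, w, β) :: (α₁, w₁, β₁) :: D).map (fun d => d.2.1) =
        w :: w₁ :: D.map fun d => d.2.1 := rfl
    rw [List.map_cons, List.prod_cons, ← hA', hmap, List.formPerm_cons_cons, List.map_cons,
      List.prod_cons, ← hB', List.flatMap_cons, ← hl', hcomm]
    have ih' : A' * (w₁ :: D.map fun d => d.2.1).formPerm * B' = l'.formPerm := ih
    have hswap : A' * swap w w₁ = swap w (A' w₁) * A' := by
      rw [mul_swap_eq_swap_mul, hw]
    have h₂ : swap w (A' w₁) * l'.formPerm = (w :: l').formPerm := by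
      rw [hγ, List.formPerm_cons_cons]
    have h₃ : (w :: l').formPerm * (w :: β).formPerm = (w :: (β ++ l')).formPerm := by
      refine (formPerm_cons_append ?_).symm
      have hnd' : (α ++ (w :: (β ++ l'))).Nodup := by simpa using hnd
      exact hnd'.sublist (List.sublist_append_right _ _)
    calc (α ++ [w]).formPerm * A' * (swap w w₁ * (w₁ :: D.map fun d => d.2.1).formPerm) *
          (B' * (w :: β).formPerm)
        = (α ++ [w]).formPerm * (A' * swap w w₁) * (w₁ :: D.map fun d => d.2.1).formPerm *
          B' * (w :: β).formPerm := by simp only [mul_assoc]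
      _ = (α ++ [w]).formPerm * (swap w (A' w₁) *
          (A' * (w₁ :: D.map fun d => d.2.1).formPerm * B')) * (w :: β).formPerm := by
          rw [hswap]; simp only [mul_assoc]
      _ = (α ++ [w]).formPerm * ((w :: l').formPerm * (w :: β).formPerm) := by
          rw [ih', h₂, mul_assoc]
      _ = (α ++ w :: β ++ l').formPerm := by
          rw [h₃, ← formPerm_append_cons, List.append_assoc, List.cons_append]

end FormPermProducts

section ListLemmas

variable {V : Type*}

theorem nodup_of_nodup_flatten_ofFn {k : ℕ} {f : Fin k → List V}
    (h : (List.ofFn f).flatten.Nodup) (i : Fin k) : (f i).Nodup :=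
  (List.nodup_flatten.1 h).1 _ (List.mem_ofFn.2 ⟨i, rfl⟩)

theorem eq_of_mem_of_nodup_flatten_ofFn {k : ℕ} {f : Fin k → List V}
    (h : (List.ofFn f).flatten.Nodup) {i j : Fin k} {x : V} (hi : x ∈ f i) (hj : x ∈ f j) :
    i = j := by
  have hp := (List.nodup_flatten.1 h).2
  rw [List.pairwise_ofFn] at hp
  rcases lt_trichotomy i j with hij | hij | hij
  · exact (hp hij hi hj).elim
  · exact hij
  · exact (hp hij hj hi).elim

theorem flatten_ofFn_single {k : ℕ} {f : Fin k → List V} (i : Fin k)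
    (h : ∀ j, j ≠ i → f j = []) : (List.ofFn f).flatten = f i := by
  induction k with
  | zero => exact i.elim0
  | succ k ih =>
    rw [List.ofFn_succ, List.flatten_cons]
    rcases Fin.eq_zero_or_eq_succ i with rfl | ⟨i, rfl⟩
    · have : (List.ofFn fun j : Fin k => f j.succ).flatten = [] := by
        rw [List.flatten_eq_nil_iff]
        intro s hs
        obtain ⟨j, rfl⟩ := List.mem_ofFn.1 hs
        exact h _ (Fin.succ_ne_zero j)
      rw [this, List.append_nil]
    · rw [h 0 (Fin.succ_ne_zero i).symm, List.nil_append]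
      exact ih i fun j hj => h _ fun e => hj (Fin.succ_injective _ e)

theorem mem_flatten_ofFn {k : ℕ} {f : Fin k → List V} {x : V} :
    x ∈ (List.ofFn f).flatten ↔ ∃ i, x ∈ f i := by
  simp only [List.mem_flatten, List.mem_ofFn]
  exact ⟨by rintro ⟨_, ⟨i, rfl⟩, h⟩; exact ⟨i, h⟩, fun ⟨i, h⟩ => ⟨_, ⟨i, rfl⟩, h⟩⟩

theorem filter_flatten_ofFn {k : ℕ} (p : V → Bool) (f : Fin k → List V) :
    (List.ofFn f).flatten.filter p = (List.ofFn fun i => (f i).filter p).flatten := by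
  rw [List.filter_flatten, List.map_ofFn]; rfl

end ListLemmas

/-! ### Assembled factorizations: product, commutation, heads and tails -/

namespace Decomp

variable {n m : ℕ} {α β : Fin (m + 2) → List (Fin n)} {w : Fin (m + 2) → Fin n}
  {A B : Fin (m + 2) → List (Perm (Fin n))} {l : List (Fin n)} {L : List (Perm (Fin n))}
  {i j : Fin (m + 2)} {x : Fin n} {σ τ : Perm (Fin n)}

theorem nodup_flatten (h : Decomp α β w A B l L)
    : (List.ofFn fun i => α i ++ w i :: β i).flatten.Nodup :=
  h.list_eq ▸ h.nodup

theorem block_unique (h : Decomp α β w A B l L)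
    (hi : x ∈ α i ++ w i :: β i) (hj : x ∈ α j ++ w j :: β j) : i = j :=
  eq_of_mem_of_nodup_flatten_ofFn h.nodup_flatten hi hj

theorem block_nodup (h : Decomp α β w A B l L) (i : Fin (m + 2)) : (α i ++ w i :: β i).Nodup :=
  nodup_of_nodup_flatten_ofFn h.nodup_flatten i

theorem injective (h : Decomp α β w A B l L) : Function.Injective w := fun i j hij =>
  h.block_unique (x := w i) (i := i) (j := j) (by simp) (by simp [hij])

theorem mem_block_of_left (h : Decomp α β w A B l L)
    (hσ : σ ∈ A i) (hx : x ∈ σ.support) : x ∈ α i ++ w i :: β i := by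
  have := (h.left i).mem_of_mem_support σ hσ x hx
  simp only [List.mem_append, List.mem_cons] at this ⊢
  tauto

theorem mem_block_of_right (h : Decomp α β w A B l L)
    (hσ : σ ∈ B i) (hx : x ∈ σ.support) : x ∈ α i ++ w i :: β i := by
  have := (h.right i).mem_of_mem_support σ hσ x hx
  simp only [List.mem_append, List.mem_cons] at this ⊢
  tauto

theorem mem_list_of_block (h : Decomp α β w A B l L) (hx : x ∈ α i ++ w i :: β i) : x ∈ l := by
  rw [h.list_eq]
  exact mem_flatten_ofFn.2 ⟨i, hx⟩

theorem eq_w_of_mem (h : Decomp α β w A B l L)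
    (hi : x ∈ α i ++ [w i]) (hj : x ∈ w j :: β j) : i = j ∧ x = w i := by
  have hij : i = j := by
    refine h.block_unique (x := x) ?_ ?_
    · simp only [List.mem_append, List.mem_cons] at hi ⊢
      tauto
    · simp only [List.mem_append, List.mem_cons] at hj ⊢
      tauto
  subst hij
  refine ⟨rfl, ?_⟩
  have hd := List.disjoint_of_nodup_append (h.block_nodup i)
  rw [List.mem_append, List.mem_singleton] at hi
  exact hi.resolve_left fun hx => hd hx hj

theorem nodup_ofFn (h : Decomp α β w A B l L) : (List.ofFn w).Nodup := List.nodup_ofFn.2 h.injective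

theorem isCycle (h : Decomp α β w A B l L) : (List.ofFn w).formPerm.IsCycle :=
  List.isCycle_formPerm h.nodup_ofFn (by simp)

theorem mem_support (h : Decomp α β w A B l L)
    : x ∈ (List.ofFn w).formPerm.support ↔ ∃ i, w i = x := by
  rw [List.support_formPerm_of_nodup _ h.nodup_ofFn, List.mem_toFinset, List.mem_ofFn]
  intro y hy
  simpa using congrArg List.length hy

theorem card_support (h : Decomp α β w A B l L) : (List.ofFn w).formPerm.support.card = m + 2 := by
  rw [List.support_formPerm_of_nodup _ h.nodup_ofFn, List.toFinset_card_of_nodup h.nodup_ofFn,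
    List.length_ofFn]
  intro y hy
  simpa using congrArg List.length hy

theorem mem_fact (h : Decomp α β w A B l L)
    : σ ∈ L ↔ (∃ i, σ ∈ A i) ∨ σ = (List.ofFn w).formPerm ∨ ∃ i, σ ∈ B i := by
  rw [h.fact_eq, List.mem_append, List.mem_cons, mem_flatten_ofFn, mem_flatten_ofFn]

theorem two_le_left (h : Decomp α β w A B l L) (hσ : σ ∈ A i) : 2 ≤ σ.support.card :=
  ((h.left i).isCycle σ hσ).two_le_card_support

theorem two_le_right (h : Decomp α β w A B l L) (hσ : σ ∈ B i) : 2 ≤ σ.support.card :=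
  ((h.right i).isCycle σ hσ).two_le_card_support

theorem left_unique (h : Decomp α β w A B l L) (hi : σ ∈ A i) (hj : σ ∈ A j) : i = j := by
  obtain ⟨x, hx⟩ := Finset.card_pos.1 (by have := h.two_le_left hi; omega : 0 < σ.support.card)
  exact h.block_unique (h.mem_block_of_left hi hx) (h.mem_block_of_left hj hx)

theorem right_unique (h : Decomp α β w A B l L) (hi : σ ∈ B i) (hj : σ ∈ B j) : i = j := by
  obtain ⟨x, hx⟩ := Finset.card_pos.1 (by have := h.two_le_right hi; omega : 0 < σ.support.card)
  exact h.block_unique (h.mem_block_of_right hi hx) (h.mem_block_of_right hj hx)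

theorem not_left_and_right (h : Decomp α β w A B l L) (hi : σ ∈ A i) (hj : σ ∈ B j) : False := by
  obtain ⟨x, hx, hne⟩ := Finset.exists_mem_ne (h.two_le_left hi) (w i)
  exact hne (h.eq_w_of_mem ((h.left i).mem_of_mem_support σ hi x hx)
    ((h.right j).mem_of_mem_support σ hj x hx)).2

theorem not_subset_block (h : Decomp α β w A B l L) (i : Fin (m + 2)) :
    ¬ ∀ x ∈ (List.ofFn w).formPerm.support, x ∈ α i ++ w i :: β i := by
  intro hsub
  have h₁ := fun j => h.block_unique (hsub (w j) (h.mem_support.2 ⟨j, rfl⟩))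
    (by simp : w j ∈ α j ++ w j :: β j)
  exact absurd ((h₁ 0).symm.trans (h₁ 1)) (by simp)

theorem ne_of_left (h : Decomp α β w A B l L) (hσ : σ ∈ A i) : σ ≠ (List.ofFn w).formPerm := by
  rintro rfl
  exact h.not_subset_block i fun x hx => h.mem_block_of_left hσ hx

theorem ne_of_right (h : Decomp α β w A B l L) (hσ : σ ∈ B i) : σ ≠ (List.ofFn w).formPerm := by
  rintro rfl
  exact h.not_subset_block i fun x hx => h.mem_block_of_right hσ hx

theorem prod_eq (h : Decomp α β w A B l L) : L.prod = l.formPerm := by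
  have h₁ := prod_formPerm_blocks (List.ofFn fun i => (α i, w i, β i)) (by simp) (by
    rw [List.flatMap_def, List.map_ofFn]; exact h.nodup_flatten)
  rw [List.flatMap_def, List.map_ofFn, List.map_ofFn, List.map_ofFn, List.map_ofFn] at h₁
  have h₂ : ((fun d : List (Fin n) × Fin n × List (Fin n) => d.1 ++ d.2.1 :: d.2.2) ∘
      fun i => (α i, w i, β i)) = fun i => α i ++ w i :: β i := rfl
  rw [h₂, ← h.list_eq] at h₁
  rw [← h₁, h.fact_eq, List.prod_append, List.prod_cons, List.prod_flatten, List.prod_flatten,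
    List.map_ofFn, List.map_ofFn, ← mul_assoc]
  have h₃ : List.prod ∘ A = (fun d : List (Fin n) × Fin n × List (Fin n) =>
      (d.1 ++ [d.2.1]).formPerm) ∘ fun i => (α i, w i, β i) :=
    funext fun i => (h.left i).prod_eq
  have h₄ : List.prod ∘ B = (fun d : List (Fin n) × Fin n × List (Fin n) =>
      (d.2.1 :: d.2.2).formPerm) ∘ fun i => (α i, w i, β i) :=
    funext fun i => (h.right i).prod_eq
  rw [h₃, h₄]
  rfl

theorem minFact (h : Decomp α β w A B l L) : MinFact l L where
  nodup := h.nodup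
  isCycle σ hσ := by
    rcases h.mem_fact.1 hσ with ⟨i, hi⟩ | rfl | ⟨i, hi⟩
    · exact (h.left i).isCycle σ hi
    · exact h.isCycle
    · exact (h.right i).isCycle σ hi
  mem_of_mem_support σ hσ x hx := by
    rcases h.mem_fact.1 hσ with ⟨i, hi⟩ | rfl | ⟨i, hi⟩
    · exact h.mem_list_of_block (h.mem_block_of_left hi hx)
    · obtain ⟨i, rfl⟩ := h.mem_support.1 hx
      exact h.mem_list_of_block (i := i) (by simp)
    · exact h.mem_list_of_block (h.mem_block_of_right hi hx)
  prod_eq := h.prod_eq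
  rank_eq := by
    have h₁ : ∀ i, totalRank (A i) = (α i).length := fun i => by
      simpa using (h.left i).rank_eq
    have h₂ : ∀ i, totalRank (B i) = (β i).length := fun i => by
      simpa using (h.right i).rank_eq
    have hlen := congrArg List.length h.list_eq
    simp only [List.length_flatten, List.map_ofFn, List.sum_ofFn, Function.comp_def,
      List.length_append, List.length_cons, Finset.sum_add_distrib, Finset.sum_const,
      Finset.card_univ, Fintype.card_fin, smul_eq_mul, mul_one] at hlen
    rw [h.fact_eq, totalRank_append, totalRank_cons, totalRank_flatten_ofFn,
      totalRank_flatten_ofFn, h.card_support]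
    simp only [h₁, h₂]
    omega

theorem commute_of_block_ne (h : Decomp α β w A B l L)
    (hij : i ≠ j) (hσ : ∀ x ∈ σ.support, x ∈ α i ++ w i :: β i)
    (hτ : ∀ x ∈ τ.support, x ∈ α j ++ w j :: β j) : Commute σ τ :=
  commute_of_support_disjoint fun x hx hx' => hij (h.block_unique (hσ x hx) (hτ x hx'))

theorem commute_left (h : Decomp α β w A B l L)
    (hij : i ≠ j) (hσ : σ ∈ A i) (hτ : τ ∈ A j) : Commute σ τ :=
  h.commute_of_block_ne hij (fun _ => h.mem_block_of_left hσ) fun _ => h.mem_block_of_left hτ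

theorem commute_right (h : Decomp α β w A B l L)
    (hij : i ≠ j) (hσ : σ ∈ B i) (hτ : τ ∈ B j) : Commute σ τ :=
  h.commute_of_block_ne hij (fun _ => h.mem_block_of_right hσ) fun _ => h.mem_block_of_right hτ

/-- P meets a block only in `w i`, and cycles with exactly one common point do not commute. -/
theorem commute_iff (h : Decomp α β w A B l L) (hσ : ∀ x ∈ σ.support, x ∈ α i ++ w i :: β i) :
    Commute (List.ofFn w).formPerm σ ↔ w i ∉ σ.support := by
  have key : ∀ x ∈ (List.ofFn w).formPerm.support, x ∈ σ.support → x = w i := by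
    intro x hx hxσ
    obtain ⟨j, rfl⟩ := h.mem_support.1 hx
    rw [h.block_unique (hσ _ hxσ) (by simp : w j ∈ α j ++ w j :: β j)]
  refine ⟨fun hc hw => ?_, fun hw => ?_⟩
  · exact not_commute_of_unique_common (h.mem_support.2 ⟨i, rfl⟩) hw key hc
  · refine commute_of_support_disjoint fun x hx hxσ => hw ?_
    rwa [← key x hx hxσ]

theorem commute_left_right (h : Decomp α β w A B l L) (hσ : σ ∈ A i) (hτ : τ ∈ B j)
    (hw : w i ∉ σ.support ∨ w j ∉ τ.support) : Commute σ τ := by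
  refine commute_of_support_disjoint fun x hx hx' => ?_
  obtain ⟨rfl, rfl⟩ := h.eq_w_of_mem ((h.left i).mem_of_mem_support σ hσ x hx)
    ((h.right j).mem_of_mem_support τ hτ x hx')
  tauto

theorem canHead_iff (h : Decomp α β w A B l L) : CanHead L σ ↔ CanHead (List.ofFn A).flatten σ ∨
    ((∀ τ ∈ (List.ofFn A).flatten, Commute τ σ) ∧ ((List.ofFn w).formPerm = σ ∨
      (Commute (List.ofFn w).formPerm σ ∧ CanHead (List.ofFn B).flatten σ))) := by
  rw [h.fact_eq, canHead_append]; rfl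

theorem canTail_iff (h : Decomp α β w A B l L) : CanTail L σ ↔ (CanTail (List.ofFn B).flatten σ ∨
    ((∀ τ ∈ (List.ofFn B).flatten, Commute τ σ) ∧ (List.ofFn w).formPerm = σ)) ∨
    (((∀ τ ∈ (List.ofFn B).flatten, Commute τ σ) ∧ Commute (List.ofFn w).formPerm σ) ∧
      CanTail (List.ofFn A).flatten σ) := by
  rw [h.fact_eq, canTail_append, canTail_cons, List.forall_mem_cons]
  tauto

theorem canHead_left_iff (h : Decomp α β w A B l L)
    : CanHead (List.ofFn A).flatten σ ↔ ∃ i, CanHead (A i) σ :=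
  canHead_flatten_ofFn fun _ _ hij _ hσ _ hτ => h.commute_left hij hσ hτ

theorem canHead_right_iff (h : Decomp α β w A B l L)
    : CanHead (List.ofFn B).flatten σ ↔ ∃ i, CanHead (B i) σ :=
  canHead_flatten_ofFn fun _ _ hij _ hσ _ hτ => h.commute_right hij hσ hτ

theorem canTail_left_iff (h : Decomp α β w A B l L)
    : CanTail (List.ofFn A).flatten σ ↔ ∃ i, CanTail (A i) σ :=
  canTail_flatten_ofFn fun _ _ hij _ hσ _ hτ => h.commute_left hij hσ hτ

theorem canTail_right_iff (h : Decomp α β w A B l L)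
    : CanTail (List.ofFn B).flatten σ ↔ ∃ i, CanTail (B i) σ :=
  canTail_flatten_ofFn fun _ _ hij _ hσ _ hτ => h.commute_right hij hσ hτ

theorem canHead_of_mem_left (h : Decomp α β w A B l L)
    (hσ : σ ∈ A i) : CanHead L σ ↔ CanHead (A i) σ := by
  rw [h.canHead_iff, h.canHead_left_iff, h.canHead_right_iff]
  constructor
  · rintro (⟨j, hj⟩ | ⟨_, rfl | ⟨_, j, hj⟩⟩)
    · rwa [h.left_unique hσ hj.mem]
    · exact (h.ne_of_left hσ rfl).elim
    · exact (h.not_left_and_right hσ hj.mem).elim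
  · exact fun hc => Or.inl ⟨i, hc⟩

theorem canTail_of_mem_right (h : Decomp α β w A B l L)
    (hσ : σ ∈ B i) : CanTail L σ ↔ CanTail (B i) σ := by
  rw [h.canTail_iff, h.canTail_left_iff, h.canTail_right_iff]
  constructor
  · rintro ((⟨j, hj⟩ | ⟨_, rfl⟩) | ⟨_, j, hj⟩)
    · rwa [h.right_unique hσ hj.mem]
    · exact (h.ne_of_right hσ rfl).elim
    · exact (h.not_left_and_right hj.mem hσ).elim
  · exact fun hc => Or.inl (Or.inl ⟨i, hc⟩)

/-- A left factor must pass P to become a tail, so it has to fix `w i`; it is then disjoint from all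
right factors as well. -/
theorem canTail_of_mem_left (h : Decomp α β w A B l L) (hσ : σ ∈ A i) :
    CanTail L σ ↔ CanTail (A i) σ ∧ w i ∉ σ.support := by
  rw [h.canTail_iff, h.canTail_left_iff, h.canTail_right_iff,
    h.commute_iff fun x => h.mem_block_of_left hσ]
  constructor
  · rintro ((⟨j, hj⟩ | ⟨_, rfl⟩) | ⟨⟨_, hc⟩, j, hj⟩)
    · exact (h.not_left_and_right hσ hj.mem).elim
    · exact (h.ne_of_left hσ rfl).elim
    · rw [h.left_unique hσ hj.mem] at *
      exact ⟨hj, hc⟩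
  · rintro ⟨hc, hw⟩
    refine Or.inr ⟨⟨fun τ hτ => ?_, hw⟩, i, hc⟩
    obtain ⟨j, hj⟩ := mem_flatten_ofFn.1 hτ
    exact (h.commute_left_right hσ hj (Or.inl hw)).symm

theorem canHead_of_mem_right (h : Decomp α β w A B l L) (hσ : σ ∈ B i) :
    CanHead L σ ↔ CanHead (B i) σ ∧ w i ∉ σ.support := by
  rw [h.canHead_iff, h.canHead_left_iff, h.canHead_right_iff,
    h.commute_iff fun x => h.mem_block_of_right hσ]
  constructor
  · rintro (⟨j, hj⟩ | ⟨_, rfl | ⟨hc, j, hj⟩⟩)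
    · exact (h.not_left_and_right hj.mem hσ).elim
    · exact (h.ne_of_right hσ rfl).elim
    · rw [h.right_unique hσ hj.mem] at *
      exact ⟨hj, hc⟩
  · rintro ⟨hc, hw⟩
    refine Or.inr ⟨fun τ hτ => ?_, Or.inr ⟨hw, i, hc⟩⟩
    obtain ⟨j, hj⟩ := mem_flatten_ofFn.1 hτ
    exact h.commute_left_right hj hσ (Or.inr hw)

/-- A nonempty left piece moves every point of its block, hence also `w i`, and a factor moving `w
i` blocks P. -/
theorem canHead_formPerm (h : Decomp α β w A B l L)
    : CanHead L (List.ofFn w).formPerm ↔ ∀ i, A i = [] := by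
  rw [h.canHead_iff, h.canHead_left_iff, h.canHead_right_iff]
  constructor
  · rintro (⟨j, hj⟩ | ⟨hc, -⟩)
    · exact (h.ne_of_left hj.mem rfl).elim
    · intro i
      by_contra hne
      obtain ⟨σ, hσ, hw⟩ := (h.left i).exists_mem_support hne (x := w i) (by simp)
      exact (h.commute_iff fun x => h.mem_block_of_left hσ).1
        (hc σ (mem_flatten_ofFn.2 ⟨i, hσ⟩)).symm hw
  · intro hA
    refine Or.inr ⟨fun τ hτ => ?_, Or.inl rfl⟩
    obtain ⟨j, hj⟩ := mem_flatten_ofFn.1 hτ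
    simp [hA] at hj

theorem canTail_formPerm (h : Decomp α β w A B l L)
    : CanTail L (List.ofFn w).formPerm ↔ ∀ i, B i = [] := by
  rw [h.canTail_iff, h.canTail_left_iff, h.canTail_right_iff]
  constructor
  · have key : (∀ τ ∈ (List.ofFn B).flatten, Commute τ (List.ofFn w).formPerm) →
        ∀ i, B i = [] := by
      intro hc i
      by_contra hne
      obtain ⟨σ, hσ, hw⟩ := (h.right i).exists_mem_support hne (x := w i) (by simp)
      exact (h.commute_iff fun x => h.mem_block_of_right hσ).1
        (hc σ (mem_flatten_ofFn.2 ⟨i, hσ⟩)).symm hw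
    rintro ((⟨j, hj⟩ | ⟨hc, -⟩) | ⟨⟨hc, -⟩, -⟩)
    · exact (h.ne_of_right hj.mem rfl).elim
    · exact key hc
    · exact key hc
  · intro hB
    refine Or.inl (Or.inr ⟨fun τ hτ => ?_, rfl⟩)
    obtain ⟨j, hj⟩ := mem_flatten_ofFn.1 hτ
    simp [hB] at hj

end Decomp

/-! ### Weights of factorizations -/

section Weights

variable {n : ℕ} {L L' : List (Perm (Fin n))}

/-- The length of a cycle. -/
def lenOf (σ : Perm (Fin n)) : Len := ⟨max 2 σ.support.card, le_max_left _ _⟩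

theorem lenOf_eq {σ : Perm (Fin n)} {j : Len} (h : σ.support.card = j.1) : lenOf σ = j :=
  Subtype.ext (by simp only [lenOf, h]; exact max_eq_right j.2)

theorem lenOf_inv (σ : Perm (Fin n)) : lenOf σ⁻¹ = lenOf σ := by
  simp [lenOf]

open Classical in
/-- The monomial that records the lengths of the factors with the property `p`. -/
def selWeight (c : Len → Var) (p : Perm (Fin n) → Prop) (L : List (Perm (Fin n))) : Var →₀ ℕ :=
  ((L.filter fun σ => p σ).map fun σ => Finsupp.single (c (lenOf σ)) 1).sum

theorem selWeight_nil (c : Len → Var) (p : Perm (Fin n) → Prop) : selWeight c p [] = 0 := by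
  simp [selWeight]

theorem selWeight_append (c : Len → Var) (p : Perm (Fin n) → Prop) :
    selWeight c p (L ++ L') = selWeight c p L + selWeight c p L' := by
  simp [selWeight]

open Classical in
theorem selWeight_cons (c : Len → Var) (p : Perm (Fin n) → Prop) (σ : Perm (Fin n)) :
    selWeight c p (σ :: L) =
      (if p σ then Finsupp.single (c (lenOf σ)) 1 else 0) + selWeight c p L := by
  simp only [selWeight, List.filter_cons, decide_eq_true_eq]
  split_ifs <;> simp

theorem selWeight_congr (c : Len → Var) {p q : Perm (Fin n) → Prop}
    (h : ∀ σ ∈ L, (p σ ↔ q σ)) : selWeight c p L = selWeight c q L := by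
  classical
  rw [selWeight, selWeight, List.filter_congr fun σ hσ => decide_eq_decide.2 (h σ hσ)]

theorem selWeight_perm (c : Len → Var) (p : Perm (Fin n) → Prop) (h : L.Perm L') :
    selWeight c p L = selWeight c p L' := by
  classical
  exact ((h.filter _).map _).sum_eq

theorem selWeight_flatten_ofFn (c : Len → Var) (p : Perm (Fin n) → Prop) {k : ℕ}
    (A : Fin k → List (Perm (Fin n))) :
    selWeight c p (List.ofFn A).flatten = ∑ i, selWeight c p (A i) := by
  induction k with
  | zero => simp [selWeight]
  | succ k ih =>
    rw [List.ofFn_succ, List.flatten_cons, selWeight_append, ih, Fin.sum_univ_succ]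

theorem selWeight_revInv (c : Len → Var) (p : Perm (Fin n) → Prop) :
    selWeight c p (revInv L) = selWeight c (fun σ => p σ⁻¹) L := by
  classical
  rw [revInv, selWeight_perm c p (List.reverse_perm _)]
  induction L with
  | nil => simp [selWeight]
  | cons σ L ih => rw [List.map_cons, selWeight_cons, selWeight_cons, ih, lenOf_inv]

theorem mapDomain_selWeight (φ : Var → Var) (c : Len → Var) (p : Perm (Fin n) → Prop) :
    (selWeight c p L).mapDomain φ = selWeight (φ ∘ c) p L := by
  classical
  induction L with
  | nil => simp [selWeight]
  | cons σ L ih =>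
    rw [selWeight_cons, selWeight_cons, Finsupp.mapDomain_add, ih]
    split_ifs <;> simp [Finsupp.mapDomain_single]

/-- The weight that records all the factors, the tails, and the heads that fix the point `r`. -/
def rootWeight (r : Fin n) (L : List (Perm (Fin n))) : Var →₀ ℕ :=
  selWeight Var.x (fun _ => True) L + selWeight Var.v (CanTail L) L +
    selWeight Var.u (fun σ => CanHead L σ ∧ r ∉ σ.support) L

/-- The weight that records all the factors, the tails that fix the point `r`, and the heads. -/
def mirrorWeight (r : Fin n) (L : List (Perm (Fin n))) : Var →₀ ℕ :=
  selWeight Var.x (fun _ => True) L +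
    selWeight Var.v (fun σ => CanTail L σ ∧ r ∉ σ.support) L + selWeight Var.u (CanHead L) L

/-- The weight that records all the factors, the tails and the heads. -/
def fullWeight (L : List (Perm (Fin n))) : Var →₀ ℕ :=
  selWeight Var.x (fun _ => True) L + selWeight Var.v (CanTail L) L +
    selWeight Var.u (CanHead L) L

theorem mapDomain_rootWeight_revInv (r : Fin n) (L : List (Perm (Fin n))) :
    (rootWeight r (revInv L)).mapDomain swapVar = mirrorWeight r L := by
  simp only [rootWeight, Finsupp.mapDomain_add, mapDomain_selWeight, selWeight_revInv,
    canTail_revInv, canHead_revInv, Perm.support_inv, inv_inv]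
  rw [mirrorWeight, add_right_comm]
  rfl

theorem Equivalent.rootWeight_eq (h : Equivalent L L') (r : Fin n) :
    rootWeight r L = rootWeight r L' := by
  simp only [rootWeight, selWeight_perm _ _ h.perm]
  congr 1
  · congr 1
    exact selWeight_congr _ fun σ _ => h.canTail_iff
  · exact selWeight_congr _ fun σ _ => by rw [h.canHead_iff]

theorem Equivalent.fullWeight_eq (h : Equivalent L L') : fullWeight L = fullWeight L' := by
  simp only [fullWeight, selWeight_perm _ _ h.perm]
  congr 1
  · congr 1
    exact selWeight_congr _ fun σ _ => h.canTail_iff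
  · exact selWeight_congr _ fun σ _ => h.canHead_iff

end Weights

namespace Decomp

variable {n m : ℕ} {α β : Fin (m + 2) → List (Fin n)} {w : Fin (m + 2) → Fin n}
  {A B : Fin (m + 2) → List (Perm (Fin n))} {l : List (Fin n)} {L : List (Perm (Fin n))}

theorem left_zero (h : Decomp α β w A B l L) : A 0 = [] := by
  rw [(h.left 0).eq_nil_iff, h.first]
  rfl

theorem head_eq (h : Decomp α β w A B l L) : ∃ l', l = w 0 :: l' := by
  refine ⟨β 0 ++ (List.ofFn fun i : Fin (m + 1) => α i.succ ++ w i.succ :: β i.succ).flatten, ?_⟩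
  rw [h.list_eq, List.ofFn_succ, List.flatten_cons, h.first]
  rfl

open Classical in
theorem selWeight_eq (h : Decomp α β w A B l L) (c : Len → Var) (p : Perm (Fin n) → Prop) :
    selWeight c p L = ∑ i, selWeight c p (A i) +
      ((if p (List.ofFn w).formPerm then
        Finsupp.single (c ⟨m + 2, Nat.le_add_left 2 m⟩) 1 else 0) +
      ∑ i, selWeight c p (B i)) := by
  rw [h.fact_eq, selWeight_append, selWeight_cons, selWeight_flatten_ofFn, selWeight_flatten_ofFn,
    lenOf_eq (j := ⟨m + 2, Nat.le_add_left 2 m⟩) h.card_support]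

theorem root_notMem_left (h : Decomp α β w A B l L)
    {i : Fin (m + 2)} {σ : Perm (Fin n)} (hσ : σ ∈ A i) :
    w 0 ∉ σ.support := by
  intro hw
  have hi := h.block_unique (h.mem_block_of_left hσ hw) (by simp : w 0 ∈ α 0 ++ w 0 :: β 0)
  subst hi
  simp [h.left_zero] at hσ

theorem root_notMem_right (h : Decomp α β w A B l L)
    {i : Fin (m + 2)} {σ : Perm (Fin n)} (hσ : σ ∈ B i)
    (hi : w i ∉ σ.support) : w 0 ∉ σ.support := by
  intro hw
  have h0 := h.block_unique (h.mem_block_of_right hσ hw) (by simp : w 0 ∈ α 0 ++ w 0 :: β 0)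
  subst h0
  exact hi hw

-- P moves the root, so it never counts as a head here. A head coming from a right piece must fix `w
-- i`, and then it fixes the root too. The left pieces avoid the root altogether, but their tails
-- must fix `w i`; hence `mirrorWeight`.
open Classical in
theorem rootWeight_eq (h : Decomp α β w A B l L) : rootWeight (w 0) L =
    Finsupp.single (Var.x ⟨m + 2, Nat.le_add_left 2 m⟩) 1 +
      (if ∀ i, B i = [] then Finsupp.single (Var.v ⟨m + 2, Nat.le_add_left 2 m⟩) 1 else 0) +
      ∑ i, rootWeight (w i) (B i) + ∑ i, mirrorWeight (w i) (A i) := by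
  have hvA := fun i => selWeight_congr (L := A i) Var.v fun σ hσ => h.canTail_of_mem_left hσ
  have hvB := fun i => selWeight_congr (L := B i) Var.v fun σ hσ => h.canTail_of_mem_right hσ
  have huA := fun i => selWeight_congr (L := A i) Var.u
    (p := fun σ => CanHead L σ ∧ w 0 ∉ σ.support) fun σ hσ =>
      (and_iff_left (h.root_notMem_left hσ)).trans (h.canHead_of_mem_left hσ)
  have huB := fun i => selWeight_congr (L := B i) Var.u
    (p := fun σ => CanHead L σ ∧ w 0 ∉ σ.support) fun σ hσ =>
      (and_congr_left' (h.canHead_of_mem_right hσ)).trans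
        (and_iff_left_of_imp fun hc => h.root_notMem_right hσ hc.2)
  rw [rootWeight, h.selWeight_eq, h.selWeight_eq, h.selWeight_eq]
  rw [if_pos trivial, if_neg (fun hc : CanHead L (List.ofFn w).formPerm ∧
      w 0 ∉ (List.ofFn w).formPerm.support => hc.2 (h.mem_support.2 ⟨0, rfl⟩)),
    if_congr h.canTail_formPerm rfl rfl]
  simp only [rootWeight, mirrorWeight, Finset.sum_add_distrib, hvA, hvB, huA, huB]
  abel

-- P is the only possible head of `L` that moves the root, so the two weights differ at most by its
-- variable.
open Classical in
theorem fullWeight_eq (h : Decomp α β w A B l L) : fullWeight L = rootWeight (w 0) L +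
    if ∀ i, A i = [] then Finsupp.single (Var.u ⟨m + 2, Nat.le_add_left 2 m⟩) 1 else 0 := by
  have huA := fun i => selWeight_congr (L := A i) Var.u
    (p := fun σ => CanHead L σ ∧ w 0 ∉ σ.support) (q := CanHead L) fun σ hσ =>
      and_iff_left (h.root_notMem_left hσ)
  have huB := fun i => selWeight_congr (L := B i) Var.u
    (p := fun σ => CanHead L σ ∧ w 0 ∉ σ.support) (q := CanHead L) fun σ hσ =>
      and_iff_left_of_imp fun hc =>
        h.root_notMem_right hσ ((h.canHead_of_mem_right hσ).1 hc).2
  rw [fullWeight, rootWeight, h.selWeight_eq Var.u, h.selWeight_eq Var.u,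
    if_neg (fun hc : CanHead L (List.ofFn w).formPerm ∧
      w 0 ∉ (List.ofFn w).formPerm.support => hc.2 (h.mem_support.2 ⟨0, rfl⟩)),
    if_congr h.canHead_formPerm rfl rfl]
  simp only [huA, huB]
  abel

end Decomp

/-! ### Uniqueness of decompositions -/

namespace Decomp

variable {n : ℕ} {l : List (Fin n)} {L L' : List (Perm (Fin n))}

/-- Restrict both lists to the factors moving the root. The restricted list `L` starts with its P.
In the restricted list `L'` nothing else can be a head, because the remaining factors lie in the
zeroth right piece and do not commute with the first one. -/
theorem formPerm_eq {m m' : ℕ} {α β : Fin (m + 2) → List (Fin n)} {w : Fin (m + 2) → Fin n}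
    {A B : Fin (m + 2) → List (Perm (Fin n))} {α' β' : Fin (m' + 2) → List (Fin n)}
    {w' : Fin (m' + 2) → Fin n} {A' B' : Fin (m' + 2) → List (Perm (Fin n))}
    (h : Decomp α β w A B l L) (h' : Decomp α' β' w' A' B' l L') (hL : Equivalent L L') :
    (List.ofFn w).formPerm = (List.ofFn w').formPerm := by
  classical
  have hw : w' 0 = w 0 := by
    obtain ⟨l₁, h₁⟩ := h.head_eq
    obtain ⟨l₂, h₂⟩ := h'.head_eq
    rw [h₁] at h₂
    exact (List.cons.inj h₂).1.symm
  have hfil : ∀ {m : ℕ} {α β : Fin (m + 2) → List (Fin n)} {w : Fin (m + 2) → Fin n}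
      {A B : Fin (m + 2) → List (Perm (Fin n))} {L : List (Perm (Fin n))},
      Decomp α β w A B l L → L.filter (fun σ => w 0 ∈ σ.support) =
        (List.ofFn w).formPerm :: (List.ofFn B).flatten.filter (fun σ => w 0 ∈ σ.support) := by
    intro m α β w A B L h
    conv_lhs => rw [h.fact_eq]
    rw [List.filter_append, List.filter_eq_nil_iff.2, List.nil_append, List.filter_cons_of_pos]
    · exact decide_eq_true (h.mem_support.2 ⟨0, rfl⟩)
    · intro σ hσ
      obtain ⟨i, hi⟩ := mem_flatten_ofFn.1 hσ
      simpa using h.root_notMem_left hi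
  have he := hL.filter (fun σ => w 0 ∈ σ.support)
  rw [hfil h] at he
  have hf' := hfil h'
  rw [hw] at hf'
  rw [hf'] at he
  have hhead := (he.canHead_iff (σ := (List.ofFn w).formPerm)).1 (Or.inl rfl)
  rcases hhead with heq | ⟨hc, hh⟩
  · exact heq.symm
  · exfalso
    obtain ⟨hmem, hw0⟩ := List.mem_filter.1 hh.mem
    obtain ⟨i, hi⟩ := mem_flatten_ofFn.1 hmem
    have hw0' := of_decide_eq_true hw0
    rw [← hw] at hw0'
    have h0 := h'.block_unique (h'.mem_block_of_right hi hw0')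
      (by simp : w' 0 ∈ α' 0 ++ w' 0 :: β' 0)
    subst h0
    exact (h'.commute_iff fun x => h'.mem_block_of_right hi).1 hc hw0'

theorem arity_eq {m m' : ℕ} {α β : Fin (m + 2) → List (Fin n)} {w : Fin (m + 2) → Fin n}
    {A B : Fin (m + 2) → List (Perm (Fin n))} {α' β' : Fin (m' + 2) → List (Fin n)}
    {w' : Fin (m' + 2) → Fin n} {A' B' : Fin (m' + 2) → List (Perm (Fin n))}
    (h : Decomp α β w A B l L) (h' : Decomp α' β' w' A' B' l L') (hL : Equivalent L L') :
    m = m' := by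
  have h₁ := h.card_support
  rw [h.formPerm_eq h' hL, h'.card_support] at h₁
  omega

variable {m : ℕ} {α β : Fin (m + 2) → List (Fin n)} {w : Fin (m + 2) → Fin n}
  {A B : Fin (m + 2) → List (Perm (Fin n))} {α' β' : Fin (m + 2) → List (Fin n)}
  {w' : Fin (m + 2) → Fin n} {A' B' : Fin (m + 2) → List (Perm (Fin n))}

theorem apply_pow (h : Decomp α β w A B l L) (i : Fin (m + 2)) :
    ((List.ofFn w).formPerm ^ i.val) (w 0) = w i := by
  have := List.formPerm_pow_apply_getElem (List.ofFn w) h.nodup_ofFn i.val 0 (by simp)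
  simp only [List.getElem_ofFn, List.length_ofFn, zero_add] at this
  rw [show w 0 = w ⟨0, by omega⟩ from rfl, this]
  congr 1
  exact Fin.ext (Nat.mod_eq_of_lt i.isLt)

theorem points_eq (h : Decomp α β w A B l L) (h' : Decomp α' β' w' A' B' l L')
    (hL : Equivalent L L') : w = w' := by
  have hw : w' 0 = w 0 := by
    obtain ⟨l₁, h₁⟩ := h.head_eq
    obtain ⟨l₂, h₂⟩ := h'.head_eq
    rw [h₁] at h₂
    exact (List.cons.inj h₂).1.symm
  funext i
  rw [← h.apply_pow, ← h'.apply_pow, hw, h.formPerm_eq h' hL]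

/-- Membership in the `i`-th block of the second decomposition is invariant under all factors except
P. The pieces of the first act transitively on αᵢ wᵢ and on wᵢ βᵢ, and both contain `w i`. -/
theorem block_subset (h : Decomp α β w A B l L) (h' : Decomp α' β' w' A' B' l L')
    (hL : Equivalent L L') (i : Fin (m + 2)) :
    ∀ x ∈ α i ++ w i :: β i, x ∈ α' i ++ w' i :: β' i := by
  have hw := h.points_eq h' hL
  let κ : Fin n → Prop := fun x => x ∈ α' i ++ w' i :: β' i
  have hinv : ∀ σ ∈ L, σ ≠ (List.ofFn w).formPerm → ∀ x, κ (σ x) = κ x := by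
    intro σ hσ hne
    rw [h.formPerm_eq h' hL] at hne
    obtain ⟨j, hj⟩ : ∃ j, ∀ x ∈ σ.support, x ∈ α' j ++ w' j :: β' j := by
      rcases h'.mem_fact.1 (hL.perm.mem_iff.1 hσ) with ⟨j, hj⟩ | rfl | ⟨j, hj⟩
      · exact ⟨j, fun x => h'.mem_block_of_left hj⟩
      · exact (hne rfl).elim
      · exact ⟨j, fun x => h'.mem_block_of_right hj⟩
    refine invariant_of_support fun x hx y hy => propext ?_
    constructor
    · intro hx'
      obtain rfl := h'.block_unique (hj x hx) hx'
      exact hj y hy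
    · intro hy'
      obtain rfl := h'.block_unique (hj y hy) hy'
      exact hj x hx
  have hκ : κ (w i) := by simp [κ, hw]
  have h₁ : ∀ x ∈ α i ++ [w i], κ x := by
    intro x hx
    rw [label_eq_of_formPerm_invariant (κ := κ) (h.left i).nodup (fun y _ => ?_) hx
      (by simp : w i ∈ α i ++ [w i])]
    · exact hκ
    · rw [← (h.left i).prod_eq]
      exact list_prod_invariant (fun σ hσ => hinv σ (h.mem_fact.2 (Or.inl ⟨i, hσ⟩))
        (h.ne_of_left hσ)) y
  have h₂ : ∀ x ∈ w i :: β i, κ x := by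
    intro x hx
    rw [label_eq_of_formPerm_invariant (κ := κ) (h.right i).nodup (fun y _ => ?_) hx
      (by simp : w i ∈ w i :: β i)]
    · exact hκ
    · rw [← (h.right i).prod_eq]
      exact list_prod_invariant (fun σ hσ => hinv σ (h.mem_fact.2 (Or.inr (Or.inr ⟨i, hσ⟩)))
        (h.ne_of_right hσ)) y
  intro x hx
  rcases List.mem_append.1 hx with hx | hx
  · exact h₁ x (List.mem_append_left _ hx)
  · exact h₂ x hx

theorem block_eq_filter (h : Decomp α β w A B l L) (i : Fin (m + 2)) :
    α i ++ w i :: β i = l.filter fun x => x ∈ α i ++ w i :: β i := by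
  conv_rhs => rw [h.list_eq]
  rw [filter_flatten_ofFn, flatten_ofFn_single i]
  · rw [List.filter_eq_self.2 fun x hx => decide_eq_true hx]
  · intro j hj
    rw [List.filter_eq_nil_iff]
    intro x hx hx'
    exact hj (h.block_unique hx (of_decide_eq_true hx'))

/-- The blocks agree as sets, their order comes from `l`, and `w i` marks the cut between α and β.
-/
theorem blocks_eq (h : Decomp α β w A B l L) (h' : Decomp α' β' w' A' B' l L')
    (hL : Equivalent L L') : α = α' ∧ β = β' := by
  have hw := h.points_eq h' hL
  have key : ∀ i, α i = α' i ∧ β i = β' i := by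
    intro i
    have hb : α i ++ w i :: β i = α' i ++ w i :: β' i := by
      have : α i ++ w i :: β i = α' i ++ w' i :: β' i := by
        rw [h.block_eq_filter, h'.block_eq_filter]
        refine List.filter_congr fun x _ => decide_eq_decide.2 ⟨h.block_subset h' hL i x,
          h'.block_subset h (Relation.EqvGen.symm _ _ hL) i x⟩
      rwa [← hw] at this
    have hnd := h.block_nodup i
    have hn : ∀ {a b : List (Fin n)} {c : Fin n}, (a ++ c :: b).Nodup → c ∉ a ∧ c ∉ b := by
      intro a b c hab
      refine ⟨fun hc => List.disjoint_of_nodup_append hab hc (by simp), ?_⟩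
      exact (List.nodup_cons.1 (hab.sublist (List.sublist_append_right _ _))).1
    have := (List.append_cons_inj_of_notMem (hn hnd).1 (hn hnd).2).1 hb
    exact ⟨this.1, this.2.2⟩
  exact ⟨funext fun i => (key i).1, funext fun i => (key i).2⟩

/-- A factor of any other piece shares at most one point with αᵢ wᵢ, and P has points in several
blocks. So the piece is a selection from `L`, and `Equivalent.filter` applies to it. -/
theorem left_eq_within (h : Decomp α β w A B l L) (i : Fin (m + 2)) :
    A i = Labelled.within L (α i ++ [w i]) := by
  classical
  conv_rhs => rw [h.fact_eq]
  rw [Labelled.within, List.filter_append, List.filter_cons_of_neg, filter_flatten_ofFn,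
    filter_flatten_ofFn, flatten_ofFn_single i, flatten_ofFn_single i,
    List.filter_eq_self.2 fun σ hσ => decide_eq_true ((h.left i).mem_of_mem_support σ hσ),
    List.filter_eq_nil_iff.2, List.append_nil]
  · intro σ hσ hp
    obtain ⟨x, hx, hne⟩ := Finset.exists_mem_ne (h.two_le_right hσ) (w i)
    exact hne (h.eq_w_of_mem (of_decide_eq_true hp x hx)
      ((h.right i).mem_of_mem_support σ hσ x hx)).2
  · intro j hj
    rw [List.filter_eq_nil_iff]
    intro σ hσ hp
    obtain ⟨x, hx, hne⟩ := Finset.exists_mem_ne (h.two_le_right hσ) (w i)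
    exact hne (h.eq_w_of_mem (of_decide_eq_true hp x hx)
      ((h.right j).mem_of_mem_support σ hσ x hx)).2
  · intro j hj
    rw [List.filter_eq_nil_iff]
    intro σ hσ hp
    obtain ⟨x, hx⟩ := Finset.card_pos.1 (by have := h.two_le_left hσ; omega : 0 < σ.support.card)
    refine hj (h.block_unique (h.mem_block_of_left hσ hx) ?_)
    have := of_decide_eq_true hp x hx
    simp only [List.mem_append, List.mem_cons] at this ⊢
    tauto
  · intro hp
    refine h.not_subset_block i fun x hx => ?_
    have := of_decide_eq_true hp x hx
    simp only [List.mem_append, List.mem_cons] at this ⊢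
    tauto

theorem right_eq_within (h : Decomp α β w A B l L) (i : Fin (m + 2)) :
    B i = Labelled.within L (w i :: β i) := by
  classical
  conv_rhs => rw [h.fact_eq]
  rw [Labelled.within, List.filter_append, List.filter_cons_of_neg, filter_flatten_ofFn,
    filter_flatten_ofFn, flatten_ofFn_single i, flatten_ofFn_single i,
    List.filter_eq_self.2 fun σ hσ => decide_eq_true ((h.right i).mem_of_mem_support σ hσ),
    List.filter_eq_nil_iff.2, List.nil_append]
  · intro σ hσ hp
    obtain ⟨x, hx, hne⟩ := Finset.exists_mem_ne (h.two_le_left hσ) (w i)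
    exact hne (h.eq_w_of_mem ((h.left i).mem_of_mem_support σ hσ x hx)
      (of_decide_eq_true hp x hx)).2
  · intro j hj
    rw [List.filter_eq_nil_iff]
    intro σ hσ hp
    obtain ⟨x, hx⟩ := Finset.card_pos.1 (by have := h.two_le_right hσ; omega : 0 < σ.support.card)
    refine hj (h.block_unique (h.mem_block_of_right hσ hx) ?_)
    have := of_decide_eq_true hp x hx
    simp only [List.mem_append, List.mem_cons] at this ⊢
    tauto
  · intro j hj
    rw [List.filter_eq_nil_iff]
    intro σ hσ hp
    obtain ⟨x, hx, hne⟩ := Finset.exists_mem_ne (h.two_le_left hσ) (w j)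
    exact hne (h.eq_w_of_mem ((h.left j).mem_of_mem_support σ hσ x hx)
      (of_decide_eq_true hp x hx)).2
  · intro hp
    refine h.not_subset_block i fun x hx => ?_
    have := of_decide_eq_true hp x hx
    simp only [List.mem_append, List.mem_cons] at this ⊢
    tauto

theorem pieces_equivalent (h : Decomp α β w A B l L) (h' : Decomp α' β' w' A' B' l L')
    (hL : Equivalent L L') (i : Fin (m + 2)) :
    Equivalent (A i) (A' i) ∧ Equivalent (B i) (B' i) := by
  obtain ⟨rfl, rfl⟩ := h.blocks_eq h' hL
  obtain rfl := h.points_eq h' hL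
  rw [h.left_eq_within, h.right_eq_within, h'.left_eq_within, h'.right_eq_within]
  exact ⟨hL.filter _, hL.filter _⟩

end Decomp

/-! ### Trees that encode the equivalence classes -/

/-- A tree is either empty, or its root carries an `(m + 2)`-cycle together with a tree on the right
of each of its points and a tree on the left of each of its points other than the first. -/
inductive Tree : Type
  | nil : Tree
  | node (m : ℕ) (b : Fin (m + 2) → Tree) (a : Fin (m + 1) → Tree) : Tree

/-- The number `m + 2` as a possible length. -/
def len (m : ℕ) : Len := ⟨m + 2, Nat.le_add_left 2 m⟩

namespace Tree

/-- The number of points other than the root. -/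
def rank : Tree → ℕ
  | nil => 0
  | node m b a => m + 1 + ∑ i, rank (b i) + ∑ i, rank (a i)

open Classical in
/-- The monomial of a tree in `f`. -/
def weight : Tree → Var →₀ ℕ
  | nil => 0
  | node m b a => Finsupp.single (Var.x (len m)) 1 +
      (if ∀ i, b i = nil then Finsupp.single (Var.v (len m)) 1 else 0) +
      ∑ i, weight (b i) + ∑ i, (weight (a i)).mapDomain swapVar

open Classical in
/-- The monomial of a tree in `g`. -/
def fullWeight : Tree → Var →₀ ℕ
  | nil => 0
  | node m b a => weight (node m b a) +
      if ∀ i, a i = nil then Finsupp.single (Var.u (len m)) 1 else 0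

variable {n : ℕ}

/-- The factorization `L` of the cycle through `l` has the shape of the tree. -/
def Rep : Tree → List (Fin n) → List (Perm (Fin n)) → Prop
  | nil, l, L => L = [] ∧ l.length = 1
  | node m b a, l, L => ∃ (α β : Fin (m + 2) → List (Fin n)) (w : Fin (m + 2) → Fin n)
      (A B : Fin (m + 2) → List (Perm (Fin n))), Decomp α β w A B l L ∧
        (∀ i, Rep (b i) (w i :: β i) (B i)) ∧
        ∀ i : Fin (m + 1), Rep (a i) (w i.succ :: (α i.succ).reverse) (revInv (A i.succ))

namespace Rep

variable {t t' : Tree} {l : List (Fin n)} {L L' : List (Perm (Fin n))}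

theorem minFact (h : Rep t l L) : MinFact l L := by
  cases t with
  | nil =>
    obtain ⟨rfl, hl⟩ := h
    obtain ⟨a, rfl⟩ := List.length_eq_one_iff.1 hl
    exact minFact_singleton a
  | node m b a =>
    obtain ⟨α, β, w, A, B, hd, -⟩ := h
    exact hd.minFact

theorem eq_nil_iff (h : Rep t l L) : L = [] ↔ t = nil := by
  cases t with
  | nil => simpa using h.1
  | node m b a =>
    obtain ⟨α, β, w, A, B, hd, -⟩ := h
    simp [hd.fact_eq]

theorem length_eq (h : Rep t l L) : l.length = t.rank + 1 := by
  induction t generalizing l L with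
  | nil => simpa [rank] using h.2
  | node m b a ihb iha =>
    obtain ⟨α, β, w, A, B, hd, hb, ha⟩ := h
    have h₁ := fun i => ihb i (hb i)
    have h₂ := fun i => iha i (ha i)
    simp only [List.length_cons, List.length_reverse, add_left_inj] at h₁ h₂
    have hlen := congrArg List.length hd.list_eq
    simp only [List.length_flatten, List.map_ofFn, List.sum_ofFn, Function.comp_def,
      List.length_append, List.length_cons, Finset.sum_add_distrib, Finset.sum_const,
      Finset.card_univ, Fintype.card_fin, smul_eq_mul, mul_one] at hlen
    rw [Fin.sum_univ_succ (fun i => (α i).length), hd.first] at hlen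
    simp only [h₁, h₂, List.length_nil, zero_add] at hlen
    rw [hlen, rank]
    ring

theorem rootWeight_eq {r : Fin n} (h : Rep t (r :: l) L) : rootWeight r L = t.weight := by
  classical
  induction t generalizing r l L with
  | nil =>
    rw [h.1]
    simp [rootWeight, selWeight_nil, weight]
  | node m b a ihb iha =>
    obtain ⟨α, β, w, A, B, hd, hb, ha⟩ := h
    obtain ⟨l', hl'⟩ := hd.head_eq
    obtain rfl := (List.cons.inj hl').1
    have h₁ := fun i => ihb i (hb i)
    have h₂ := fun i => iha i (ha i)
    -- The zeroth left piece is empty, so only the `m + 1` left subtrees of the tree contribute.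
    have h₃ : mirrorWeight (w 0) (A 0) = 0 := by
      rw [hd.left_zero]
      simp [mirrorWeight, selWeight_nil]
    rw [hd.rootWeight_eq, Fin.sum_univ_succ (fun i => mirrorWeight (w i) (A i)), h₃, zero_add,
      weight, if_congr (forall_congr' fun i => (hb i).eq_nil_iff) rfl rfl]
    simp only [h₁, ← mapDomain_rootWeight_revInv, h₂]
    rfl

theorem fullWeight_eq (h : Rep t l L) : CycleFactorization.fullWeight L = t.fullWeight := by
  classical
  cases t with
  | nil =>
    rw [h.1]
    simp [CycleFactorization.fullWeight, selWeight_nil, fullWeight]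
  | node m b a =>
    have h' := h
    obtain ⟨α, β, w, A, B, hd, hb, ha⟩ := h
    obtain ⟨l', rfl⟩ := hd.head_eq
    have hA : (∀ i, A i = []) ↔ ∀ i, a i = nil := by
      rw [Fin.forall_fin_succ, and_iff_right hd.left_zero]
      refine forall_congr' fun i => ?_
      rw [← (ha i).eq_nil_iff, revInv, List.reverse_eq_nil_iff, List.map_eq_nil_iff]
    rw [hd.fullWeight_eq, h'.rootWeight_eq, fullWeight, if_congr hA rfl rfl]
    rfl

theorem tree_unique (h : Rep t l L) (h' : Rep t' l L') (hL : Equivalent L L') : t = t' := by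
  induction t generalizing t' l L L' with
  | nil =>
    have h₁ : L' = [] := by
      have := hL.perm.length_eq
      rw [h.1] at this
      exact List.length_eq_zero_iff.1 this.symm
    exact (h'.eq_nil_iff.1 h₁).symm
  | node m b a ihb iha =>
    cases t' with
    | nil =>
      have h₁ : L = [] := by
        have := hL.perm.length_eq
        rw [h'.1] at this
        exact List.length_eq_zero_iff.1 this
      exact h.eq_nil_iff.1 h₁
    | node m' b' a' =>
      obtain ⟨α, β, w, A, B, hd, hb, ha⟩ := h
      obtain ⟨α', β', w', A', B', hd', hb', ha'⟩ := h'
      obtain rfl := hd.arity_eq hd' hL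
      obtain ⟨rfl, rfl⟩ := hd.blocks_eq hd' hL
      obtain rfl := hd.points_eq hd' hL
      congr 1
      · funext i
        exact ihb i (hb i) (hb' i) (hd.pieces_equivalent hd' hL i).2
      · funext i
        exact iha i (ha i) (ha' i) (hd.pieces_equivalent hd' hL i.succ).1.revInv

/-- The ranks of the subtrees give the lengths of all blocks, so `l` is cut at the same places; the
pieces agree by induction. -/
theorem list_unique (h : Rep t l L) (h' : Rep t l L') : L = L' := by
  induction t generalizing l L L' with
  | nil => rw [h.1, h'.1]
  | node m b a ihb iha =>
    obtain ⟨α, β, w, A, B, hd, hb, ha⟩ := h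
    obtain ⟨α', β', w', A', B', hd', hb', ha'⟩ := h'
    have hβ : ∀ i, (β i).length = (β' i).length := fun i => by
      simpa using (hb i).length_eq.trans (hb' i).length_eq.symm
    have hα : ∀ i, (α i).length = (α' i).length := by
      refine Fin.cases (by rw [hd.first, hd'.first]) fun i => ?_
      simpa using (ha i).length_eq.trans (ha' i).length_eq.symm
    have hlist : (List.ofFn fun i => α i ++ w i :: β i) = List.ofFn fun i => α' i ++ w' i :: β' i := by
      rw [List.eq_iff_flatten_eq]
      refine ⟨hd.list_eq.symm.trans hd'.list_eq, ?_⟩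
      simp only [List.map_ofFn, Function.comp_def, List.length_append, List.length_cons, hα, hβ]
    have hblock := List.ofFn_injective hlist
    have hpieces : ∀ i, α i = α' i ∧ w i = w' i ∧ β i = β' i := fun i => by
      have := congrFun hblock i
      obtain ⟨h₁, h₂⟩ := List.append_inj this (hα i)
      exact ⟨h₁, List.cons.inj h₂⟩
    obtain rfl : α = α' := funext fun i => (hpieces i).1
    obtain rfl : w = w' := funext fun i => (hpieces i).2.1
    obtain rfl : β = β' := funext fun i => (hpieces i).2.2
    have hB : B = B' := funext fun i => ihb i (hb i) (hb' i)
    have hA : A = A' := by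
      funext i
      refine Fin.cases (by rw [hd.left_zero, hd'.left_zero]) (fun i => ?_) i
      rw [← revInv_revInv (A i.succ), iha i (ha i) (ha' i), revInv_revInv]
    rw [hd.fact_eq, hd'.fact_eq, hA, hB]

end Rep

theorem exists_flatten_ofFn {V : Type*} {k : ℕ} (s : Fin k → ℕ) (l : List V)
    (hl : l.length = ∑ i, s i) :
    ∃ e : Fin k → List V, (∀ i, (e i).length = s i) ∧ l = (List.ofFn e).flatten := by
  induction k generalizing l with
  | zero =>
    refine ⟨fun i => i.elim0, fun i => i.elim0, ?_⟩
    simpa using hl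
  | succ k ih =>
    rw [Fin.sum_univ_succ] at hl
    obtain ⟨e, he, hl'⟩ := ih (fun i => s i.succ) (l.drop (s 0)) (by simp; omega)
    refine ⟨Fin.cons (l.take (s 0)) e, Fin.cases (by simp; omega) fun i => by simpa using he i, ?_⟩
    simp [List.ofFn_succ, ← hl']

/-- Every tree is the shape of a factorization. -/
theorem exists_rep (t : Tree) (l : List (Fin n)) (hnd : l.Nodup) (hl : l.length = t.rank + 1) :
    ∃ L, Rep t l L := by
  induction t generalizing l with
  | nil => exact ⟨[], rfl, by simpa [rank] using hl⟩
  | node m b a ihb iha =>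
    -- `s i` is the length of αᵢ; it is 0 for the first block, which has no left subtree.
    let s : Fin (m + 2) → ℕ := Fin.cons 0 fun i => (a i).rank
    obtain ⟨e, he, hle⟩ := exists_flatten_ofFn (fun i => s i + ((b i).rank + 1)) l (by
      rw [hl, rank]
      simp only [Finset.sum_add_distrib, Finset.sum_const, Finset.card_univ, Fintype.card_fin,
        smul_eq_mul, mul_one]
      rw [Fin.sum_univ_succ s]
      simp only [s, Fin.cons_zero, Fin.cons_succ]
      ring)
    have hex : ∀ i, ∃ x : List (Fin n) × Fin n × List (Fin n), e i = x.1 ++ x.2.1 :: x.2.2 ∧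
        x.1.length = s i ∧ x.2.2.length = (b i).rank := by
      intro i
      have h₁ : ((e i).drop (s i)).length = (b i).rank + 1 := by simp [he]
      obtain ⟨y, β, hy⟩ := List.exists_cons_of_length_eq_add_one h₁
      refine ⟨((e i).take (s i), y, β), ?_, by simp [he], ?_⟩
      · rw [← hy, List.take_append_drop]
      · rw [hy] at h₁
        simpa using h₁
    choose x hx hα hβ using hex
    have hle' : l = (List.ofFn fun i => (x i).1 ++ (x i).2.1 :: (x i).2.2).flatten := by
      rw [hle]
      congr 2
      exact funext hx
    have hblock : ∀ i, ((x i).1 ++ (x i).2.1 :: (x i).2.2).Nodup :=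
      nodup_of_nodup_flatten_ofFn (hle' ▸ hnd)
    have hB := fun i => ihb i ((x i).2.1 :: (x i).2.2)
      ((hblock i).sublist (List.sublist_append_right _ _)) (by simp [hβ])
    choose B hB using hB
    have hA := fun i : Fin (m + 1) => iha i ((x i.succ).2.1 :: (x i.succ).1.reverse) (by
      have h₁ : ((x i.succ).1 ++ [(x i.succ).2.1]).Nodup := (hblock i.succ).sublist (by simp)
      rw [← List.nodup_reverse]
      simpa using h₁) (by simp [hα, s])
    choose A hA using hA
    have h0 : (x 0).1 = [] := List.length_eq_zero_iff.1 (by simp [hα, s])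
    refine ⟨_, fun i => (x i).1, fun i => (x i).2.2, fun i => (x i).2.1,
      Fin.cons [] fun i => revInv (A i), B, ⟨hnd, hle', rfl, ?_, fun i => (hB i).minFact, h0⟩,
      hB, fun i => ?_⟩
    · refine Fin.cases ?_ fun i => ?_
      · rw [h0, Fin.cons_zero]
        exact minFact_singleton _
      · rw [Fin.cons_succ]
        simpa using (hA i).minFact.revInv
    · rw [Fin.cons_succ, revInv_revInv]
      exact hA i

end Tree

theorem length_le_length_flatten_ofFn {V : Type*} {k : ℕ} (f : Fin k → List V) (i : Fin k) :
    (f i).length ≤ (List.ofFn f).flatten.length := by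
  obtain ⟨X, Y, h⟩ := exists_append_of_flatten_ofFn f i
  rw [h]
  simp only [List.length_append]
  omega

/-- Every factorization is equivalent to one that has the shape of a tree. -/
theorem MinFact.exists_rep {n : ℕ} {l : List (Fin n)} {L : List (Perm (Fin n))}
    (h : MinFact l L) : ∃ t L', Equivalent L L' ∧ Tree.Rep t l L' := by
  induction hN : L.length using Nat.strong_induction_on generalizing l L with
  | _ N ih =>
    by_cases hL : L = []
    · exact ⟨Tree.nil, [], Equivalent.of_eq hL, rfl, h.eq_nil_iff.1 hL⟩
    · obtain ⟨m, α, β, w, A, B, L₀, hL₀, hd⟩ := h.exists_decomp hL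
      have hlen : (List.ofFn A).flatten.length + ((List.ofFn B).flatten.length + 1) = N := by
        rw [← hN, hL₀.perm.length_eq, hd.fact_eq, List.length_append, List.length_cons]
      -- P belongs to no piece, so every piece has fewer factors than `L`.
      have hB := fun i => ih (B i).length (by
        have := length_le_length_flatten_ofFn B i
        omega) (hd.right i) rfl
      choose b B' hBB' hB' using hB
      have hA := fun i : Fin (m + 1) => ih (CycleFactorization.revInv (A i.succ)).length (by
        have := length_le_length_flatten_ofFn A i.succ
        rw [length_revInv]
        omega) (l := w i.succ :: (α i.succ).reverse) (by simpa using (hd.left i.succ).revInv) rfl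
      choose a A' hAA' hA' using hA
      let A'' : Fin (m + 2) → List (Perm (Fin n)) := Fin.cons [] fun i => CycleFactorization.revInv (A' i)
      have hA'' : ∀ i, Equivalent (A i) (A'' i) := by
        refine Fin.cases ?_ fun i => ?_
        · rw [hd.left_zero]
          exact Equivalent.rfl'
        · have := (hAA' i).revInv
          rwa [revInv_revInv] at this
      refine ⟨Tree.node m b a,
        (List.ofFn A'').flatten ++ (List.ofFn w).formPerm :: (List.ofFn B').flatten, ?_,
        α, β, w, A'', B', ⟨hd.nodup, hd.list_eq, rfl, fun i => (hd.left i).of_equivalent (hA'' i),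
          fun i => (hB' i).minFact, hd.first⟩, hB', fun i => ?_⟩
      · refine hL₀.trans _ _ _ ?_
        rw [hd.fact_eq]
        exact (Equivalent.flatten_ofFn hA'').append ((Equivalent.flatten_ofFn hBB').cons _)
      · have : A'' i.succ = CycleFactorization.revInv (A' i) := rfl
        rw [this, revInv_revInv]
        exact hA' i

/-! ### The coefficients of `g` count trees -/

section Count

variable {n : ℕ} {L : List (Perm (Fin n))}

open Classical in
theorem selWeight_apply {c : Len → Var} (hc : Function.Injective c) (p : Perm (Fin n) → Prop)
    (j : Len) : selWeight c p L (c j) = (L.filter fun σ => p σ ∧ lenOf σ = j).length := by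
  induction L with
  | nil => simp [selWeight]
  | cons σ L ih =>
    rw [selWeight_cons, Finsupp.add_apply, ih, List.filter_cons]
    by_cases h₁ : p σ
    · by_cases h₂ : lenOf σ = j
      · simp [h₁, h₂, add_comm]
      · simp [h₁, h₂, hc.eq_iff]
    · simp [h₁]

theorem selWeight_apply_of_ne {c : Len → Var} (p : Perm (Fin n) → Prop) {y : Var}
    (hy : ∀ j, c j ≠ y) : selWeight c p L y = 0 := by
  classical
  induction L with
  | nil => simp [selWeight]
  | cons σ L ih =>
    rw [selWeight_cons, Finsupp.add_apply, ih]
    split_ifs <;> simp [hy]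

/-- The maximum with 2 in `lenOf` only serves to land in `Len`; a cycle moves at least two points,
so it changes nothing. -/
theorem lenOf_eq_iff {σ : Perm (Fin n)} (hσ : σ.IsCycle) {j : Len} :
    lenOf σ = j ↔ σ.support.card = j.1 := by
  refine ⟨fun h => ?_, lenOf_eq⟩
  rw [← h]
  exact (max_eq_right hσ.two_le_card_support).symm

theorem length_filter_eq_ncard {p : Perm (Fin n) → Prop} [DecidablePred p] (hL : L.Nodup)
    {s : Set (Perm (Fin n))} (hs : ∀ σ, σ ∈ s ↔ σ ∈ L ∧ p σ) :
    (L.filter fun σ => p σ).length = s.ncard := by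
  rw [← List.toFinset_card_of_nodup (hL.filter _), ← Set.ncard_coe_finset]
  congr 1
  ext σ
  simp [hs]

/-- The weight counts occurrences in the list, the head and tail numbers count different cycles;
`hnd` makes these the same. -/
theorem fullWeight_eq_iff (hnd : L.Nodup) (hc : ∀ σ ∈ L, σ.IsCycle) (e : Var →₀ ℕ) :
    fullWeight L = e ↔
      (∀ j : Len, (L.filter fun σ => σ.support.card = j.1).length = e (Var.x j)) ∧
      (∀ j : Len, {σ | CanHead L σ ∧ σ.support.card = j.1}.ncard = e (Var.u j)) ∧
      ∀ j : Len, {σ | CanTail L σ ∧ σ.support.card = j.1}.ncard = e (Var.v j) := by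
  classical
  have hx : ∀ j, fullWeight L (Var.x j) =
      (L.filter fun σ => σ.support.card = j.1).length := by
    intro j
    rw [fullWeight, Finsupp.add_apply, Finsupp.add_apply,
      selWeight_apply fun _ _ => Var.x.inj, selWeight_apply_of_ne _ (by simp),
      selWeight_apply_of_ne _ (by simp)]
    simp only [true_and, add_zero]
    rw [List.filter_congr fun σ hσ => decide_eq_decide.2 (lenOf_eq_iff (hc σ hσ))]
  have hu : ∀ j, fullWeight L (Var.u j) =
      {σ | CanHead L σ ∧ σ.support.card = j.1}.ncard := by
    intro j
    rw [fullWeight, Finsupp.add_apply, Finsupp.add_apply,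
      selWeight_apply_of_ne _ (by simp), selWeight_apply_of_ne _ (by simp),
      selWeight_apply fun _ _ => Var.u.inj, zero_add, zero_add]
    refine length_filter_eq_ncard hnd fun σ => ?_
    constructor
    · rintro ⟨h₁, h₂⟩
      exact ⟨h₁.mem, h₁, lenOf_eq h₂⟩
    · rintro ⟨h₁, h₂, h₃⟩
      exact ⟨h₂, (lenOf_eq_iff (hc σ h₁)).1 h₃⟩
  have hv : ∀ j, fullWeight L (Var.v j) =
      {σ | CanTail L σ ∧ σ.support.card = j.1}.ncard := by
    intro j
    rw [fullWeight, Finsupp.add_apply, Finsupp.add_apply,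
      selWeight_apply_of_ne _ (by simp), selWeight_apply fun _ _ => Var.v.inj,
      selWeight_apply_of_ne _ (by simp), zero_add, add_zero]
    refine length_filter_eq_ncard hnd fun σ => ?_
    constructor
    · rintro ⟨h₁, h₂⟩
      exact ⟨h₁.mem, h₁, lenOf_eq h₂⟩
    · rintro ⟨h₁, h₂, h₃⟩
      exact ⟨h₂, (lenOf_eq_iff (hc σ h₁)).1 h₃⟩
  simp only [← hx, ← hu, ← hv]
  constructor
  · rintro rfl
    exact ⟨fun _ => rfl, fun _ => rfl, fun _ => rfl⟩
  · rintro ⟨h₁, h₂, h₃⟩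
    ext (j | j | j)
    exacts [h₁ j, h₃ j, h₂ j]

theorem rank_eq_totalRank (hc : ∀ σ ∈ L, σ.IsCycle) {α : Len →₀ ℕ}
    (h : ∀ j : Len, (L.filter fun σ => σ.support.card = j.1).length = α j) :
    rank α = totalRank L := by
  have hα : α = (L.map fun σ => Finsupp.single (lenOf σ) 1).sum := by
    ext j
    rw [← h j]
    clear h
    induction L with
    | nil => simp
    | cons σ L ih =>
      have := lenOf_eq_iff (hc σ List.mem_cons_self) (j := j)
      rw [List.map_cons, List.sum_cons, Finsupp.add_apply,
        ← ih fun τ hτ => hc τ (List.mem_cons_of_mem _ hτ), List.filter_cons, Finsupp.single_apply]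
      by_cases h₂ : lenOf σ = j
      · simp [this.1 h₂, h₂, add_comm]
      · simp [mt this.2 h₂, h₂]
  rw [hα]
  clear h hα
  induction L with
  | nil => simp [rank, totalRank]
  | cons σ L ih =>
    rw [totalRank_cons, ← ih fun τ hτ => hc τ (List.mem_cons_of_mem _ hτ), List.map_cons,
      List.sum_cons, rank, Finsupp.sum_add_index' (by simp) (fun _ _ _ => by ring),
      Finsupp.sum_single_index (by simp), mul_one]
    have : (lenOf σ).1 = σ.support.card :=
      ((lenOf_eq_iff (hc σ List.mem_cons_self)).1 rfl).symm
    rw [this]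
    rfl

theorem formPerm_finRange (k : ℕ) : (List.finRange (k + 1)).formPerm = finRotate (k + 1) := by
  ext x
  have h := List.formPerm_apply_getElem (List.finRange (k + 1)) (List.nodup_finRange _) x.val
    (by simpa using x.isLt)
  simp only [List.getElem_finRange, Fin.eta, Fin.cast_mk, List.length_finRange] at h
  rw [h, finRotate_apply]
  simp [Fin.val_add]

theorem isFactorization_iff {α : Len →₀ ℕ} {L : List (Perm (Fin (rank α + 1)))} :
    IsFactorization (rank α + 1) α L ↔ MinFact (List.finRange (rank α + 1)) L ∧
      ∀ j : Len, (L.filter fun σ => σ.support.card = j.1).length = α j := by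
  constructor
  · intro h
    refine ⟨⟨List.nodup_finRange _, h.isCycle, fun _ _ x _ => List.mem_finRange x, ?_, ?_⟩,
      h.type_eq⟩
    · rw [h.prod_eq, formPerm_finRange]
    · rw [← rank_eq_totalRank h.isCycle h.type_eq, List.length_finRange]
  · rintro ⟨h, ht⟩
    exact ⟨h.isCycle, ht, by rw [h.prod_eq, formPerm_finRange]⟩

end Count

/-! ### Heads and tails of equivalence classes -/

section Classes

variable {α : Len →₀ ℕ}

theorem MinFactorization.minFact (L : MinFactorization α) :
    MinFact (List.finRange (rank α + 1)) L.1 := (isFactorization_iff.1 L.2).1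

theorem mk_eq_mk_iff {L L' : MinFactorization α} :
    Quotient.mk (equivalence α) L = Quotient.mk (equivalence α) L' ↔ Equivalent L.1 L'.1 :=
  Quotient.eq

/-- A list that is equivalent to a factorization is a factorization of the same type. -/
theorem MinFactorization.isFactorization_of_equivalent (L : MinFactorization α)
    {L' : List (Perm (Fin (rank α + 1)))} (h : Equivalent L.1 L') :
    IsFactorization (rank α + 1) α L' where
  isCycle σ hσ := L.2.isCycle σ (h.perm.mem_iff.2 hσ)
  type_eq j := by rw [← L.2.type_eq j, (h.perm.filter _).length_eq]
  prod_eq := by rw [← h.prod_eq, L.2.prod_eq]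

theorem mem_heads_mk (L : MinFactorization α) (σ : Perm (Fin (rank α + 1))) :
    σ ∈ heads (Quotient.mk (equivalence α) L : FactClass α) ↔ CanHead L.1 σ := by
  constructor
  · rintro ⟨L', hL', hh⟩
    rw [← (mk_eq_mk_iff.1 hL').canHead_iff]
    obtain ⟨M, hM⟩ := List.head?_eq_some_iff.1 hh
    rw [hM]
    exact Or.inl rfl
  · intro h
    obtain ⟨M, hM⟩ := h.exists_equivalent
    exact ⟨⟨σ :: M, L.isFactorization_of_equivalent hM⟩,
      mk_eq_mk_iff.2 (Relation.EqvGen.symm _ _ hM), rfl⟩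

theorem mem_tails_mk (L : MinFactorization α) (σ : Perm (Fin (rank α + 1))) :
    σ ∈ tails (Quotient.mk (equivalence α) L : FactClass α) ↔ CanTail L.1 σ := by
  constructor
  · rintro ⟨L', hL', hh⟩
    rw [← (mk_eq_mk_iff.1 hL').canTail_iff]
    obtain ⟨M, hM⟩ := List.getLast?_eq_some_iff.1 hh
    rw [hM, CanTail, List.reverse_append]
    exact Or.inl rfl
  · intro h
    obtain ⟨M, hM⟩ := h.exists_equivalent
    exact ⟨⟨M ++ [σ], L.isFactorization_of_equivalent hM⟩,
      mk_eq_mk_iff.2 (Relation.EqvGen.symm _ _ hM), by simp⟩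

theorem headCount_mk (L : MinFactorization α) (j : Len) :
    headCount (Quotient.mk (equivalence α) L : FactClass α) j =
      {σ | CanHead L.1 σ ∧ σ.support.card = j.1}.ncard := by
  simp only [headCount, mem_heads_mk]

theorem tailCount_mk (L : MinFactorization α) (j : Len) :
    tailCount (Quotient.mk (equivalence α) L : FactClass α) j =
      {σ | CanTail L.1 σ ∧ σ.support.card = j.1}.ncard := by
  simp only [tailCount, mem_tails_mk]

end Classes

theorem Tree.rank_eq_of_fullWeight {t : Tree} {e : Var →₀ ℕ} (h : t.fullWeight = e)
    {α : Len →₀ ℕ} (hα : ∀ j, α j = e (Var.x j)) : t.rank = CycleFactorization.rank α := by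
  obtain ⟨L, hL⟩ := t.exists_rep (List.finRange (t.rank + 1)) (List.nodup_finRange _) (by simp)
  have h₁ := hL.minFact
  have h₂ := (fullWeight_eq_iff h₁.nodup_factors h₁.isCycle e).1 (hL.fullWeight_eq.trans h)
  have h₃ := h₁.rank_eq
  rw [List.length_finRange, add_left_inj] at h₃
  rw [← h₃]
  exact (rank_eq_totalRank h₁.isCycle fun j => (h₂.1 j).trans (hα j).symm).symm

/-- A tree is sent to the class of the factorization it encodes. This is injective by
`Tree.Rep.tree_unique`, and surjective because each class has a member with the shape of a tree,
which `Tree.Rep.list_unique` identifies with the chosen one. -/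
theorem numFact_eq_ncard {e : Var →₀ ℕ} {α h t : Len →₀ ℕ} (hα : ∀ j, α j = e (Var.x j))
    (hh : ∀ j, h j = e (Var.u j)) (ht : ∀ j, t j = e (Var.v j)) :
    numFact α h t = {T : Tree | T.fullWeight = e}.ncard := by
  have hex : ∀ T ∈ {T : Tree | T.fullWeight = e},
      ∃ L : MinFactorization α, T.Rep (List.finRange (rank α + 1)) L.1 := by
    intro T hT
    obtain ⟨L, hL⟩ := T.exists_rep (List.finRange (rank α + 1)) (List.nodup_finRange _) (by
      rw [T.rank_eq_of_fullWeight hT hα, List.length_finRange])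
    have h₁ := hL.minFact
    have h₂ := (fullWeight_eq_iff h₁.nodup_factors h₁.isCycle e).1 (hL.fullWeight_eq.trans hT)
    exact ⟨⟨L, isFactorization_iff.2 ⟨h₁, fun j => (h₂.1 j).trans (hα j).symm⟩⟩, hL⟩
  choose F hF using hex
  have key : ∀ L : MinFactorization α, fullWeight L.1 = e ↔
      (∀ j, headCount (Quotient.mk (equivalence α) L : FactClass α) j = h j) ∧
      ∀ j, tailCount (Quotient.mk (equivalence α) L : FactClass α) j = t j := by
    intro L
    rw [fullWeight_eq_iff L.minFact.nodup_factors L.2.isCycle]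
    simp only [headCount_mk, tailCount_mk, hh, ht]
    refine and_iff_right fun j => ?_
    rw [L.2.type_eq j, hα]
  symm
  refine Set.ncard_congr (fun T hT => (Quotient.mk (equivalence α) (F T hT) : FactClass α))
    ?_ ?_ ?_
  · intro T hT
    exact (key _).1 ((hF T hT).fullWeight_eq.trans hT)
  · intro T T' hT hT' heq
    exact (hF T hT).tree_unique (hF T' hT') (mk_eq_mk_iff.1 heq)
  · intro c hc
    induction c using Quotient.inductionOn with
    | h L =>
      obtain ⟨T, L', hLL', hT⟩ := L.minFact.exists_rep
      have hTe : T.fullWeight = e := by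
        rw [← hT.fullWeight_eq, ← hLL'.fullWeight_eq]
        exact (key L).2 hc
      refine ⟨T, hTe, mk_eq_mk_iff.2 ?_⟩
      rw [(hF T hTe).list_unique hT]
      exact Relation.EqvGen.symm _ _ hLL'

theorem coeff_g (e : Var →₀ ℕ) :
    MvPowerSeries.coeff e g = ({T : Tree | T.fullWeight = e}.ncard : ℤ) := by
  rw [← numFact_eq_ncard (e := e)
    (α := e.comapDomain Var.x (fun _ _ _ _ hab => Var.x.inj hab))
    (h := e.comapDomain Var.u (fun _ _ _ _ hab => Var.u.inj hab))
    (t := e.comapDomain Var.v (fun _ _ _ _ hab => Var.v.inj hab))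
    (fun _ => rfl) (fun _ => rfl) (fun _ => rfl)]
  rfl

/-! ### Generating functions -/

section GeneratingFunction

variable {T S : Type*} {w : T → Var →₀ ℕ} {w' : S → Var →₀ ℕ}

/-- Only finitely many objects have a given monomial. -/
def FiniteFibers (w : T → Var →₀ ℕ) : Prop := ∀ e, {t | w t = e}.Finite

/-- The sum of the monomials of all objects. -/
def gf (w : T → Var →₀ ℕ) : Series := ∑' t, MvPowerSeries.monomial (w t) (1 : ℤ)

theorem FiniteFibers.summable_coeff (hw : FiniteFibers w) (e : Var →₀ ℕ) :
    (Function.support fun t =>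
      MvPowerSeries.coeff e (MvPowerSeries.monomial (w t) (1 : ℤ))).Finite := by
  classical
  refine (hw e).subset fun t ht => ?_
  rw [Function.mem_support, MvPowerSeries.coeff_monomial] at ht
  by_contra h
  exact ht (if_neg fun h' => h h'.symm)

theorem FiniteFibers.summable (hw : FiniteFibers w) :
    Summable fun t => (MvPowerSeries.monomial (w t) (1 : ℤ) : Series) := by
  rw [MvPowerSeries.WithPiTopology.summable_iff_summable_coeff]
  exact fun e => summable_of_hasFiniteSupport (hw.summable_coeff e)

theorem coeff_gf (hw : FiniteFibers w) (e : Var →₀ ℕ) :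
    MvPowerSeries.coeff e (gf w) = ({t | w t = e}.ncard : ℤ) := by
  classical
  have h := MvPowerSeries.WithPiTopology.hasSum_iff_hasSum_coeff.1 hw.summable.hasSum e
  rw [gf, ← h.tsum_eq, tsum_eq_sum (s := (hw e).toFinset), Set.ncard_eq_toFinset_card _ (hw e),
    Finset.card_eq_sum_ones, Nat.cast_sum]
  · refine Finset.sum_congr rfl fun t ht => ?_
    rw [MvPowerSeries.coeff_monomial, if_pos ((Set.Finite.mem_toFinset _).1 ht).symm]
    rfl
  · intro t ht
    rw [MvPowerSeries.coeff_monomial, if_neg]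
    exact fun h' => ht ((Set.Finite.mem_toFinset _).2 h'.symm)

theorem FiniteFibers.comp_equiv (hw : FiniteFibers w) (E : S ≃ T) :
    FiniteFibers fun s => w (E s) :=
  fun e => (hw e).preimage E.injective.injOn

theorem gf_comp_equiv (E : S ≃ T) : gf (fun s => w (E s)) = gf w :=
  E.tsum_eq fun t => MvPowerSeries.monomial (w t) (1 : ℤ)

theorem FiniteFibers.prod (hw : FiniteFibers w) (hw' : FiniteFibers w') :
    FiniteFibers fun p : T × S => w p.1 + w' p.2 := by
  classical
  intro e
  refine ((Finset.HasAntidiagonal.antidiagonal e).finite_toSet.biUnion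
    fun q _ => (hw q.1).prod (hw' q.2)).subset fun p hp => ?_
  simp only [Set.mem_iUnion]
  exact ⟨(w p.1, w' p.2), by simpa using hp, rfl, rfl⟩

theorem gf_prod (hw : FiniteFibers w) (hw' : FiniteFibers w') :
    gf (fun p : T × S => w p.1 + w' p.2) = gf w * gf w' := by
  have h : ∀ p : T × S, (MvPowerSeries.monomial (w p.1 + w' p.2) (1 : ℤ) : Series) =
      MvPowerSeries.monomial (w p.1) 1 * MvPowerSeries.monomial (w' p.2) 1 := fun p => by
    rw [MvPowerSeries.monomial_mul_monomial, one_mul]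
  rw [gf, gf, gf, hw.summable.tsum_mul_tsum hw'.summable]
  · exact tsum_congr h
  · exact (hw.prod hw').summable.congr fun p => (h p)

/-- Both claims go through one induction, since the product formula needs finite fibres for shorter
tuples. -/
theorem finiteFibers_pi (hw : FiniteFibers w) (k : ℕ) :
    FiniteFibers (fun t : Fin k → T => ∑ i, w (t i)) ∧
      gf (fun t : Fin k → T => ∑ i, w (t i)) = gf w ^ k := by
  induction k with
  | zero =>
    refine ⟨fun e => Set.toFinite _, ?_⟩
    rw [gf, tsum_fintype, Fintype.sum_unique]
    simp
  | succ k ih =>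
    have h : ∀ t : Fin (k + 1) → T, ∑ i, w (t i) =
        (fun p : T × (Fin k → T) => w p.1 + ∑ i, w (p.2 i)) ((Fin.consEquiv fun _ => T).symm t) :=
      fun t => Fin.sum_univ_succ _
    simp only [h]
    refine ⟨(hw.prod ih.1).comp_equiv _, ?_⟩
    rw [gf_comp_equiv (w := fun p : T × (Fin k → T) => w p.1 + ∑ i, w (p.2 i)),
      gf_prod hw ih.1, ih.2, pow_succ']

open Classical in
theorem FiniteFibers.add_ite (hw : FiniteFibers w) (t₀ : T) (d : Var →₀ ℕ) :
    FiniteFibers fun t => w t + if t = t₀ then d else 0 := by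
  intro e
  refine ((hw e).insert t₀).subset fun t ht => ?_
  by_cases h : t = t₀
  · exact Or.inl h
  · exact Or.inr (by simpa [h] using ht)

-- The single object `t₀` contributes `d` instead of 1. With the tuple of empty trees as `t₀`, this
-- is where −1 + vₙ and −1 + uₙ come from.
open Classical in
theorem gf_add_ite (hw : FiniteFibers w) {t₀ : T} (h₀ : w t₀ = 0) (d : Var →₀ ℕ) :
    gf (fun t => w t + if t = t₀ then d else 0) =
      gf w - 1 + MvPowerSeries.monomial d (1 : ℤ) := by
  rw [gf, gf, hw.summable.tsum_eq_add_tsum_ite t₀,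
    (hw.add_ite t₀ d).summable.tsum_eq_add_tsum_ite t₀]
  have : ∀ t, (if t = t₀ then (0 : Series) else
      MvPowerSeries.monomial (w t + if t = t₀ then d else 0) (1 : ℤ)) =
      if t = t₀ then 0 else MvPowerSeries.monomial (w t) (1 : ℤ) := fun t => by
    split_ifs <;> simp
  simp only [this, h₀, if_true, zero_add, MvPowerSeries.monomial_zero_one]
  ring

theorem FiniteFibers.of_le (hw : FiniteFibers w) {w₁ : T → Var →₀ ℕ} (h : ∀ t, w t ≤ w₁ t) :
    FiniteFibers w₁ := by
  classical
  intro e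
  refine ((Set.finite_Icc 0 e).biUnion fun q _ => hw q).subset fun t ht => ?_
  simp only [Set.mem_iUnion]
  exact ⟨w t, ⟨zero_le, (h t).trans_eq ht⟩, rfl⟩

end GeneratingFunction

/-! ### The exchange of variables -/

theorem swapVar_swapVar (i : Var) : swapVar (swapVar i) = i := by cases i <;> rfl

theorem mapDomain_swapVar_swapVar (e : Var →₀ ℕ) :
    (e.mapDomain swapVar).mapDomain swapVar = e := by
  rw [← Finsupp.mapDomain_comp]
  have : (swapVar ∘ swapVar : Var → Var) = id := funext swapVar_swapVar
  rw [this, Finsupp.mapDomain_id]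

theorem mapDomain_swapVar_eq_iff {e e' : Var →₀ ℕ} :
    e.mapDomain swapVar = e' ↔ e = e'.mapDomain swapVar := by
  constructor
  · rintro rfl
    rw [mapDomain_swapVar_swapVar]
  · rintro rfl
    rw [mapDomain_swapVar_swapVar]

theorem coeff_hat (h : Series) (e : Var →₀ ℕ) :
    MvPowerSeries.coeff e (hat h) = MvPowerSeries.coeff (e.mapDomain swapVar) h := by
  have := MvPowerSeries.coeff_embDomain_rename swapVar.toEmbedding h (e.mapDomain swapVar)
  rw [Finsupp.embDomain_eq_mapDomain] at this
  change MvPowerSeries.coeff ((e.mapDomain swapVar).mapDomain swapVar) (hat h) = _ at this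
  rwa [mapDomain_swapVar_swapVar] at this

theorem hat_hat (h : Series) : hat (hat h) = h := by
  ext e
  rw [coeff_hat, coeff_hat, mapDomain_swapVar_swapVar]

theorem hat_sub (a b : Series) : hat (a - b) = hat a - hat b := map_sub _ a b

theorem hat_mul (a b : Series) : hat (a * b) = hat a * hat b := map_mul _ a b

theorem hat_pow (a : Series) (k : ℕ) : hat (a ^ k) = hat a ^ k := map_pow _ a k

theorem hat_one : hat 1 = 1 := map_one _

theorem hat_X (i : Var) : hat (MvPowerSeries.X i) = MvPowerSeries.X (swapVar i) :=
  MvPowerSeries.rename_X _ i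

theorem FiniteFibers.mapDomain {T : Type*} {w : T → Var →₀ ℕ} (hw : FiniteFibers w) :
    FiniteFibers fun t => (w t).mapDomain swapVar := fun e => by
  simpa only [mapDomain_swapVar_eq_iff] using hw (e.mapDomain swapVar)

theorem hat_gf {T : Type*} {w : T → Var →₀ ℕ} (hw : FiniteFibers w) :
    hat (gf w) = gf fun t => (w t).mapDomain swapVar := by
  ext e
  rw [coeff_hat, coeff_gf hw, coeff_gf hw.mapDomain]
  simp only [mapDomain_swapVar_eq_iff]

/-! ### The series `∑ x_n * G_n` -/

/-- The series `∑ x_n * G_n`. -/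
def xsum (G : Len → Series) : Series := ∑' n : Len, x n * G n

theorem xsum_add (G H : Len → Series) : xsum (fun n => G n + H n) = xsum G + xsum H := by
  simp only [xsum, mul_add]
  exact (summable_x_mul G).tsum_add (summable_x_mul H)

theorem xsum_sub (G H : Len → Series) : xsum (fun n => G n - H n) = xsum G - xsum H := by
  simp only [xsum, mul_sub]
  exact (summable_x_mul G).tsum_sub (summable_x_mul H)

theorem xsum_mul (G : Len → Series) (a : Series) : xsum (fun n => G n * a) = xsum G * a := by
  simp only [xsum, ← mul_assoc]
  exact (summable_x_mul G).tsum_mul_right a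

theorem coeff_xsum (G : Len → Series) (e : Var →₀ ℕ) :
    MvPowerSeries.coeff e (xsum G) = ∑' n, MvPowerSeries.coeff e (x n * G n) :=
  (MvPowerSeries.WithPiTopology.hasSum_iff_hasSum_coeff.1
    (summable_x_mul G).hasSum e).tsum_eq.symm

theorem hat_xsum (G : Len → Series) : hat (xsum G) = xsum fun n => hat (G n) := by
  ext e
  rw [coeff_hat, coeff_xsum, coeff_xsum]
  refine tsum_congr fun n => ?_
  rw [← coeff_hat, hat_mul, x, hat_X]
  rfl

/-! ### Uniqueness of the solution -/

/-- The series without terms of degree less than `N`. -/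
def lowIdeal (N : ℕ) : Ideal Series where
  carrier := {h | (N : ℕ∞) ≤ h.order}
  add_mem' ha hb := (le_min ha hb).trans MvPowerSeries.min_order_le_add
  zero_mem' := MvPowerSeries.le_order fun _ _ => rfl
  smul_mem' c _ ha := (le_add_left ha).trans (MvPowerSeries.le_order_mul (f := c))

theorem mem_lowIdeal {N : ℕ} {h : Series} :
    h ∈ lowIdeal N ↔ ∀ e, Finsupp.degree e < N → MvPowerSeries.coeff e h = 0 :=
  ⟨fun hh _ he => MvPowerSeries.coeff_of_lt_order ((Nat.cast_lt.2 he).trans_le hh),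
    MvPowerSeries.nat_le_order⟩

theorem hat_mem_lowIdeal {N : ℕ} {h : Series} (hh : h ∈ lowIdeal N) : hat h ∈ lowIdeal N := by
  rw [mem_lowIdeal] at hh ⊢
  intro e he
  rw [coeff_hat]
  exact hh _ (by rwa [Finsupp.degree_mapDomain])

theorem xsum_mem_lowIdeal {N : ℕ} {G : Len → Series} (hG : ∀ n, G n ∈ lowIdeal N) :
    xsum G ∈ lowIdeal (N + 1) := by
  rw [mem_lowIdeal]
  intro e he
  have h : ∀ n, x n * G n ∈ lowIdeal (N + 1) := fun n => by
    have h₁ : (1 : ℕ∞) ≤ (x n).order := by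
      rw [x, MvPowerSeries.X, MvPowerSeries.order_monomial]
      simp
    have h₂ : ((N + 1 : ℕ) : ℕ∞) ≤ (x n).order + (G n).order := by
      rw [add_comm, Nat.cast_add]
      exact add_le_add h₁ (hG n)
    exact h₂.trans MvPowerSeries.le_order_mul
  rw [coeff_xsum, tsum_congr fun n => mem_lowIdeal.1 (h n) e he, tsum_zero]

/-- The recursion is a contraction: if two solutions agree below degree `N`, so do the families
under the sum, and the factors `x n` gain one more degree. -/
theorem SolvesRecursion.unique {f f' : Series} (hf : SolvesRecursion f)
    (hf' : SolvesRecursion f') : f = f' := by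
  have key : ∀ N, f - f' ∈ lowIdeal N := by
    intro N
    induction N with
    | zero => exact mem_lowIdeal.2 fun e he => absurd he (Nat.not_lt_zero _)
    | succ N ih =>
      -- In the quotient ring the two solutions coincide, so their powers and products need no
      -- separate estimates.
      have h₁ := Ideal.Quotient.eq.2 ih
      have h₂ := Ideal.Quotient.eq.2 (hat_sub f f' ▸ hat_mem_lowIdeal ih)
      have h₃ : f - f' = xsum (fun n : Len => (f ^ n.1 - 1 + v n) * hat f ^ (n.1 - 1) -
          (f' ^ n.1 - 1 + v n) * hat f' ^ (n.1 - 1)) := by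
        rw [xsum_sub]
        conv_lhs => rw [hf, hf']
        exact add_sub_add_left_eq_sub _ _ _
      rw [h₃]
      refine xsum_mem_lowIdeal fun n => Ideal.Quotient.eq.1 ?_
      simp only [map_mul, map_pow, map_add, map_sub, h₁, h₂]
  ext e
  have := mem_lowIdeal.1 (key (Finsupp.degree e + 1)) e (Nat.lt_succ_self _)
  rwa [map_sub, sub_eq_zero] at this

/-! ### The generating functions of trees -/

namespace Tree

/-- Induction on the degree: the variable at the root makes every subtree weight smaller in degree,
and it must occur in `e`, which leaves finitely many arities. -/
theorem finite_weight_eq (N : ℕ) (e : Var →₀ ℕ) (he : Finsupp.degree e < N) :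
    {t : Tree | t.weight = e}.Finite := by
  classical
  induction N generalizing e with
  | zero => exact absurd he (Nat.not_lt_zero _)
  | succ N ih =>
    have ih' : ∀ q : Var →₀ ℕ, Finsupp.degree q < N →
        {t : Tree | t.weight.mapDomain swapVar = q}.Finite := fun q hq => by
      simpa only [mapDomain_swapVar_eq_iff] using
        ih (q.mapDomain swapVar) (by rwa [Finsupp.degree_mapDomain])
    have hI : (Set.Icc 0 e ∩ {q | Finsupp.degree q < N}).Finite :=
      (Set.finite_Icc 0 e).inter_of_left _
    have hF := hI.biUnion fun q hq => ih q hq.2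
    have hF' := hI.biUnion fun q hq => ih' q hq.2
    have hm : {m | Var.x (len m) ∈ (e.support : Set Var)}.Finite :=
      e.support.finite_toSet.preimage fun m _ m' _ h => by
        simpa [len] using congrArg Subtype.val (Var.x.inj h)
    refine ((hm.biUnion fun m _ => ((Set.Finite.pi' fun _ : Fin (m + 2) => hF).prod
      (Set.Finite.pi' fun _ : Fin (m + 1) => hF')).image
        fun p => node m p.1 p.2).insert nil).subset fun t ht => ?_
    cases t with
    | nil => exact Or.inl rfl
    | node m b a =>
      right
      rw [Set.mem_ofPred_eq, weight] at ht
      have hx : ∀ q : Var →₀ ℕ, Finsupp.single (Var.x (len m)) 1 + q ≤ e →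
          q ∈ Set.Icc 0 e ∩ {q | Finsupp.degree q < N} := fun q hq => by
        refine ⟨⟨zero_le, le_add_self.trans hq⟩, ?_⟩
        have h₁ := Finsupp.degree_mono hq
        rw [map_add, Finsupp.degree_single] at h₁
        rw [Set.mem_ofPred_eq]
        omega
      have hb : ∀ i, Finsupp.single (Var.x (len m)) 1 + (b i).weight ≤ e := fun i => by
        rw [← ht, add_assoc, add_assoc]
        refine add_le_add le_rfl (le_add_left (le_add_right ?_))
        exact Finset.single_le_sum (f := fun i => (b i).weight) (fun _ _ => zero_le)
          (Finset.mem_univ i)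
      have ha : ∀ i, Finsupp.single (Var.x (len m)) 1 + (a i).weight.mapDomain swapVar ≤ e :=
        fun i => by
          rw [← ht, add_assoc, add_assoc]
          refine add_le_add le_rfl (le_add_left (le_add_left ?_))
          exact Finset.single_le_sum (f := fun i => (a i).weight.mapDomain swapVar)
            (fun _ _ => zero_le) (Finset.mem_univ i)
      simp only [Set.mem_iUnion]
      refine ⟨m, ?_, (b, a), ⟨fun i => ?_, fun i => ?_⟩, rfl⟩
      · have h₁ := (le_add_right le_rfl).trans (hb 0) (Var.x (len m))
        rw [Finsupp.single_eq_same] at h₁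
        simp only [Set.mem_ofPred_eq, Finset.mem_coe, Finsupp.mem_support_iff]
        omega
      · exact ⟨_, hx _ (hb i), rfl⟩
      · exact ⟨_, hx _ (ha i), rfl⟩

theorem finiteFibers_weight : FiniteFibers weight := fun e =>
  finite_weight_eq _ e (Nat.lt_succ_self _)

theorem finiteFibers_fullWeight : FiniteFibers fullWeight :=
  finiteFibers_weight.of_le fun t => by
    classical
    cases t with
    | nil => exact zero_le
    | node m b a =>
      rw [fullWeight]
      exact le_add_right le_rfl

/-- The data at the root of a nonempty tree. -/
abbrev Branches : Type := Σ m : ℕ, (Fin (m + 2) → Tree) × (Fin (m + 1) → Tree)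

/-- The tree with given data at the root. -/
def ofBranches (p : Branches) : Tree := node p.1 p.2.1 p.2.2

theorem ofBranches_injective : Function.Injective ofBranches := by
  rintro ⟨m, b, a⟩ ⟨m', b', a'⟩ h
  obtain ⟨rfl, h₁, h₂⟩ := node.inj h
  obtain rfl : b = b' := eq_of_heq h₁
  obtain rfl : a = a' := eq_of_heq h₂
  rfl

/-- The possible lengths are the numbers `m + 2`. -/
def lenEquiv : ℕ ≃ Len where
  toFun := len
  invFun j := j.1 - 2
  left_inv _ := rfl
  right_inv j := Subtype.ext (Nat.sub_add_cancel j.2)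

/-- Nonempty trees are triples `(m, b, a)`, so a weight that splits over the right and left subtrees
gives a product for each arity. General weights are allowed so that f and g are both covered. -/
theorem gf_eq_of_branches {w : Tree → Var →₀ ℕ} (hw : FiniteFibers w) (h₀ : w nil = 0)
    {wb : ∀ m, (Fin (m + 2) → Tree) → Var →₀ ℕ} {wa : ∀ m, (Fin (m + 1) → Tree) → Var →₀ ℕ}
    (hwb : ∀ m, FiniteFibers (wb m)) (hwa : ∀ m, FiniteFibers (wa m))
    (h : ∀ m b a, w (node m b a) = Finsupp.single (Var.x (len m)) 1 + (wb m b + wa m a))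
    {G : Len → Series} (hG : ∀ m, G (len m) = gf (wb m) * gf (wa m)) :
    gf w = 1 + xsum G := by
  classical
  rw [gf, hw.summable.tsum_eq_add_tsum_ite nil, h₀, MvPowerSeries.monomial_zero_one]
  congr 1
  have hs : Function.support (fun t => if t = nil then (0 : Series) else
      MvPowerSeries.monomial (w t) (1 : ℤ)) ⊆ Set.range ofBranches := fun t ht => by
    cases t with
    | nil => simp at ht
    | node m b a => exact ⟨⟨m, b, a⟩, rfl⟩
  have hm : ∀ m, (fun p : (Fin (m + 2) → Tree) × (Fin (m + 1) → Tree) =>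
      (MvPowerSeries.monomial (w (node m p.1 p.2)) (1 : ℤ) : Series)) =
      fun p => x (len m) * MvPowerSeries.monomial (wb m p.1 + wa m p.2) 1 := fun m => by
    funext p
    rw [h, x, MvPowerSeries.X, MvPowerSeries.monomial_mul_monomial, one_mul]
  have hsm := fun m => ((hwb m).prod (hwa m)).summable.mul_left (x (len m))
  rw [← ofBranches_injective.tsum_eq hs]
  have hi : ∀ p : Branches, (if ofBranches p = nil then (0 : Series) else
      MvPowerSeries.monomial (w (ofBranches p)) (1 : ℤ)) =
      MvPowerSeries.monomial (w (ofBranches p)) 1 := fun p => if_neg (by simp [ofBranches])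
  have hs' : Summable fun p : Branches =>
      (MvPowerSeries.monomial (w (ofBranches p)) (1 : ℤ) : Series) :=
    hw.summable.comp_injective ofBranches_injective
  rw [tsum_congr hi, hs'.tsum_sigma' fun m => ?_, xsum, ← lenEquiv.tsum_eq]
  · refine tsum_congr fun m => ?_
    change ∑' p : (Fin (m + 2) → Tree) × (Fin (m + 1) → Tree),
      (MvPowerSeries.monomial (w (node m p.1 p.2)) (1 : ℤ) : Series) = x (len m) * G (len m)
    rw [hm, ((hwb m).prod (hwa m)).summable.tsum_mul_left, hG, ← gf_prod (hwb m) (hwa m)]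
    rfl
  · change Summable fun p : (Fin (m + 2) → Tree) × (Fin (m + 1) → Tree) =>
      (MvPowerSeries.monomial (w (node m p.1 p.2)) (1 : ℤ) : Series)
    rw [hm]
    exact hsm m

theorem forall_eq_nil_iff {k : ℕ} {b : Fin k → Tree} : (∀ i, b i = nil) ↔ b = fun _ => nil :=
  funext_iff.symm

theorem solvesRecursion : SolvesRecursion (gf weight) := by
  classical
  have hw := finiteFibers_weight
  have hb := fun k => finiteFibers_pi hw k
  have ha := fun k => finiteFibers_pi hw.mapDomain k
  refine gf_eq_of_branches hw rfl
    (fun m => (hb (m + 2)).1.add_ite (fun _ => nil) (Finsupp.single (Var.v (len m)) 1))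
    (fun m => (ha (m + 1)).1) (fun m b a => ?_) fun m => ?_
  · by_cases h : b = fun _ => nil <;>
      simp only [weight, forall_eq_nil_iff, h, implies_true, ↓reduceIte] <;> abel
  · rw [gf_add_ite (hb _).1 (by simp [weight]), (hb _).2, (ha _).2, ← hat_gf hw]
    rfl

/-- As for `solvesRecursion`, but the root may also be a head, so empty left subtrees contribute uₙ
in place of 1. The subtrees below keep the weight of f. -/
theorem gf_fullWeight : gf fullWeight = 1 + xsum fun n =>
    (gf weight ^ n.1 - 1 + v n) * (hat (gf weight) ^ (n.1 - 1) - 1 + u n) := by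
  classical
  have hw := finiteFibers_weight
  have hb := fun k => finiteFibers_pi hw k
  have ha := fun k => finiteFibers_pi hw.mapDomain k
  refine gf_eq_of_branches finiteFibers_fullWeight rfl
    (fun m => (hb (m + 2)).1.add_ite (fun _ => nil) (Finsupp.single (Var.v (len m)) 1))
    (fun m => (ha (m + 1)).1.add_ite (fun _ => nil) (Finsupp.single (Var.u (len m)) 1))
    (fun m b a => ?_) fun m => ?_
  · by_cases h : b = fun _ => nil <;> by_cases h' : a = fun _ => nil <;>
      simp only [fullWeight, weight, forall_eq_nil_iff, h, h', implies_true, ↓reduceIte] <;> abel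
  · rw [gf_add_ite (hb _).1 (by simp [weight]), gf_add_ite (ha _).1 (by simp [weight]),
      (hb _).2, (ha _).2, ← hat_gf hw]
    rfl

end Tree

theorem g_eq_gf : g = gf Tree.fullWeight := by
  ext e
  rw [coeff_g, coeff_gf Tree.finiteFibers_fullWeight]

/-! ### The two closed formulas for `g` -/

section Identities

variable {f : Series}

theorem SolvesRecursion.g_eq_xsum (hf : SolvesRecursion f) : g = 1 + xsum fun n =>
    (f ^ n.1 - 1 + v n) * (hat f ^ (n.1 - 1) - 1 + u n) := by
  rw [hf.unique Tree.solvesRecursion, g_eq_gf, Tree.gf_fullWeight]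

/-- Subtracting the recursion leaves −(1 − uₙ)(fⁿ − 1 + vₙ) as the coefficient of xₙ. -/
theorem SolvesRecursion.g_eq (hf : SolvesRecursion f) :
    g = f - xsum (fun n => (1 - u n) * f ^ n.1) + xsum fun n => (1 - u n) * (1 - v n) := by
  have h : f = 1 + xsum fun n => (f ^ n.1 - 1 + v n) * hat f ^ (n.1 - 1) := hf
  conv_rhs => enter [1, 1]; rw [h]
  rw [hf.g_eq_xsum, add_sub_assoc, add_assoc, ← xsum_sub, ← xsum_add]
  congr 2
  funext n
  ring

/-- The two expressions for `g` agree. -/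
theorem SolvesRecursion.mul_hat_sub (hf : SolvesRecursion f) :
    f * hat f - xsum (fun n => (f * hat f) ^ n.1) = f - xsum fun n => (1 - u n) * f ^ n.1 := by
  have h : f = 1 + xsum fun n => (f ^ n.1 - 1 + v n) * hat f ^ (n.1 - 1) := hf
  -- This is the recursion multiplied by f̂; the powers (f f̂)ⁿ cancel.
  have h₁ : f * hat f - xsum (fun n => (f * hat f) ^ n.1) =
      hat f - xsum fun n => (1 - v n) * hat f ^ n.1 := by
    conv_lhs => enter [1, 1]; rw [h]
    -- Zero is written as a difference of two zero sums so that the right side also becomes f̂ plus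
    -- a single `xsum`, and the families can be compared termwise.
    rw [add_mul, one_mul, ← xsum_mul, add_sub_assoc, ← xsum_sub, sub_eq_add_neg, ← zero_sub,
      ← sub_self (xsum fun _ => 0), sub_sub, ← xsum_add, ← xsum_sub]
    congr 2
    funext n
    rw [mul_assoc, ← pow_succ, Nat.sub_add_cancel (one_le_two.trans n.2), mul_pow]
    ring
  -- The left side of `h₁` is invariant under `hat`, so only the right side changes.
  have h₂ := congrArg hat h₁
  simp only [hat_sub, hat_mul, hat_hat, hat_xsum, hat_pow, hat_one] at h₂
  rw [mul_comm (hat f) f] at h₂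
  rw [h₂]
  congr 2
  funext n
  rw [v, hat_X]
  rfl

end Identities

end CycleFactorization

end

theorem theorem3 :
    (∃! f : CycleFactorization.Series, CycleFactorization.SolvesRecursion f) ∧
    ∀ f : CycleFactorization.Series, CycleFactorization.SolvesRecursion f →
      (CycleFactorization.g =
        f - ∑' n : CycleFactorization.Len,
              CycleFactorization.x n * ((1 - CycleFactorization.u n) * f ^ n.1)
          + ∑' n : CycleFactorization.Len,
              CycleFactorization.x n *
                ((1 - CycleFactorization.u n) * (1 - CycleFactorization.v n))) ∧
      (CycleFactorization.g =
        f * CycleFactorization.hat f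
          - ∑' n : CycleFactorization.Len,
              CycleFactorization.x n * (f * CycleFactorization.hat f) ^ n.1
          + ∑' n : CycleFactorization.Len,
              CycleFactorization.x n *
                ((1 - CycleFactorization.u n) * (1 - CycleFactorization.v n))) := by
  exact ⟨⟨_, CycleFactorization.Tree.solvesRecursion, fun _ hf =>
      hf.unique CycleFactorization.Tree.solvesRecursion⟩,
    fun _ hf => ⟨hf.g_eq, hf.g_eq.trans (by rw [← hf.mul_hat_sub]; rfl)⟩⟩
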